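/- **Setting.** Let $E$ be $\mathbb{R}^n$ with an arbitrary norm $\|\cdot\|$ and dual norm $\|\cdot\|_*$, let $X\subseteq E$ be convex and compact, and consider $$\min_{x\in X}\ \psi_0(x)=f_0(x)+\chi_0(x)\quad\text{s.t.}\quad \psi_i(x)=f_i(x)+\chi_i(x)\le 0,\quad i=1,\dots,m,$$ where $f_0,f_i,\chi_i$ ($i=1,\dots,m$) are convex and continuous on $X$ and $\chi_0:X\to\mathbb{R}$ is convex and lower semicontinuous. Write $f=(f_1,\dots,f_m)$, $\chi=(\chi_1,\dots,\chi_m)$, $\psi=f+\chi$, let $[\cdot]_+$ be the (componentwise) positive part, and $\|\cdot\|_2$ the Euclidean norm. Let $\omega$ be continuously differentiable on $X$ with Lipschitz gradient and $1$-strongly convex with respect to $\|\cdot\|$, $W(z,x)=\omega(z)-\omega(x)-\langle\nabla\omega(x),z-x\rangle$ and $D_X=\max_{x,z\in X}\sqrt{2W(x,z)}$. For convex $h$ on $X$, $\partial h(x)$ is the set of subgradients (relative to $X$) if $x$ is in the relative interior of $X$; at other points of $X$ it is the set of limits of subgradients taken at relative interior points converging to $x$. Assume that, for nonnegative constants $L_0,H_0,L_i,H_i,M_{f,i},M_{\chi,i}$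 and some $\alpha_0>0$, for all $x_1,x_2\in X$: * $f_i(x_1)-f_i(x_2)-\langle f_i',x_1-x_2\rangle\le \frac{L_i}{2}\|x_1-x_2\|^2+H_i\|x_1-x_2\|$ for all $f_i'\in\partial f_i(x_2)$, $i=0,\dots,m$; * $f_i(x_1)-f_i(x_2)\le M_{f,i}\|x_1-x_2\|$ and $\chi_i(x_1)-\chi_i(x_2)\le M_{\chi,i}\|x_1-x_2\|$, $i=1,\dots,m$; * $\chi_0(x_1)\ge\chi_0(x_2)+\langle g,x_1-x_2\rangle+\alpha_0W(x_1,x_2)$ for all $g\in\partial\chi_0(x_2)$. Let $L_f,H_f,M_f,M_\chi$ be the Euclidean norms of $(L_i)_{i=1}^m$, $(H_i)_{i=1}^m$, $(M_{f,i})_{i=1}^m$, $(M_{\chi,i})_{i=1}^m$. Assume that $(x^*,y^*)\in X\times\mathbb{R}^m_+$ is a saddle point of $\mathcal{L}(x,y)=\psi_0(x)+\langle y,\psi(x)\rangle$, i.e. $\mathcal L(x^*,y)\le\mathcal L(x^*,y^*)\le\mathcal L(x,y^*)$ for all $x\in X$, $y\ge 0$. **Oracle.** For $x\in X$ and a random sample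 $\xi$, the oracle returns $G_0(x,\xi),G_1(x,\xi),\dots,G_m(x,\xi)$ and $F(x,\xi)\in\mathbb{R}^m$ with $\mathbb{E}[G_i(x,\xi)]=f_i'(x)\in\partial f_i(x)$ and $\mathbb{E}\|G_i(x,\xi)-f_i'(x)\|_*^2\le\sigma_i^2$ for $i=0,\dots,m$, and $\mathbb{E}[F(x,\xi)]=f(x)$, $\mathbb{E}\|F(x,\xi)-f(x)\|_2^2\le\sigma_f^2$. Let $\sigma=(\sigma_1,\dots,\sigma_m)$, and let $\xi_t,\bar\xi_t$ ($t\ge0$) be mutually independent copies of $\xi$. **ConEx method.** Given $x_0\in X$, $y_0\in\mathbb R^m$, stepsizes $\gamma_t,\tau_t,\eta_t,\theta_t$ and $T$, put $x_{-1}=x_0$, $\ell_F(x_0)=\ell_F(x_{-1})=F(x_0,\bar\xi_0)$ and $\ell_F(x_t)=F(x_{t-1},\bar\xi_{t-1})+\big(\langle G_i(x_{t-1},\bar\xi_{t-1}),x_t-x_{t-1}\rangle\big)_{i=1}^m$ for $t\ge1$. For $t=0,\dots,T-1$, $$s_t=(1+\theta_t)[\chi(x_t)+\ell_F(x_t)]-\theta_t[\chi(x_{t-1})+\ell_F(x_{t-1})],\qquad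 y_{t+1}=\big[y_t+\tfrac1{\tau_t}s_t\big]_+,$$ $$x_{t+1}=\operatorname*{argmin}_{x\in X}\Big\{\chi_0(x)+\sum_{i=1}^m y_{t+1}^{(i)}\chi_i(x)+\Big\langle G_0(x_t,\xi_t)+\sum_{i=1}^m y_{t+1}^{(i)}G_i(x_t,\xi_t),x\Big\rangle+\eta_tW(x,x_t)\Big\},$$ and the output is $\bar x_T=\big(\sum_{t=0}^{T-1}\gamma_t\big)^{-1}\sum_{t=0}^{T-1}\gamma_tx_{t+1}$. **Theorem.** Let $B\ge1$, $t_0=\frac{4(L_0+BL_f)}{\alpha_0}+2$, $\mathcal M=\max\{2M_f,M_\chi+M_f\}$, $\sigma_{X,f}=(\sigma_f^2+D_X^2\|\sigma\|_2^2)^{1/2}$. Set $y_0=\mathbf 0$ and $$\gamma_t=t+t_0+2,\quad \eta_t=\frac{\alpha_0(t+t_0+1)}2,\quad \theta_t=\frac{t+t_0+1}{t+t_0+2},\quad \tau_t=\frac1{t+1}\max\Big\{\frac{32\mathcal M^2}{\alpha_0},\frac{384\|\sigma\|_2^2T}{\alpha_0},\frac{\sigma_{X,f}T^{3/2}}{B(t_0+2)^{1/2}}\Big\}$$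 (with the convention $1/\tau_t:=0$ in the degenerate case $\tau_t=0$). Put $$\mathcal H_*=H_0+(\|y^*\|_2+1)H_f+\frac{L_fD_X[\|y^*\|_2+1-B]_+}2,$$ $$\zeta=2e\Big\{\sigma_0^2+12(t_0+3)\|\sigma\|_2^2\|y^*\|_2^2+96(t_0+2)B^2\|\sigma\|_2^2+\frac{\mathcal H_*^2}2+\frac{3\alpha_0B\sigma_{X,f}(t_0+2)^{3/2}}2\Big\}^{1/2}.$$ Then for every $T\ge1$ the following expectations are finite and $$\mathbb E[\psi_0(\bar x_T)-\psi_0(x^*)]\le\frac{\alpha_0(t_0+1)(t_0+2)D_X^2}{T^2}+\frac{12B\sigma_{X,f}(t_0+1)(t_0+2)^{1/2}}{T^{3/2}}+\frac{16(\zeta^2+H_0^2)}{\alpha_0T}+\frac{8B(t_0+2)^{1/2}\sigma_{X,f}}{T^{1/2}},$$ $$\begin{aligned}\mathbb E\|[\psi(\bar x_T)]_+\|_2\le{}&\frac{192(t_0+2)(\|y^*\|_2+1)^2\mathcal M^2}{\alpha_0T^2}+\frac{\alpha_0(t_0+1)(t_0+2)D_X^2}{T^2}+\frac{13B\sigma_{X,f}(t_0+1)(t_0+2)^{1/2}}{T^{3/2}}\\&+\frac{16\big(\zeta^2+\mathcal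 H_*^2+144(t_0+2)(\|y^*\|_2+1)^2\|\sigma\|_2^2\big)}{\alpha_0T}\\&+\Big\{\frac{6(t_0+2)^{1/2}(\|y^*\|_2+1)^2\sigma_{X,f}}B+\frac{26B(t_0+2)^{1/2}\sigma_{X,f}}3\Big\}\frac1{T^{1/2}},\end{aligned}$$ $$\begin{aligned}\mathbb E[W(x^*,x_T)]\le{}&\frac{192(t_0+2)(\|y^*\|_2+1)^2\mathcal M^2}{\alpha_0^2T^2}+\frac{(t_0+1)(t_0+2)D_X^2}{T^2}+\frac{12B\sigma_{X,f}(t_0+1)(t_0+2)^{1/2}}{\alpha_0T^{3/2}}\\&+\frac{16\big(\zeta^2+\mathcal H_*^2+144(t_0+2)(\|y^*\|_2+1)^2\|\sigma\|_2^2\big)}{\alpha_0^2T}\\&+\frac{(t_0+2)^{1/2}\|y^*\|_2^2\sigma_{X,f}}{B\alpha_0}\frac1{T^{1/2}}+\frac{8B(t_0+2)^{1/2}\sigma_{X,f}}{\alpha_0T^{1/2}}.\end{aligned}$$ -/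

import Mathlib

open MeasureTheory ProbabilityTheory Filter Topology

namespace ConEx

/-- `ℝ^m` with the Euclidean norm `‖·‖₂`. -/
abbrev Vec (m : ℕ) : Type := EuclideanSpace ℝ (Fin m)

/-- The vector with given components. -/
def mkVec {m : ℕ} (a : Fin m → ℝ) : Vec m := WithLp.toLp 2 a

/-- `[v]₊`, the componentwise positive part. -/
def posVec {m : ℕ} (v : Vec m) : Vec m := mkVec fun i => max (v i) 0

section Problem

variable {E : Type*} [NormedAddCommGroup E] [NormedSpace ℝ E]

/-- Subdifferential, relative to the convex set `X`, of a function `h` on `X`.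
Subgradients are elements of the dual space; the pairing `⟨h', x⟩` is `h' x` and the dual norm
`‖h'‖_*` is the operator norm.  At a point of the relative interior of `X` it consists of all
subgradients.  At the remaining points of `X` it consists of all limits of
subgradients taken at points of the relative interior.  (Only the values of a subgradient on the
span of `X - X` matter, so no representative of it is singled out.) -/
def subdiff (X : Set E) (h : E → ℝ) (x : E) : Set (StrongDual ℝ E) :=
  {g | (x ∈ intrinsicInterior ℝ X ∧ ∀ z ∈ X, h x + g (z - x) ≤ h z) ∨
    (x ∈ X \ intrinsicInterior ℝ X ∧
      ∃ (u : ℕ → E) (k : ℕ → StrongDual ℝ E),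
        (∀ j, u j ∈ intrinsicInterior ℝ X ∧ ∀ z ∈ X, h (u j) + k j (z - u j) ≤ h z) ∧
        Tendsto u atTop (𝓝 x) ∧ Tendsto k atTop (𝓝 g))}

/-- The distance generating function `ω`: continuously differentiable on `X` with `Lω`-Lipschitz
gradient and `1`-strongly convex with respect to the norm of `E`. -/
structure DistGen (X : Set E) where
  ω : E → ℝ
  grad : E → StrongDual ℝ E
  Lω : ℝ
  hasGrad : ∀ x ∈ X, HasFDerivWithinAt ω (grad x) X x
  lipschitz : ∀ x ∈ X, ∀ z ∈ X, ‖grad x - grad z‖ ≤ Lω * ‖x - z‖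
  strongConvex : ∀ x ∈ X, ∀ z ∈ X, ω x + grad x (z - x) + (1 / 2) * ‖z - x‖ ^ 2 ≤ ω z

/-- The prox-function (Bregman distance) `W(z, x) = ω(z) - ω(x) - ⟨∇ω(x), z - x⟩`. -/
def DistGen.W {X : Set E} (d : DistGen X) (z x : E) : ℝ :=
  d.ω z - d.ω x - d.grad x (z - x)

/-- `D_X = max_{x, z ∈ X} √(2 W(x, z))`. -/
noncomputable def DistGen.diam {X : Set E} (d : DistGen X) : ℝ :=
  sSup ((fun p : E × E => Real.sqrt (2 * d.W p.1 p.2)) '' (X ×ˢ X))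

/-- `r` is `β`-strongly convex with respect to `W`. -/
def StronglyConvexWrt {X : Set E} (d : DistGen X) (β : ℝ) (r : E → ℝ) : Prop :=
  ∀ x ∈ X, ∀ z ∈ X, ∀ g ∈ subdiff X r z, r z + g (x - z) + β * d.W x z ≤ r x

/-- The data of the problem
`min_{x ∈ X} ψ₀(x) = f₀(x) + χ₀(x)` subject to `ψᵢ(x) = fᵢ(x) + χᵢ(x) ≤ 0`, `i = 1, …, m`. -/
structure Problem (E : Type*) (m : ℕ) where
  X : Set E
  f₀ : E → ℝ
  χ₀ : E → ℝ
  f : Fin m → E → ℝ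
  χ : Fin m → E → ℝ

variable {m : ℕ}

/-- The standing assumptions on the problem in the convex setting. -/
structure Problem.IsConvex (p : Problem E m) : Prop where
  convex_X : Convex ℝ p.X
  compact_X : IsCompact p.X
  convex_f₀ : ConvexOn ℝ p.X p.f₀
  continuous_f₀ : ContinuousOn p.f₀ p.X
  convex_χ₀ : ConvexOn ℝ p.X p.χ₀
  lsc_χ₀ : LowerSemicontinuousOn p.χ₀ p.X
  convex_f : ∀ i, ConvexOn ℝ p.X (p.f i)
  continuous_f : ∀ i, ContinuousOn (p.f i) p.X
  convex_χ : ∀ i, ConvexOn ℝ p.X (p.χ i)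
  continuous_χ : ∀ i, ContinuousOn (p.χ i) p.X

def Problem.ψ₀ (p : Problem E m) (x : E) : ℝ := p.f₀ x + p.χ₀ x

def Problem.fVec (p : Problem E m) (x : E) : Vec m := mkVec fun i => p.f i x

def Problem.χVec (p : Problem E m) (x : E) : Vec m := mkVec fun i => p.χ i x

def Problem.ψ (p : Problem E m) (x : E) : Vec m := mkVec fun i => p.f i x + p.χ i x

/-- The Lagrange function `ℒ(x, y) = ψ₀(x) + ∑ᵢ yᵢ ψᵢ(x)`. -/
def Problem.lagrangian (p : Problem E m) (x : E) (y : Vec m) : ℝ :=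
  p.ψ₀ x + ∑ i, y i * p.ψ x i

/-- `(xs, ys)` is a saddle point of the Lagrange function on `X × ℝ^m_+`. -/
structure Problem.IsSaddlePoint (p : Problem E m) (xs : E) (ys : Vec m) : Prop where
  mem_X : xs ∈ p.X
  nonneg : ∀ i, 0 ≤ ys i
  dual : ∀ y : Vec m, (∀ i, 0 ≤ y i) → p.lagrangian xs y ≤ p.lagrangian xs ys
  primal : ∀ x ∈ p.X, p.lagrangian xs ys ≤ p.lagrangian x ys

/-- `z = prox(w, v, x̃, η)`, i.e. `z` minimizes
`χ₀(x) + ∑ᵢ wᵢ χᵢ(x) + ⟨v, x⟩ + η W(x, x̃)` over `x ∈ X`. -/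
def Problem.IsProx (p : Problem E m) (d : DistGen p.X) (w : Vec m) (v : StrongDual ℝ E)
    (xt : E) (η : ℝ) (z : E) : Prop :=
  z ∈ p.X ∧
    IsMinOn (fun x => p.χ₀ x + ∑ i, w i * p.χ i x + v x + η * d.W x xt) p.X z

end Problem

/-- The constants of the problem, of the oracle and of the method: smoothness constants `L`,
nonsmoothness constants `H`, Lipschitz constants `Mf`, `Mχ`, noise levels `σ₀`, `σ`, `σf`, the
strong convexity modulus `α₀` and the parameter `B`. -/
structure Constants (m : ℕ) where
  α₀ : ℝ
  B : ℝ
  L₀ : ℝ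
  H₀ : ℝ
  L : Fin m → ℝ
  H : Fin m → ℝ
  Mf : Fin m → ℝ
  Mχ : Fin m → ℝ
  σ₀ : ℝ
  σ : Fin m → ℝ
  σf : ℝ
  α₀_pos : 0 < α₀
  one_le_B : 1 ≤ B
  L₀_nonneg : 0 ≤ L₀
  H₀_nonneg : 0 ≤ H₀
  L_nonneg : ∀ i, 0 ≤ L i
  H_nonneg : ∀ i, 0 ≤ H i
  Mf_nonneg : ∀ i, 0 ≤ Mf i
  Mχ_nonneg : ∀ i, 0 ≤ Mχ i
  σ₀_nonneg : 0 ≤ σ₀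
  σ_nonneg : ∀ i, 0 ≤ σ i
  σf_nonneg : 0 ≤ σf

namespace Constants

variable {m : ℕ} (c : Constants m)

noncomputable def LfAgg : ℝ := ‖mkVec c.L‖

noncomputable def HfAgg : ℝ := ‖mkVec c.H‖

noncomputable def MfAgg : ℝ := ‖mkVec c.Mf‖

noncomputable def MχAgg : ℝ := ‖mkVec c.Mχ‖

/-- `‖σ‖₂` for `σ = (σ₁, …, σ_m)`. -/
noncomputable def σNorm : ℝ := ‖mkVec c.σ‖

noncomputable def t₀ : ℝ := 4 * (c.L₀ + c.B * c.LfAgg) / c.α₀ + 2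

noncomputable def calM : ℝ := max (2 * c.MfAgg) (c.MχAgg + c.MfAgg)

/-- `σ_{X,f} = (σ_f² + D² ‖σ‖₂²)^{1/2}`. -/
noncomputable def σX (D : ℝ) : ℝ := Real.sqrt (c.σf ^ 2 + D ^ 2 * c.σNorm ^ 2)

noncomputable def γ (t : ℕ) : ℝ := t + c.t₀ + 2

noncomputable def η (t : ℕ) : ℝ := c.α₀ * (t + c.t₀ + 1) / 2

noncomputable def θ (t : ℕ) : ℝ := (t + c.t₀ + 1) / (t + c.t₀ + 2)

noncomputable def τ (D : ℝ) (T t : ℕ) : ℝ :=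
  1 / ((t : ℝ) + 1) *
    max (max (32 * c.calM ^ 2 / c.α₀) (384 * c.σNorm ^ 2 * T / c.α₀))
      (c.σX D * (T : ℝ) ^ (3 / 2 : ℝ) / (c.B * Real.sqrt (c.t₀ + 2)))

/-- `ℋ_*`, where `N` stands for `‖y^*‖₂`. -/
noncomputable def calH (D N : ℝ) : ℝ :=
  c.H₀ + (N + 1) * c.HfAgg + c.LfAgg * D * max (N + 1 - c.B) 0 / 2

/-- `ζ`, where `N` stands for `‖y^*‖₂`. -/
noncomputable def ζ (D N : ℝ) : ℝ :=
  2 * Real.exp 1 *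
    Real.sqrt (c.σ₀ ^ 2 + 12 * (c.t₀ + 3) * c.σNorm ^ 2 * N ^ 2
      + 96 * (c.t₀ + 2) * c.B ^ 2 * c.σNorm ^ 2 + c.calH D N ^ 2 / 2
      + 3 * c.α₀ * c.B * c.σX D * (c.t₀ + 2) ^ (3 / 2 : ℝ) / 2)

end Constants

section Oracle

variable {E : Type*} [NormedAddCommGroup E] [NormedSpace ℝ E] {m : ℕ}

/-- `h` satisfies `h(x₁) - h(x₂) - ⟨h', x₁ - x₂⟩ ≤ (L/2) ‖x₁ - x₂‖² + H ‖x₁ - x₂‖` for all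
`x₁, x₂ ∈ X` and all `h' ∈ ∂h(x₂)`. -/
def SmoothPlusNonsmooth (X : Set E) (h : E → ℝ) (L H : ℝ) : Prop :=
  ∀ x₁ ∈ X, ∀ x₂ ∈ X, ∀ g ∈ subdiff X h x₂,
    h x₁ - h x₂ - g (x₁ - x₂) ≤ L / 2 * ‖x₁ - x₂‖ ^ 2 + H * ‖x₁ - x₂‖

/-- The regularity assumptions on the problem data. -/
structure Problem.Regular (p : Problem E m) (d : DistGen p.X) (c : Constants m) : Prop where
  smooth_f₀ : SmoothPlusNonsmooth p.X p.f₀ c.L₀ c.H₀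
  smooth_f : ∀ i, SmoothPlusNonsmooth p.X (p.f i) (c.L i) (c.H i)
  lip_f : ∀ i, ∀ x₁ ∈ p.X, ∀ x₂ ∈ p.X, p.f i x₁ - p.f i x₂ ≤ c.Mf i * ‖x₁ - x₂‖
  lip_χ : ∀ i, ∀ x₁ ∈ p.X, ∀ x₂ ∈ p.X, p.χ i x₁ - p.χ i x₂ ≤ c.Mχ i * ‖x₁ - x₂‖
  strong_χ₀ : StronglyConvexWrt d c.α₀ p.χ₀

/-- The outputs of a stochastic oracle at a query point `x ∈ X` and a sample `s : S`: stochastic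
subgradients `G₀(x, s)`, `Gᵢ(x, s)` and the stochastic constraint value `F(x, s)`. -/
structure Oracle (E : Type*) [NormedAddCommGroup E] [NormedSpace ℝ E] (m : ℕ) (S : Type*) where
  G₀ : E → S → StrongDual ℝ E
  G : Fin m → E → S → StrongDual ℝ E
  F : E → S → Vec m

variable {S : Type*}

/-- The oracle is unbiased with bounded second moments of the noise, for a sample of law `P`, with
respect to subgradient selections `f₀'(x) ∈ ∂f₀(x)`, `fᵢ'(x) ∈ ∂fᵢ(x)`. -/
structure Oracle.IsStochasticOracle [MeasurableSpace E] [BorelSpace E] [MeasurableSpace S]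
    (o : Oracle E m S) (p : Problem E m) (c : Constants m) (P : Measure S)
    (f₀' : E → StrongDual ℝ E) (f' : Fin m → E → StrongDual ℝ E) : Prop where
  measurable_G₀ : Measurable fun q : E × S => o.G₀ q.1 q.2
  measurable_G : ∀ i, Measurable fun q : E × S => o.G i q.1 q.2
  measurable_F : Measurable fun q : E × S => o.F q.1 q.2
  mem_f₀' : ∀ x ∈ p.X, f₀' x ∈ subdiff p.X p.f₀ x
  mem_f' : ∀ i, ∀ x ∈ p.X, f' i x ∈ subdiff p.X (p.f i) x
  mean_G₀ : ∀ x ∈ p.X, Integrable (o.G₀ x) P ∧ ∫ s, o.G₀ x s ∂P = f₀' x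
  mean_G : ∀ i, ∀ x ∈ p.X, Integrable (o.G i x) P ∧ ∫ s, o.G i x s ∂P = f' i x
  mean_F : ∀ x ∈ p.X, Integrable (o.F x) P ∧ ∫ s, o.F x s ∂P = p.fVec x
  var_G₀ : ∀ x ∈ p.X, Integrable (fun s => ‖o.G₀ x s - f₀' x‖ ^ 2) P ∧
    ∫ s, ‖o.G₀ x s - f₀' x‖ ^ 2 ∂P ≤ c.σ₀ ^ 2
  var_G : ∀ i, ∀ x ∈ p.X, Integrable (fun s => ‖o.G i x s - f' i x‖ ^ 2) P ∧
    ∫ s, ‖o.G i x s - f' i x‖ ^ 2 ∂P ≤ c.σ i ^ 2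
  var_F : ∀ x ∈ p.X, Integrable (fun s => ‖o.F x s - p.fVec x‖ ^ 2) P ∧
    ∫ s, ‖o.F x s - p.fVec x‖ ^ 2 ∂P ≤ c.σf ^ 2

/-- The samples `ξ_t`, `ξ̄_t`, `t ≥ 0`, are mutually independent with law `P`. -/
structure AreSamples {Ω : Type*} [MeasurableSpace Ω] [MeasurableSpace S] (μ : Measure Ω)
    (P : Measure S) (ξ ξbar : ℕ → Ω → S) : Prop where
  measurable_ξ : ∀ t, Measurable (ξ t)
  measurable_ξbar : ∀ t, Measurable (ξbar t)
  law_ξ : ∀ t, μ.map (ξ t) = P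
  law_ξbar : ∀ t, μ.map (ξbar t) = P
  indep : iIndepFun (Sum.elim ξ ξbar) μ

/-- The stochastic linearization `ℓ_F(x_t) = F(x_{t-1}, ξ̄_{t-1}) + G(x_{t-1}, ξ̄_{t-1})ᵀ(x_t - x_{t-1})`
along a sequence of points and samples, with `ℓ_F(x_0) = F(x_0, ξ̄_0)`, which is what the
initialization `x_{-1} = x_0`, `F(x_{-1}) = F(x_0, ξ̄_0)` gives. -/
def Oracle.linF (o : Oracle E m S) (x : ℕ → E) (sbar : ℕ → S) : ℕ → Vec m
  | 0 => o.F (x 0) (sbar 0)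
  | t + 1 => o.F (x t) (sbar t) + mkVec fun i => o.G i (x t) (sbar t) (x (t + 1) - x t)

/-- The extrapolation
`s_t = (1 + θ_t)[χ(x_t) + ℓ_F(x_t)] - θ_t[χ(x_{t-1}) + ℓ_F(x_{t-1})]`, with
`x_{-1} = x_0` and `ℓ_F(x_{-1}) = ℓ_F(x_0)`. -/
def Oracle.extrap (o : Oracle E m S) (p : Problem E m) (θ : ℕ → ℝ) (x : ℕ → E) (sbar : ℕ → S) :
    ℕ → Vec m
  | 0 => (1 + θ 0) • (p.χVec (x 0) + o.linF x sbar 0)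
      - θ 0 • (p.χVec (x 0) + o.linF x sbar 0)
  | t + 1 => (1 + θ (t + 1)) • (p.χVec (x (t + 1)) + o.linF x sbar (t + 1))
      - θ (t + 1) • (p.χVec (x t) + o.linF x sbar t)

/-- `(x_t)`, `(y_t)` for `t ≤ T` are the iterates of `T` steps of the constraint extrapolation
method, started at `(x₀, y₀)` and fed with the samples `s_t = ξ_t`, `sbar_t = ξ̄_t`. -/
structure IsConExRun (p : Problem E m) (d : DistGen p.X) (o : Oracle E m S) (θ η τ : ℕ → ℝ)
    (T : ℕ) (x₀ : E) (y₀ : Vec m) (s sbar : ℕ → S) (x : ℕ → E) (y : ℕ → Vec m) : Prop where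
  x_zero : x 0 = x₀
  y_zero : y 0 = y₀
  y_step : ∀ t < T, y (t + 1) = posVec (y t + (1 / τ t) • o.extrap p θ x sbar t)
  x_step : ∀ t < T, p.IsProx d (y (t + 1))
    (o.G₀ (x t) (s t) + ∑ i, y (t + 1) i • o.G i (x t) (s t)) (x t) (η t) (x (t + 1))

/-- The output `x̄_T = (∑_{t<T} γ_t)⁻¹ ∑_{t<T} γ_t x_{t+1}`. -/
noncomputable def avgIterate (γ : ℕ → ℝ) (T : ℕ) (x : ℕ → E) : E :=
  (∑ t ∈ Finset.range T, γ t)⁻¹ • ∑ t ∈ Finset.range T, γ t • x (t + 1)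

end Oracle

end ConEx

/-!
The convergence rates come from one inequality that holds along every trajectory and for every
nonnegative dual reference point `Y`, `ConEx.path_bound`, and from taking its expectation.

*One trajectory.*  The objective of the prox step is strongly convex with respect to `W`, because
the subgradient inequality for `χ₀` makes `χ₀ - α₀ ω` convex
(`ConEx.StronglyConvexWrt.convexOn_sub`).  The resulting three-point inequality and the smoothness of
`f₀`, `fᵢ` give a recursion for the gap of the Lagrange function (`ConEx.one_step`); a dual vector
larger than `B` costs smoothness `L_f` that the step sizes do not cover, and this excess is paid as
nonsmoothness `L_f D_X (‖Y‖ - B)₊ / 2`.  The weights `γ_t` and the extrapolation make the products of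
dual iterates with differences of constraint linearizations telescope (`ConEx.telescope`).  The
remaining products are split by Young's inequality; since the linearizations vary by at most `ℳ`
times the last two steps, the quadratic terms of the prox steps absorb them
(`ConEx.Constants.absorb_add_le`, `ConEx.summation_bound`).

*Expectation.*  The iterates are measurable functions of the samples used so far, as the prox-mapping
is Lipschitz (`ConEx.measurable_iterates`), so each noise term is independent of the vector it is
paired with and has mean zero.  The one exception, the linearization at `x₀`, whose sample also
enters the first step, is bounded directly.

*Dual iterates.*  The subgradient noise involves `‖y_{t+1}‖²`, for which there is no a priori bound.  At
`Y = y^*` the gap is nonnegative, so the trajectory inequality bounds `E ‖y^* - y_n‖²` through the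
earlier and the current dual errors; as `(t + 1) τ_t` dominates `384 ‖σ‖² T / α₀`, this is a contraction
(`ConEx.Constants.IsDualScale.dual_error_le`), and the noise is at most `ζ²` in mean square.

*Conclusion.*  The reference points `Y = 0`, `Y = y^*` and
`Y = (‖y^*‖ + 1) [ψ(x̄)]₊ / ‖[ψ(x̄)]₊‖` give the bounds for the objective, for the last iterate and for
the infeasibility.  The last one is random, and its product with the accumulated noise is estimated
by the Cauchy-Schwarz inequality, the noise terms being orthogonal
(`ConEx.StochasticRun.integralLE_weightedNoise_sq`).

If the maximum defining `τ_t` is zero, the dual iterates vanish and the constraints are constant and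
known exactly; then any positive scale is admissible in the argument, and the bounds follow by
letting it tend to zero (`ConEx.StochasticRun.exists_dualScale`,
`ConEx.IntegralLE.of_forall_pos`).
-/

namespace ConEx

/-! ### Relative interiors and subgradients of convex functions -/

section ConvexGeometry

variable {E : Type*} [NormedAddCommGroup E] [NormedSpace ℝ E]

theorem mem_intrinsicInterior_iff_exists_ball {X : Set E} {z : E} :
    z ∈ intrinsicInterior ℝ X ↔
      z ∈ affineSpan ℝ X ∧ ∃ ε > 0, ∀ q ∈ affineSpan ℝ X, dist q z < ε → q ∈ X := by
  rw [mem_intrinsicInterior]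
  constructor
  · rintro ⟨y, hy, rfl⟩
    refine ⟨y.2, ?_⟩
    obtain ⟨ε, hε, h⟩ := Metric.mem_nhds_iff.1 (mem_interior_iff_mem_nhds.1 hy)
    exact ⟨ε, hε, fun q hq hd => h (show dist (⟨q, hq⟩ : affineSpan ℝ X) y < ε from hd)⟩
  · rintro ⟨hz, ε, hε, h⟩
    refine ⟨⟨z, hz⟩, mem_interior_iff_mem_nhds.2 (Metric.mem_nhds_iff.2 ⟨ε, hε, ?_⟩), rfl⟩
    rintro ⟨q, hq⟩ hd
    exact h q hq hd

theorem exists_pos_add_smul_mem_of_mem_intrinsicInterior {X : Set E} {z : E}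
    (hz : z ∈ intrinsicInterior ℝ X) {v : E} (hv : v ∈ vectorSpan ℝ X) :
    ∃ t : ℝ, 0 < t ∧ z + t • v ∈ X := by
  obtain ⟨hzs, ε, hε, h⟩ := mem_intrinsicInterior_iff_exists_ball.1 hz
  have hpos : 0 < ‖v‖ + 1 := by positivity
  refine ⟨ε / (‖v‖ + 1), by positivity, h _ ?_ ?_⟩
  · have := AffineSubspace.vadd_mem_of_mem_direction
      (s := affineSpan ℝ X) (v := (ε / (‖v‖ + 1)) • v)
      (by rw [direction_affineSpan]; exact Submodule.smul_mem _ _ hv) hzs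
    rwa [vadd_eq_add, add_comm] at this
  · rw [dist_eq_norm, add_sub_cancel_left, norm_smul, Real.norm_of_nonneg (by positivity),
      div_mul_eq_mul_div, div_lt_iff₀ hpos]
    nlinarith

/-- A convex combination of a point of a convex set and a relative interior point, with positive
weight on the latter, lies in the relative interior. -/
theorem combo_mem_intrinsicInterior {X : Set E} (hX : Convex ℝ X) {z u : E} (hz : z ∈ X)
    (hu : u ∈ intrinsicInterior ℝ X) {s : ℝ} (hs : 0 < s) (hs1 : s ≤ 1) :
    (1 - s) • z + s • u ∈ intrinsicInterior ℝ X := by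
  obtain ⟨hus, ε, hε, h⟩ := mem_intrinsicInterior_iff_exists_ball.1 hu
  have hzs : z ∈ affineSpan ℝ X := subset_affineSpan ℝ X hz
  have hline : ∀ {a b : E}, a ∈ affineSpan ℝ X → b ∈ affineSpan ℝ X → ∀ r : ℝ,
      (1 - r) • a + r • b ∈ affineSpan ℝ X := by
    intro a b ha hb r
    have := AffineMap.lineMap_mem r ha hb
    rwa [AffineMap.lineMap_apply_module] at this
  refine mem_intrinsicInterior_iff_exists_ball.2 ⟨hline hzs hus s, s * ε, by positivity, ?_⟩
  intro q hq hd
  -- `q` is the same combination of `z` and a point near `u`.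
  have hq' : (1 - s⁻¹) • z + s⁻¹ • q ∈ X := by
    apply h _ (hline hzs hq _)
    have : (1 - s⁻¹) • z + s⁻¹ • q - u = s⁻¹ • (q - ((1 - s) • z + s • u)) := by
      match_scalars <;> field_simp
      ring
    rw [dist_eq_norm, this, norm_smul, Real.norm_of_nonneg (by positivity), ← dist_eq_norm,
      inv_mul_lt_iff₀ hs]
    exact hd
  have := hX hz hq' (sub_nonneg.2 hs1) hs.le (by ring)
  convert this using 1
  match_scalars <;> field_simp
  ring

/-- A convex function has a subgradient at every relative interior point of its domain. -/
theorem exists_subgradient [FiniteDimensional ℝ E] {X : Set E} {h : E → ℝ}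
    (hh : ConvexOn ℝ X h) {z : E} (hz : z ∈ intrinsicInterior ℝ X) :
    ∃ g : StrongDual ℝ E, ∀ x ∈ X, h z + g (x - z) ≤ h x := by
  have hzX : z ∈ X := intrinsicInterior_subset hz
  let V := vectorSpan ℝ X
  -- The cone generated by the epigraph of `h`, translated to the origin.
  let s : PointedCone ℝ (V × ℝ) :=
    { carrier := {q | ∃ t : ℝ, 0 < t ∧ z + t • (q.1 : E) ∈ X ∧
        h (z + t • (q.1 : E)) - h z ≤ t * q.2}
      zero_mem' := ⟨1, one_pos, by simpa using hzX, by simp⟩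
      add_mem' := by
        rintro ⟨a, r⟩ ⟨b, r'⟩ ⟨t, ht, ha, har⟩ ⟨t', ht', hb, hbr⟩
        have hw : t' / (t + t') + t / (t + t') = 1 := by field_simp; ring
        have hw1 : 0 ≤ t' / (t + t') := by positivity
        have hw2 : 0 ≤ t / (t + t') := by positivity
        have e : z + (t * t' / (t + t')) • ((a : E) + (b : E))
            = (t' / (t + t')) • (z + t • (a : E)) + (t / (t + t')) • (z + t' • (b : E)) := by
          match_scalars <;> field_simp
          ring
        refine ⟨t * t' / (t + t'), by positivity, ?_, ?_⟩
        · simp only [Prod.fst_add, Submodule.coe_add]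
          rw [e]; exact hh.1 ha hb hw1 hw2 hw
        · simp only [Prod.fst_add, Prod.snd_add, Submodule.coe_add]
          rw [e]
          have h1 := hh.2 ha hb hw1 hw2 hw
          simp only [smul_eq_mul] at h1
          have h2 := mul_le_mul_of_nonneg_left har hw1
          have h3 := mul_le_mul_of_nonneg_left hbr hw2
          have h4 : h z = (t' / (t + t') + t / (t + t')) * h z := by rw [hw, one_mul]
          have h5 : t * t' / (t + t') * (r + r')
              = t' / (t + t') * (t * r) + t / (t + t') * (t' * r') := by ring
          simp only at h2 h3
          rw [h5]
          nlinarith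
      smul_mem' := by
        rintro ⟨c, hc⟩ ⟨a, r⟩ ⟨t, ht, ha, har⟩
        rcases hc.eq_or_lt with rfl | hc
        · exact ⟨1, one_pos, by simpa using hzX, by simp⟩
        · have e : z + (t / c) • ((c • a : V) : E) = z + t • (a : E) := by
            rw [Submodule.coe_smul, smul_smul, div_mul_cancel₀ _ hc.ne']
          refine ⟨t / c, by positivity, ?_, ?_⟩
          · change z + (t / c) • ((c • a : V) : E) ∈ X
            rw [e]; exact ha
          · change h (z + (t / c) • ((c • a : V) : E)) - h z ≤ t / c * (c * r)
            rw [e, ← mul_assoc, div_mul_cancel₀ _ hc.ne']; exact har }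
  have hmem : ∀ q : V × ℝ, q ∈ s ↔ ∃ t : ℝ, 0 < t ∧ z + t • (q.1 : E) ∈ X ∧
        h (z + t • (q.1 : E)) - h z ≤ t * q.2 := fun _ => Iff.rfl
  let f : (V × ℝ) →ₗ.[ℝ] ℝ :=
    ⟨LinearMap.ker (LinearMap.fst ℝ V ℝ),
      (LinearMap.snd ℝ V ℝ).comp (LinearMap.ker (LinearMap.fst ℝ V ℝ)).subtype⟩
  obtain ⟨g, hg1, hg2⟩ := riesz_extension s f
    (by
      rintro ⟨⟨a, r⟩, hq⟩ hs
      obtain rfl : a = 0 := LinearMap.mem_ker.1 hq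
      obtain ⟨t, ht, -, h2⟩ := (hmem _).1 hs
      change 0 ≤ r
      simp only [ZeroMemClass.coe_zero, smul_zero, add_zero, sub_self] at h2
      exact nonneg_of_mul_nonneg_right h2 ht)
    (by
      rintro ⟨a, r⟩
      obtain ⟨t, ht, ha⟩ := exists_pos_add_smul_mem_of_mem_intrinsicInterior hz a.2
      refine ⟨⟨(0, (h (z + t • (a : E)) - h z) / t - r), by simp [f]⟩, ?_⟩
      refine (hmem _).2 ⟨t, ht, ?_, ?_⟩
      · simpa using ha
      · simp only [Prod.mk_add_mk, zero_add, sub_add_cancel]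
        rw [mul_div_cancel₀ _ ht.ne'])
  obtain ⟨k, hk⟩ := (-(g.comp (LinearMap.inl ℝ V ℝ))).exists_extend
  refine ⟨LinearMap.toContinuousLinearMap k, fun x hx => ?_⟩
  have hxV : x - z ∈ V := vsub_mem_vectorSpan ℝ hx hzX
  have h1 := hg2 (⟨x - z, hxV⟩, h x - h z) ((hmem _).2 ⟨1, one_pos, by simpa using hx, by simp⟩)
  have h2 : g ((0 : V), h x - h z) = h x - h z :=
    hg1 ⟨((0 : V), h x - h z), by simp [f]⟩
  have h3 : k (x - z) = -g (⟨x - z, hxV⟩, 0) := by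
    have := LinearMap.congr_fun hk ⟨x - z, hxV⟩
    simpa using this
  have h4 : g (⟨x - z, hxV⟩, h x - h z) = g (⟨x - z, hxV⟩, 0) + g ((0 : V), h x - h z) := by
    rw [← map_add]; simp
  change h z + k (x - z) ≤ h x
  linarith

/-- Elements of the subdifferential satisfy the subgradient inequality also at the points outside
the relative interior, when the function is continuous. -/
theorem le_of_mem_subdiff {X : Set E} {h : E → ℝ} (hc : ContinuousOn h X) {x : E} (hx : x ∈ X)
    {g : StrongDual ℝ E} (hg : g ∈ subdiff X h x) {z : E} (hz : z ∈ X) :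
    h x + g (z - x) ≤ h z := by
  rcases hg with ⟨-, hg⟩ | ⟨-, u, k, huk, hu, hk⟩
  · exact hg z hz
  · have h1 : Tendsto (fun j => h (u j)) atTop (𝓝 (h x)) :=
      (hc x hx).tendsto.comp (tendsto_nhdsWithin_iff.2
        ⟨hu, Eventually.of_forall fun j => intrinsicInterior_subset (huk j).1⟩)
    have h2 : Tendsto (fun j => k j (z - u j)) atTop (𝓝 (g (z - x))) :=
      (isBoundedBilinearMap_apply.continuous.tendsto (g, z - x)).comp
        (hk.prodMk_nhds (tendsto_const_nhds.sub hu))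
    exact le_of_tendsto (h1.add h2) (Eventually.of_forall fun j => (huk j).2 z hz)

theorem abs_le_of_subgradient_of_mem_intrinsicInterior {X : Set E} {h : E → ℝ} {M : ℝ}
    (hM : ∀ a ∈ X, ∀ b ∈ X, h a - h b ≤ M * ‖a - b‖) {x : E} (hx : x ∈ intrinsicInterior ℝ X)
    {g : StrongDual ℝ E} (hg : ∀ z ∈ X, h x + g (z - x) ≤ h z) {z : E} (hz : z ∈ X) :
    |g (z - x)| ≤ M * ‖z - x‖ := by
  have hxX := intrinsicInterior_subset hx
  rw [abs_le]
  constructor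
  · -- Move from `x` in the direction opposite to `z`.
    obtain ⟨t, ht, hmem⟩ := exists_pos_add_smul_mem_of_mem_intrinsicInterior hx
      (vsub_mem_vectorSpan ℝ hxX hz)
    rw [vsub_eq_sub] at hmem
    have h1 := hg _ hmem
    have h2 := hM _ hmem _ hxX
    rw [add_sub_cancel_left, map_smul, smul_eq_mul] at h1
    rw [add_sub_cancel_left, norm_smul, Real.norm_of_nonneg ht.le, norm_sub_rev] at h2
    have h3 : g (x - z) = -g (z - x) := by rw [← map_neg, neg_sub]
    rw [h3] at h1
    have : t * (-g (z - x)) ≤ t * (M * ‖z - x‖) := by linarith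
    linarith [le_of_mul_le_mul_left this ht]
  · linarith [hg z hz, hM z hz x hxX]

theorem abs_le_of_mem_subdiff {X : Set E} {h : E → ℝ} {M : ℝ}
    (hM : ∀ a ∈ X, ∀ b ∈ X, h a - h b ≤ M * ‖a - b‖) {x : E}
    {g : StrongDual ℝ E} (hg : g ∈ subdiff X h x) {z : E} (hz : z ∈ X) :
    |g (z - x)| ≤ M * ‖z - x‖ := by
  rcases hg with ⟨hx, hg⟩ | ⟨-, u, k, huk, hu, hk⟩
  · exact abs_le_of_subgradient_of_mem_intrinsicInterior hM hx hg hz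
  · have h2 : Tendsto (fun j => k j (z - u j)) atTop (𝓝 (g (z - x))) :=
      (isBoundedBilinearMap_apply.continuous.tendsto (g, z - x)).comp
        (hk.prodMk_nhds (tendsto_const_nhds.sub hu))
    have h3 : Tendsto (fun j => M * ‖z - u j‖) atTop (𝓝 (M * ‖z - x‖)) :=
      ((tendsto_const_nhds.sub hu).norm).const_mul M
    exact le_of_tendsto_of_tendsto' h2.abs h3 fun j =>
      abs_le_of_subgradient_of_mem_intrinsicInterior hM (huk j).1 (huk j).2 hz

/-- If `r` is convex and lower semicontinuous and `ω` continuous on `X`, and `r - β ω` has a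
subgradient at every relative interior point, then `r - β ω` is convex on all of `X`: at a point
outside the relative interior, pass to the limit along segments towards a relative interior point;
convexity of `r` bounds the limit at the endpoints, semicontinuity that at the point itself. -/
theorem convexOn_sub_of_support [FiniteDimensional ℝ E] {X : Set E} {r ω : E → ℝ} {β : ℝ}
    (hr : ConvexOn ℝ X r) (hl : LowerSemicontinuousOn r X) (hω : ContinuousOn ω X)
    (hsupp : ∀ z ∈ intrinsicInterior ℝ X, ∃ g : StrongDual ℝ E, ∀ x ∈ X,
      r z - β * ω z + g (x - z) ≤ r x - β * ω x) :
    ConvexOn ℝ X (fun x => r x - β * ω x) := by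
  have hint : ∀ x ∈ X, ∀ y ∈ X, ∀ a b : ℝ, 0 ≤ a → 0 ≤ b → a + b = 1 →
      a • x + b • y ∈ intrinsicInterior ℝ X →
      r (a • x + b • y) - β * ω (a • x + b • y) ≤
        a * (r x - β * ω x) + b * (r y - β * ω y) := by
    intro x hx y hy a b ha hb hab hz
    obtain ⟨g, hg⟩ := hsupp _ hz
    have h1 := mul_le_mul_of_nonneg_left (hg x hx) ha
    have h2 := mul_le_mul_of_nonneg_left (hg y hy) hb
    set z := a • x + b • y with hzdef
    have h3 : a * g (x - z) + b * g (y - z) = 0 := by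
      have : a • (x - z) + b • (y - z) = 0 := by
        rw [smul_sub, smul_sub]
        have : (a + b) • z = z := by rw [hab, one_smul]
        rw [add_smul] at this
        calc a • x - a • z + (b • y - b • z) = (a • x + b • y) - (a • z + b • z) := by abel
          _ = 0 := by rw [this, ← hzdef, sub_self]
      have h := congrArg g this
      simpa using h
    have h4 : r z - β * ω z = a * (r z - β * ω z) + b * (r z - β * ω z) := by
      rw [← add_mul, hab, one_mul]
    nlinarith
  refine ⟨hr.1, fun x hx y hy a b ha hb hab => ?_⟩
  obtain ⟨u, hu⟩ := Set.Nonempty.intrinsicInterior hr.1 ⟨x, hx⟩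
  have huX := intrinsicInterior_subset hu
  have hzX := hr.1 hx hy ha hb hab
  set z := a • x + b • y with hz
  -- Approach everything along the segments towards the relative interior point `u`.
  have hseg : ∀ w ∈ X, Tendsto (fun s : ℝ => (1 - s) • w + s • u) (𝓝[>] 0) (𝓝[X] w) := by
    intro w hw
    refine tendsto_nhdsWithin_iff.2 ⟨?_, ?_⟩
    · have : Tendsto (fun s : ℝ => (1 - s) • w + s • u) (𝓝 0) (𝓝 ((1 - (0 : ℝ)) • w + (0 : ℝ) • u)) :=
        Continuous.tendsto (by fun_prop) 0
      simp only [sub_zero, one_smul, zero_smul, add_zero] at this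
      exact this.mono_left nhdsWithin_le_nhds
    · filter_upwards [Ioo_mem_nhdsGT (zero_lt_one' ℝ)] with s hs
      exact hr.1 hw huX (by linarith [hs.2]) hs.1.le (by ring)
  have hωlim : ∀ w ∈ X, Tendsto (fun s : ℝ => ω ((1 - s) • w + s • u)) (𝓝[>] 0) (𝓝 (ω w)) :=
    fun w hw => (hω w hw).tendsto.comp (hseg w hw)
  change r z - β * ω z ≤ a * (r x - β * ω x) + b * (r y - β * ω y)
  refine le_of_forall_pos_le_add fun ε hε => ?_
  have hlow : ∀ᶠ s in 𝓝[>] (0 : ℝ), r z - ε ≤ r ((1 - s) • z + s • u) :=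
    ((hseg z hzX).eventually (hl z hzX (r z - ε) (by linarith))).mono fun s hs => le_of_lt hs
  have hlim : Tendsto (fun s : ℝ =>
      a * ((1 - s) * r x + s * r u - β * ω ((1 - s) • x + s • u))
        + b * ((1 - s) * r y + s * r u - β * ω ((1 - s) • y + s • u))
        + β * ω ((1 - s) • z + s • u)) (𝓝[>] 0)
      (𝓝 (a * ((1 - 0) * r x + 0 * r u - β * ω x) + b * ((1 - 0) * r y + 0 * r u - β * ω y)
        + β * ω z)) := by
    have hid : Tendsto (fun s : ℝ => s) (𝓝[>] 0) (𝓝 0) := tendsto_id.mono_left nhdsWithin_le_nhds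
    refine Tendsto.add (Tendsto.add ?_ ?_) ((hωlim z hzX).const_mul β)
    · exact (((((tendsto_const_nhds.sub hid).mul_const _).add (hid.mul_const _))).sub
        ((hωlim x hx).const_mul β)).const_mul a
    · exact (((((tendsto_const_nhds.sub hid).mul_const _).add (hid.mul_const _))).sub
        ((hωlim y hy).const_mul β)).const_mul b
  have hev : ∀ᶠ s in 𝓝[>] (0 : ℝ), r z - ε ≤
      a * ((1 - s) * r x + s * r u - β * ω ((1 - s) • x + s • u))
        + b * ((1 - s) * r y + s * r u - β * ω ((1 - s) • y + s • u))
        + β * ω ((1 - s) • z + s • u) := by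
    filter_upwards [hlow, Ioo_mem_nhdsGT (zero_lt_one' ℝ)] with s h1 hs
    have hs1 : 0 ≤ 1 - s := by linarith [hs.2]
    have hx' := hr.1 hx huX hs1 hs.1.le (by ring)
    have hy' := hr.1 hy huX hs1 hs.1.le (by ring)
    have hzz : (1 - s) • z + s • u
        = a • ((1 - s) • x + s • u) + b • ((1 - s) • y + s • u) := by
      obtain rfl : b = 1 - a := by linarith
      rw [hz]
      module
    have h2 := hint _ hx' _ hy' a b ha hb hab
      (by rw [← hzz]; exact combo_mem_intrinsicInterior hr.1 hzX hu hs.1 hs.2.le)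
    rw [← hzz] at h2
    have h3 := mul_le_mul_of_nonneg_left (hr.2 hx huX hs1 hs.1.le (by ring)) ha
    have h4 := mul_le_mul_of_nonneg_left (hr.2 hy huX hs1 hs.1.le (by ring)) hb
    simp only [smul_eq_mul] at h3 h4
    nlinarith
  have := ge_of_tendsto hlim hev
  nlinarith

end ConvexGeometry

end ConEx

namespace ConEx

/-! ### The prox-function and the prox-mapping -/

section Prox

variable {E : Type*} [NormedAddCommGroup E] [NormedSpace ℝ E] {X : Set E}

theorem DistGen.half_sq_norm_le_W (d : DistGen X) {x z : E} (hx : x ∈ X) (hz : z ∈ X) :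
    1 / 2 * ‖z - x‖ ^ 2 ≤ d.W z x := by
  have := d.strongConvex x hx z hz
  unfold DistGen.W; linarith

theorem DistGen.W_nonneg (d : DistGen X) {x z : E} (hx : x ∈ X) (hz : z ∈ X) :
    0 ≤ d.W z x :=
  le_trans (by positivity) (d.half_sq_norm_le_W hx hz)

theorem DistGen.continuousOn_ω (d : DistGen X) : ContinuousOn d.ω X :=
  fun x hx => (d.hasGrad x hx).continuousWithinAt

theorem DistGen.continuousOn_grad (d : DistGen X) : ContinuousOn d.grad X := by
  have : LipschitzOnWith (Real.toNNReal |d.Lω|) d.grad X := by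
    refine LipschitzOnWith.of_dist_le_mul fun x hx z hz => ?_
    rw [dist_eq_norm, dist_eq_norm, Real.coe_toNNReal _ (abs_nonneg _)]
    exact (d.lipschitz x hx z hz).trans (by gcongr; exact le_abs_self _)
  exact this.continuousOn

theorem DistGen.continuousOn_W (d : DistGen X) :
    ContinuousOn (fun q : E × E => d.W q.1 q.2) (X ×ˢ X) := by
  have h1 : ContinuousOn (fun q : E × E => d.ω q.1) (X ×ˢ X) :=
    d.continuousOn_ω.comp continuousOn_fst fun q hq => hq.1
  have h2 : ContinuousOn (fun q : E × E => d.ω q.2) (X ×ˢ X) :=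
    d.continuousOn_ω.comp continuousOn_snd fun q hq => hq.2
  have h3 : ContinuousOn (fun q : E × E => d.grad q.2) (X ×ˢ X) :=
    d.continuousOn_grad.comp continuousOn_snd fun q hq => hq.2
  exact (h1.sub h2).sub (h3.clm_apply (continuousOn_fst.sub continuousOn_snd))

theorem DistGen.sqrt_W_le_diam (d : DistGen X) (hX : IsCompact X) {x z : E} (hx : x ∈ X)
    (hz : z ∈ X) : Real.sqrt (2 * d.W z x) ≤ d.diam := by
  refine le_csSup ?_ ⟨(z, x), ⟨hz, hx⟩, rfl⟩
  refine ((hX.prod hX).image_of_continuousOn ?_).bddAbove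
  exact Real.continuous_sqrt.comp_continuousOn (continuousOn_const.mul d.continuousOn_W)

theorem DistGen.W_le_half_sq_diam (d : DistGen X) (hX : IsCompact X) {x z : E} (hx : x ∈ X)
    (hz : z ∈ X) : d.W z x ≤ d.diam ^ 2 / 2 := by
  have h1 := d.sqrt_W_le_diam hX hx hz
  have h0 := d.W_nonneg hx hz
  have h2 := Real.sq_sqrt (show 0 ≤ 2 * d.W z x by positivity)
  have h3 := Real.sqrt_nonneg (2 * d.W z x)
  nlinarith

theorem DistGen.norm_sub_le_diam (d : DistGen X) (hX : IsCompact X) {x z : E} (hx : x ∈ X)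
    (hz : z ∈ X) : ‖z - x‖ ≤ d.diam := by
  refine le_trans (Real.le_sqrt_of_sq_le ?_) (d.sqrt_W_le_diam hX hx hz)
  linarith [d.half_sq_norm_le_W hx hz]

theorem DistGen.diam_nonneg (d : DistGen X) : 0 ≤ d.diam := by
  apply Real.sSup_nonneg
  rintro _ ⟨q, -, rfl⟩
  exact Real.sqrt_nonneg _

/-- If `r = K + β ω` with `K` convex attains its minimum over `X` at `z`, then `r` grows at least
like `β W(·, z)` away from `z`. -/
theorem DistGen.add_mul_W_le_of_isMinOn (d : DistGen X) {K : E → ℝ}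
    (hK : ConvexOn ℝ X K) {β : ℝ} {z : E} (hz : z ∈ X)
    (hmin : IsMinOn (fun x => K x + β * d.ω x) X z) {x : E} (hx : x ∈ X) :
    K z + β * d.ω z + β * d.W x z ≤ K x + β * d.ω x := by
  have hline : ∀ s ∈ Set.Icc (0 : ℝ) 1, z + s • (x - z) ∈ X := by
    intro s hs
    have := hK.1 hz hx (sub_nonneg.2 hs.2) hs.1 (by ring)
    convert this using 1; module
  -- The derivative of `ω` along the segment from `z` to `x`.
  have hd : HasDerivWithinAt (fun s : ℝ => d.ω (z + s • (x - z))) (d.grad z (x - z))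
      (Set.Icc 0 1) 0 := by
    have h1 : HasDerivWithinAt (fun s : ℝ => z + s • (x - z)) (x - z) (Set.Icc 0 1) 0 := by
      simpa using (((hasDerivAt_id (0 : ℝ)).smul_const (x - z)).const_add z).hasDerivWithinAt
    have h2 : HasFDerivWithinAt d.ω (d.grad z) X (z + (0 : ℝ) • (x - z)) := by
      simpa using d.hasGrad z hz
    exact h2.comp_hasDerivWithinAt (0 : ℝ) h1 hline
  have hlim := (hasDerivWithinAt_iff_tendsto_slope' (s := Set.Ioc (0 : ℝ) 1) (x := 0)
    (by simp)).1 (hd.mono Set.Ioc_subset_Icc_self)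
  have hlim2 : Tendsto (fun s : ℝ => K x - K z + β * slope (fun s : ℝ => d.ω (z + s • (x - z))) 0 s)
      (𝓝[Set.Ioc 0 1] 0) (𝓝 (K x - K z + β * d.grad z (x - z))) :=
    (hlim.const_mul β).const_add _
  have hne : (𝓝[Set.Ioc (0 : ℝ) 1] 0).NeBot := by
    rw [nhdsWithin_Ioc_eq_nhdsGT zero_lt_one]; infer_instance
  have hnn : 0 ≤ K x - K z + β * d.grad z (x - z) := by
    refine ge_of_tendsto hlim2 (eventually_nhdsWithin_of_forall fun s hs => ?_)
    have h1 := hmin (hline s ⟨hs.1.le, hs.2⟩)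
    have h2 := hK.2 hz hx (sub_nonneg.2 hs.2) hs.1.le (by ring)
    have h3 : (1 - s) • z + s • x = z + s • (x - z) := by module
    rw [h3] at h2
    simp only [Set.mem_ofPred_eq, smul_eq_mul] at h1 h2
    simp only [slope_def_field, zero_smul, add_zero, sub_zero]
    have h4 : 0 ≤ s * (K x - K z) + β * (d.ω (z + s • (x - z)) - d.ω z) := by nlinarith
    have h5 : K x - K z + β * ((d.ω (z + s • (x - z)) - d.ω z) / s)
        = (s * (K x - K z) + β * (d.ω (z + s • (x - z)) - d.ω z)) / s := by
      field_simp [hs.1.ne']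
    rw [h5]
    exact div_nonneg h4 hs.1.le
  unfold DistGen.W
  nlinarith

/-- Strong convexity with respect to `W`, in the sense of subgradients, makes `r - β ω` convex. -/
theorem StronglyConvexWrt.convexOn_sub [FiniteDimensional ℝ E] {d : DistGen X} {β : ℝ} {r : E → ℝ}
    (h : StronglyConvexWrt d β r) (hr : ConvexOn ℝ X r) (hl : LowerSemicontinuousOn r X) :
    ConvexOn ℝ X (fun x => r x - β * d.ω x) := by
  refine convexOn_sub_of_support hr hl d.continuousOn_ω fun z hz => ?_
  obtain ⟨g, hg⟩ := exists_subgradient hr hz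
  refine ⟨g - β • d.grad z, fun x hx => ?_⟩
  have := h x hx z (intrinsicInterior_subset hz) g (Or.inl ⟨hz, hg⟩)
  unfold DistGen.W at this
  simp only [FunLike.coe_sub, FunLike.coe_smul, Pi.sub_apply, Pi.smul_apply, smul_eq_mul]
  linarith

variable {m : ℕ}

/-- The three-point inequality of the prox-mapping. -/
theorem Problem.IsProx.three_point [FiniteDimensional ℝ E] {p : Problem E m} (hp : p.IsConvex)
    {d : DistGen p.X} {α : ℝ} (hα : StronglyConvexWrt d α p.χ₀) {w : Vec m} (hw : ∀ i, 0 ≤ w i)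
    {v : StrongDual ℝ E} {xt : E} {η : ℝ} {z : E} (hz : p.IsProx d w v xt η z)
    {x : E} (hx : x ∈ p.X) :
    p.χ₀ z + ∑ i, w i * p.χ i z + v z + η * d.W z xt + (η + α) * d.W x z
      ≤ p.χ₀ x + ∑ i, w i * p.χ i x + v x + η * d.W x xt := by
  have hsum : ConvexOn ℝ p.X (fun x => ∑ i, w i * p.χ i x) := by
    have : ∀ s : Finset (Fin m), ConvexOn ℝ p.X (fun x => ∑ i ∈ s, w i * p.χ i x) := by
      intro s
      induction s using Finset.induction_on with
      | empty => simpa using convexOn_const (0 : ℝ) hp.convex_X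
      | insert i s hi ih =>
        simp only [Finset.sum_insert hi]
        exact ((hp.convex_χ i).smul (hw i)).add ih
    exact this _
  have hlin : ConvexOn ℝ p.X (fun x => (v - η • d.grad xt) x) :=
    ((v - η • d.grad xt).toLinearMap.convexOn hp.convex_X)
  have hK : ConvexOn ℝ p.X (fun u => p.χ₀ u - α * d.ω u + ∑ i, w i * p.χ i u
      + (v - η • d.grad xt) u + η * (d.grad xt xt - d.ω xt)) :=
    (((hα.convexOn_sub hp.convex_χ₀ hp.lsc_χ₀).add hsum).add hlin).add
      (convexOn_const (η * (d.grad xt xt - d.ω xt)) hp.convex_X)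
  have key : ∀ u, p.χ₀ u - α * d.ω u + ∑ i, w i * p.χ i u
      + (v - η • d.grad xt) u + η * (d.grad xt xt - d.ω xt)
        + (η + α) * d.ω u = p.χ₀ u + ∑ i, w i * p.χ i u + v u + η * d.W u xt := by
    intro u
    simp only [DistGen.W, FunLike.coe_sub, FunLike.coe_smul,
      Pi.sub_apply, Pi.smul_apply, smul_eq_mul, map_sub]
    ring
  have h := d.add_mul_W_le_of_isMinOn (β := η + α) hK hz.1 (by simp only [key]; exact hz.2) hx
  simp only [key] at h
  exact h

/-- The prox-mapping is Lipschitz continuous in the dual weights, the linear term and the prox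
center jointly. -/
theorem Problem.IsProx.norm_sub_le [FiniteDimensional ℝ E] {p : Problem E m} (hp : p.IsConvex)
    {d : DistGen p.X} {α : ℝ} (hα0 : 0 ≤ α) (hα : StronglyConvexWrt d α p.χ₀) {Mχ : Fin m → ℝ}
    (hM0 : ∀ i, 0 ≤ Mχ i)
    (hM : ∀ i, ∀ a ∈ p.X, ∀ b ∈ p.X, p.χ i a - p.χ i b ≤ Mχ i * ‖a - b‖)
    {η : ℝ} (hη : 0 ≤ η)
    {w w' : Vec m} (hw : ∀ i, 0 ≤ w i) (hw' : ∀ i, 0 ≤ w' i) {v v' : StrongDual ℝ E}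
    {xt xt' : E} (hxt : xt ∈ p.X) (hxt' : xt' ∈ p.X) {z z' : E}
    (hz : p.IsProx d w v xt η z) (hz' : p.IsProx d w' v' xt' η z') :
    η * ‖z - z'‖ ≤ ∑ i, |w i - w' i| * Mχ i + ‖v - v'‖ + η * (d.Lω * ‖xt - xt'‖) := by
  have h1 := hz.three_point hp hα hw hz'.1
  have h2 := hz'.three_point hp hα hw' hz.1
  have q1 := mul_le_mul_of_nonneg_left (d.half_sq_norm_le_W hz.1 hz'.1) (add_nonneg hη hα0)
  have q2 := mul_le_mul_of_nonneg_left (d.half_sq_norm_le_W hz'.1 hz.1) (add_nonneg hη hα0)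
  rw [norm_sub_rev] at q1
  have e1 : ∑ i, w i * p.χ i z' - ∑ i, w i * p.χ i z + ∑ i, w' i * p.χ i z
      - ∑ i, w' i * p.χ i z' ≤ (∑ i, |w i - w' i| * Mχ i) * ‖z - z'‖ := by
    rw [← Finset.sum_sub_distrib, ← Finset.sum_add_distrib, ← Finset.sum_sub_distrib,
      Finset.sum_mul]
    refine Finset.sum_le_sum fun i _ => ?_
    have a1 := hM i z hz.1 z' hz'.1
    have a2 := hM i z' hz'.1 z hz.1
    rw [norm_sub_rev] at a2
    have : w i * p.χ i z' - w i * p.χ i z + w' i * p.χ i z - w' i * p.χ i z'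
        = (w i - w' i) * (p.χ i z' - p.χ i z) := by ring
    rw [this, mul_assoc]
    calc (w i - w' i) * (p.χ i z' - p.χ i z) ≤ |w i - w' i| * |p.χ i z' - p.χ i z| := by
          rw [← abs_mul]; exact le_abs_self _
      _ ≤ |w i - w' i| * (Mχ i * ‖z - z'‖) := by
          refine mul_le_mul_of_nonneg_left (abs_le.2 ⟨by linarith, a2⟩) (abs_nonneg _)
  have e2 : v z' - v z + v' z - v' z' ≤ ‖v - v'‖ * ‖z - z'‖ := by
    have := (v - v').le_opNorm (z - z')
    have h3 : (v - v') (z - z') = v z - v z' - (v' z - v' z') := by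
      simp [map_sub]; ring
    rw [h3, Real.norm_eq_abs] at this
    linarith [neg_abs_le (v z - v z' - (v' z - v' z'))]
  have e3 : d.W z' xt - d.W z xt + d.W z xt' - d.W z' xt' ≤ d.Lω * ‖xt - xt'‖ * ‖z - z'‖ := by
    have := (d.grad xt - d.grad xt').le_opNorm (z - z')
    have h3 : (d.grad xt - d.grad xt') (z - z')
        = d.W z' xt - d.W z xt + d.W z xt' - d.W z' xt' := by
      simp [map_sub, DistGen.W]; ring
    rw [h3, Real.norm_eq_abs] at this
    exact (le_abs_self _).trans (this.trans (by gcongr; exact d.lipschitz _ hxt _ hxt'))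
  have e4 := mul_le_mul_of_nonneg_left e3 hη
  have e5 : η * ‖z - z'‖ * ‖z - z'‖ ≤
      (∑ i, |w i - w' i| * Mχ i + ‖v - v'‖ + η * (d.Lω * ‖xt - xt'‖)) * ‖z - z'‖ := by
    nlinarith [mul_nonneg hα0 (sq_nonneg ‖z - z'‖)]
  rcases (norm_nonneg (z - z')).eq_or_lt with h0 | h0
  · rw [← h0, mul_zero]
    have hL : 0 ≤ d.Lω * ‖xt - xt'‖ := (norm_nonneg _).trans (d.lipschitz _ hxt _ hxt')
    have : 0 ≤ ∑ i, |w i - w' i| * Mχ i :=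
      Finset.sum_nonneg fun i _ => mul_nonneg (abs_nonneg _) (hM0 i)
    positivity
  · exact le_of_mul_le_mul_right e5 h0

end Prox

end ConEx

namespace ConEx

/-! ### Step-size relations -/

section StepSizes

variable {m : ℕ} (c : Constants m)

theorem norm_mkVec_sq (a : Fin m → ℝ) : ‖mkVec a‖ ^ 2 = ∑ i, a i ^ 2 := by
  rw [EuclideanSpace.norm_sq_eq]
  simp [mkVec]

theorem Constants.smooth_nonneg : 0 ≤ c.L₀ + c.B * c.LfAgg :=
  add_nonneg c.L₀_nonneg (mul_nonneg (zero_le_one.trans c.one_le_B) (norm_nonneg _))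

theorem Constants.two_le_t₀ : 2 ≤ c.t₀ := by
  have := div_nonneg (mul_nonneg (zero_le_four (α := ℝ)) c.smooth_nonneg) c.α₀_pos.le
  unfold Constants.t₀; linarith

theorem Constants.smooth_eq : c.L₀ + c.B * c.LfAgg = c.α₀ * (c.t₀ - 2) / 4 := by
  have := c.α₀_pos
  unfold Constants.t₀; field_simp; ring

theorem Constants.γ_pos (t : ℕ) : 0 < c.γ t := by
  have := c.two_le_t₀
  unfold Constants.γ; positivity

theorem Constants.γ_succ (t : ℕ) : c.γ (t + 1) = c.γ t + 1 := by
  unfold Constants.γ; push_cast; ring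

theorem Constants.γ_mul_θ_succ (t : ℕ) : c.γ (t + 1) * c.θ (t + 1) = c.γ t := by
  have h := c.γ_pos (t + 1)
  unfold Constants.γ Constants.θ at *
  field_simp; push_cast; ring

theorem Constants.γ_mul_η_succ (t : ℕ) :
    c.γ (t + 1) * c.η (t + 1) = c.γ t * (c.η t + c.α₀) := by
  unfold Constants.γ Constants.η
  push_cast; ring

theorem Constants.η_pos (t : ℕ) : 0 < c.η t := by
  have := c.two_le_t₀
  have := c.α₀_pos
  unfold Constants.η; positivity

/-- The coefficient with which `‖x_{t+1} - x_t‖²` enters the bound of the extrapolation terms. -/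
noncomputable def Constants.absorb (t : ℕ) : ℝ :=
  c.α₀ * (t + 2) * c.γ t ^ 2 / (16 * c.γ (t + 1))

theorem Constants.absorb_nonneg (t : ℕ) : 0 ≤ c.absorb t := by
  have := c.γ_pos t
  have := c.γ_pos (t + 1)
  have := c.α₀_pos
  unfold Constants.absorb; positivity

theorem Constants.absorb_mono (t : ℕ) : c.absorb t ≤ c.absorb (t + 1) := by
  have h1 := c.γ_pos t
  have h3 := c.α₀_pos
  unfold Constants.absorb
  rw [c.γ_succ (t + 1), c.γ_succ t]
  rw [div_le_div_iff₀ (by positivity) (by positivity)]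
  push_cast
  have : 0 ≤ 16 * c.α₀ * (((t : ℝ) + 1 + 2) * (c.γ t + 1) ^ 2 * (c.γ t + 1)
      - (t + 2) * c.γ t ^ 2 * (c.γ t + 1 + 1)) := by
    refine mul_nonneg (by positivity) ?_
    have : ((t : ℝ) + 1 + 2) * (c.γ t + 1) ^ 2 * (c.γ t + 1)
      - (t + 2) * c.γ t ^ 2 * (c.γ t + 1 + 1) = (t + 2) * ((c.γ t) ^ 2 + 3 * c.γ t + 1)
        + (c.γ t + 1) ^ 3 := by ring
    rw [this]; positivity
  linarith

/-- The quadratic terms produced by the extrapolation, together with a reserve `α₀ γ_t² / 16`, are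
dominated by what is left of the prox term after the smoothness constants are subtracted. -/
theorem Constants.absorb_add_le (t : ℕ) :
    c.absorb t + 2 * c.absorb (t + 1) + c.α₀ * c.γ t ^ 2 / 16
      ≤ c.γ t * (c.η t - (c.L₀ + c.B * c.LfAgg)) / 2 := by
  have h1 := c.γ_pos t
  have h3 := c.α₀_pos
  have h4 := c.two_le_t₀
  rw [c.smooth_eq]
  have e : c.γ t * (c.η t - c.α₀ * (c.t₀ - 2) / 4) / 2
      = c.α₀ * (c.γ t * (2 * c.γ t + 2 * t + 4)) / 16 := by
    unfold Constants.η Constants.γ; ring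
  rw [e]
  unfold Constants.absorb
  rw [c.γ_succ (t + 1), c.γ_succ t]
  obtain ⟨b, hb, hg⟩ : ∃ b : ℝ, 0 ≤ b ∧ c.γ t = t + 4 + b :=
    ⟨c.t₀ - 2, by linarith, by unfold Constants.γ; ring⟩
  rw [hg]
  push_cast
  have ht : (0 : ℝ) ≤ t := Nat.cast_nonneg t
  generalize (t : ℝ) = s at *
  have hs1 : 0 < s + 4 + b + 1 := by positivity
  have hs2 : 0 < s + 4 + b + 1 + 1 := by positivity
  have key : (s + 2) * (s + 4 + b) ^ 2 / (s + 4 + b + 1)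
      + 2 * ((s + 1 + 2) * (s + 4 + b + 1) ^ 2 / (s + 4 + b + 1 + 1)) + (s + 4 + b) ^ 2
      ≤ (s + 4 + b) * (2 * (s + 4 + b) + 2 * s + 4) := by
    rw [mul_div_assoc', div_add_div _ _ hs1.ne' hs2.ne', ← le_sub_iff_add_le,
      div_le_iff₀ (by positivity), ← sub_nonneg]
    ring_nf
    positivity
  have h5 := mul_le_mul_of_nonneg_left key (show 0 ≤ c.α₀ / 16 by positivity)
  calc _ = c.α₀ / 16 * ((s + 2) * (s + 4 + b) ^ 2 / (s + 4 + b + 1)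
      + 2 * ((s + 1 + 2) * (s + 4 + b + 1) ^ 2 / (s + 4 + b + 1 + 1)) + (s + 4 + b) ^ 2) := by
        field_simp
    _ ≤ _ := h5
    _ = _ := by ring

end StepSizes

/-! ### Summation of the one-step inequalities along a trajectory -/

section Summation

/-- The sequence shifted by one place, with first term `0`. -/
def prev (f : ℕ → ℝ) : ℕ → ℝ
  | 0 => 0
  | t + 1 => f t

theorem prev_nonneg {f : ℕ → ℝ} (hf : ∀ t, 0 ≤ f t) : ∀ t, 0 ≤ prev f t
  | 0 => le_rfl
  | t + 1 => hf t

/-- Collects the coefficients of each `e t` when every index contributes with its predecessor and the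
last index counts twice. -/
theorem sum_add_prev_le {a e : ℕ → ℝ} (ha : ∀ t, 0 ≤ a t) (hmono : ∀ t, a t ≤ a (t + 1))
    (he : ∀ t, 0 ≤ e t) (k : ℕ) :
    ∑ t ∈ Finset.range (k + 1), a t * (e t + prev e t) + a k * (e k + prev e k)
      ≤ ∑ t ∈ Finset.range (k + 1), (a t + 2 * a (t + 1)) * e t := by
  have h1 : ∀ n, ∑ t ∈ Finset.range n, a t * (e t + prev e t) + a n * prev e n
      = ∑ t ∈ Finset.range n, (a t + a (t + 1)) * e t := by
    intro n
    induction n with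
    | zero => simp [prev]
    | succ n ih =>
      rw [Finset.sum_range_succ, Finset.sum_range_succ, ← ih]
      simp only [prev]; ring
  have h2 : a k * prev e k ≤ ∑ t ∈ Finset.range (k + 1), a (t + 1) * e t := by
    cases k with
    | zero => simpa [prev] using mul_nonneg (ha _) (he _)
    | succ j =>
      refine Finset.single_le_sum (f := fun t => a (t + 1) * e t)
        (fun t _ => mul_nonneg (ha _) (he _)) ?_
      simp
  have h3 := h1 (k + 1)
  rw [show prev e (k + 1) = e k from rfl] at h3
  have h4 := mul_le_mul_of_nonneg_right (hmono k) (he k)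
  have h5 : ∑ t ∈ Finset.range (k + 1), (a t + 2 * a (t + 1)) * e t
      = ∑ t ∈ Finset.range (k + 1), (a t + a (t + 1)) * e t
        + ∑ t ∈ Finset.range (k + 1), a (t + 1) * e t := by
    rw [← Finset.sum_add_distrib]
    exact Finset.sum_congr rfl fun t _ => by ring
  rw [h5]
  linarith

variable {V : Type*} [NormedAddCommGroup V] [InnerProductSpace ℝ V]

theorem inner_le_young {κ : ℝ} (hκ : 0 < κ) (u v : V) :
    inner ℝ u v ≤ κ / 2 * ‖u‖ ^ 2 + ‖v‖ ^ 2 / (2 * κ) := by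
  refine (real_inner_le_norm u v).trans ?_
  have : κ / 2 * ‖u‖ ^ 2 + ‖v‖ ^ 2 / (2 * κ) - ‖u‖ * ‖v‖ = (κ * ‖u‖ - ‖v‖) ^ 2 / (2 * κ) := by
    field_simp; ring
  have h2 : 0 ≤ (κ * ‖u‖ - ‖v‖) ^ 2 / (2 * κ) := by positivity
  linarith

/-- Telescoping of the weighted one-step inequalities.  The extrapolation makes the differences
`p_t = γ_{t-1} (v_t - v_{t-1})` telescope up to the inner products with `y_{t+1} - y_t`. -/
theorem telescope {γ η τ : ℕ → ℝ} {α L H : ℝ} {n : ℕ} (hγ : ∀ t, 0 ≤ γ t)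
    (hγη : ∀ t, γ (t + 1) * η (t + 1) = γ t * (η t + α))
    (hκ : ∀ t, γ (t + 1) * τ (t + 1) ≤ γ t * τ t)
    {Q W r d e : ℕ → ℝ} {y v s p δ : ℕ → V} {Y : V} (hp0 : p 0 = 0)
    (hp : ∀ t, p (t + 1) = γ t • (v (t + 1) - v t))
    (hs : ∀ t, γ t • s t = γ t • v t + p t)
    (hstep : ∀ t < n, Q t ≤ η t * W t - (η t + α) * W (t + 1) - η t / 2 * r t ^ 2
      + L / 2 * r t ^ 2 + H * r t + d t * r t - e t + inner ℝ (Y - y (t + 1)) (v (t + 1) - δ t))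
    (hy : ∀ t < n, inner ℝ (Y - y (t + 1)) (s t)
      ≤ τ t * inner ℝ (Y - y (t + 1)) (y (t + 1) - y t)) :
    ∑ t ∈ Finset.range n, γ t * Q t + γ n * η n * W n + γ n * τ n / 2 * ‖Y - y n‖ ^ 2
      ≤ γ 0 * η 0 * W 0 + γ 0 * τ 0 / 2 * ‖Y - y 0‖ ^ 2 + inner ℝ (Y - y n) (p n)
        + ∑ t ∈ Finset.range n, (inner ℝ (y (t + 1) - y t) (p t)
          - γ t * τ t / 2 * ‖y (t + 1) - y t‖ ^ 2 - γ t * (η t - L) / 2 * r t ^ 2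
          + γ t * (H + d t) * r t - γ t * e t - γ t * inner ℝ (Y - y (t + 1)) (δ t)) := by
  induction n with
  | zero => simp [hp0]
  | succ n ih =>
    have ih := ih (fun t ht => hstep t (by omega)) (fun t ht => hy t (by omega))
    rw [Finset.sum_range_succ, Finset.sum_range_succ]
    have h1 := mul_le_mul_of_nonneg_left (hstep n (by omega)) (hγ n)
    have h2 := mul_le_mul_of_nonneg_left (hy n (by omega)) (hγ n)
    have h3 : γ n * inner ℝ (Y - y (n + 1)) (s n)
        = γ n * inner ℝ (Y - y (n + 1)) (v n) + inner ℝ (Y - y (n + 1)) (p n) := by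
      rw [← inner_smul_right, hs, inner_add_right, inner_smul_right]
    have h4 : γ n * inner ℝ (Y - y (n + 1)) (v (n + 1) - δ n)
        = inner ℝ (Y - y (n + 1)) (p (n + 1)) + γ n * inner ℝ (Y - y (n + 1)) (v n)
          - γ n * inner ℝ (Y - y (n + 1)) (δ n) := by
      rw [hp, inner_smul_right]
      simp only [inner_sub_right]; ring
    have h5 : inner ℝ (Y - y (n + 1)) (p n)
        = inner ℝ (Y - y n) (p n) - inner ℝ (y (n + 1) - y n) (p n) := by
      rw [← inner_sub_left]; congr 1; abel
    have h6 : ‖Y - y n‖ ^ 2 = ‖Y - y (n + 1)‖ ^ 2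
        + 2 * inner ℝ (Y - y (n + 1)) (y (n + 1) - y n) + ‖y (n + 1) - y n‖ ^ 2 := by
      rw [← norm_add_sq_real]; congr 2; abel
    have h7 := mul_le_mul_of_nonneg_right (hκ n) (sq_nonneg ‖Y - y (n + 1)‖)
    have h8 : γ (n + 1) * η (n + 1) * W (n + 1) = γ n * (η n + α) * W (n + 1) := by
      rw [hγη n]
    rw [h6] at ih
    nlinarith

end Summation

end ConEx

namespace ConEx

section SummationBound

variable {m : ℕ} (c : Constants m)

/-- The dual step sizes `τ_t = K / (t + 1)`. -/
noncomputable def dualStep (K : ℝ) (t : ℕ) : ℝ := K / ((t : ℝ) + 1)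

theorem Constants.add_two_le_γ (t : ℕ) : (t : ℝ) + 4 ≤ c.γ t := by
  have := c.two_le_t₀
  unfold Constants.γ; linarith

theorem Constants.γ_mul_dualStep_succ_le {K : ℝ} (hK : 0 ≤ K) (t : ℕ) :
    c.γ (t + 1) * dualStep K (t + 1) ≤ c.γ t * dualStep K t := by
  have h := c.add_two_le_γ t
  rw [c.γ_succ]
  unfold dualStep
  rw [mul_div_assoc', mul_div_assoc', div_le_div_iff₀ (by positivity) (by positivity)]
  push_cast
  have : K * ((c.γ t + 1) * (t + 1)) ≤ K * (c.γ t * (t + 1 + 1)) :=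
    mul_le_mul_of_nonneg_left (by nlinarith) hK
  linarith

variable {V : Type*} [NormedAddCommGroup V] [InnerProductSpace ℝ V]

/-- Young's inequality for one extrapolation term, split into a part absorbed by the prox terms and
a noise part. -/
theorem extrapolation_term_le {K M : ℝ} (hK : 0 < K) (hKM : 32 * M ^ 2 / c.α₀ ≤ K) (t : ℕ)
    {R N : ℝ} (hR : 0 ≤ R) (hN : 0 ≤ N) {q : V}
    (hq : ‖q‖ ^ 2 ≤ 4 * M ^ 2 * R + 8 * N) :
    ‖c.γ t • q‖ ^ 2 / (2 * (c.γ (t + 1) * dualStep K (t + 1)))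
      ≤ c.absorb t * R + 4 / K * ((t + 2) * c.γ t * N) := by
  have hg := c.γ_pos t
  have hα := c.α₀_pos
  have hM : 32 * M ^ 2 ≤ K * c.α₀ := (div_le_iff₀ hα).1 hKM
  rw [norm_smul, Real.norm_of_nonneg hg.le]
  unfold Constants.absorb dualStep
  rw [c.γ_succ]
  push_cast
  have e : (c.γ t * ‖q‖) ^ 2 / (2 * ((c.γ t + 1) * (K / ((t : ℝ) + 1 + 1))))
      = ((t : ℝ) + 2) * c.γ t ^ 2 / (2 * (c.γ t + 1) * K) * ‖q‖ ^ 2 := by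
    field_simp; ring
  rw [e]
  have h1 := mul_le_mul_of_nonneg_left hq
    (show 0 ≤ ((t : ℝ) + 2) * c.γ t ^ 2 / (2 * (c.γ t + 1) * K) by positivity)
  refine h1.trans ?_
  rw [mul_add]
  have h2 : ((t : ℝ) + 2) * c.γ t ^ 2 / (2 * (c.γ t + 1) * K) * (4 * M ^ 2 * R)
      ≤ c.α₀ * (t + 2) * c.γ t ^ 2 / (16 * (c.γ t + 1)) * R := by
    have : ((t : ℝ) + 2) * c.γ t ^ 2 / (2 * (c.γ t + 1) * K) * (4 * M ^ 2 * R)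
        = (32 * M ^ 2) * (((t : ℝ) + 2) * c.γ t ^ 2 * R / (16 * (c.γ t + 1) * K)) := by
      field_simp; ring
    rw [this]
    refine (mul_le_mul_of_nonneg_right hM (by positivity)).trans (le_of_eq ?_)
    field_simp
  have h3 : ((t : ℝ) + 2) * c.γ t ^ 2 / (2 * (c.γ t + 1) * K) * (8 * N)
      ≤ 4 / K * ((t + 2) * c.γ t * N) := by
    have : ((t : ℝ) + 2) * c.γ t ^ 2 / (2 * (c.γ t + 1) * K) * (8 * N)
        = 4 / K * ((t + 2) * c.γ t * N) * (c.γ t / (c.γ t + 1)) := by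
      field_simp; ring
    rw [this]
    refine mul_le_of_le_one_right (by positivity) ?_
    rw [div_le_one (by positivity)]; linarith
  linarith

/-- Young's inequality for the nonsmoothness and the gradient noise; `α g² / 16` is the reserve left
by `Constants.absorb_add_le`. -/
theorem prox_term_le {g α H d r : ℝ} (hα : 0 < α) :
    g * (H + d) * r ≤ α * g ^ 2 / 16 * r ^ 2 + 8 / α * (H ^ 2 + d ^ 2) := by
  have h1 : α * g ^ 2 / 16 * r ^ 2 + 4 / α * (H + d) ^ 2 - g * (H + d) * r
      = (α * g * r / 8 - (H + d)) ^ 2 * (4 / α) := by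
    field_simp; ring
  have h2 : 0 ≤ (α * g * r / 8 - (H + d)) ^ 2 * (4 / α) := by positivity
  have h3 : 8 / α * (H ^ 2 + d ^ 2) - 4 / α * (H + d) ^ 2 = 4 / α * (H - d) ^ 2 := by
    field_simp; ring
  have h4 : 0 ≤ 4 / α * (H - d) ^ 2 := by positivity
  linarith

/-- The accumulated contribution of the noise `N_t` of the constraint oracle to the extrapolation
terms of `k + 1` steps. -/
noncomputable def Constants.extrapNoise (K : ℝ) (N : ℕ → ℝ) (k : ℕ) : ℝ :=
  4 / K * (∑ t ∈ Finset.range (k + 1), ((t : ℝ) + 2) * c.γ t * (N t + prev N t)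
    + ((k : ℝ) + 2) * c.γ k * (N k + prev N k)) + c.γ 0 * N 0 / K

/-- Summation of the one-step inequalities: all terms that involve the successive differences of
primal and dual iterates are absorbed, and only noise terms remain.  The initial dual error
`⟨y₁ - y₀, δ₀⟩` is kept apart, since `y₁` depends on the sample entering `δ₀`. -/
theorem summation_bound {K M H : ℝ} (hK : 0 < K) (hKM : 32 * M ^ 2 / c.α₀ ≤ K) {k : ℕ}
    {Q W r d e N : ℕ → ℝ} (hN : ∀ t, 0 ≤ N t) {y v s p δ yy : ℕ → V} {Y : V} (hp0 : p 0 = 0)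
    (hp : ∀ t, p (t + 1) = c.γ t • (v (t + 1) - v t))
    (hs : ∀ t, c.γ t • s t = c.γ t • v t + p t)
    (hstep : ∀ t < k + 1, Q t ≤ c.η t * W t - (c.η t + c.α₀) * W (t + 1) - c.η t / 2 * r t ^ 2
      + (c.L₀ + c.B * c.LfAgg) / 2 * r t ^ 2 + H * r t + d t * r t - e t
      + inner ℝ (Y - y (t + 1)) (v (t + 1) - δ t))
    (hy : ∀ t < k + 1, inner ℝ (Y - y (t + 1)) (s t)
      ≤ dualStep K t * inner ℝ (Y - y (t + 1)) (y (t + 1) - y t))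
    (hy0 : y 0 = 0)
    (hq : ∀ t < k + 1, ‖v (t + 1) - v t‖ ^ 2
      ≤ 4 * M ^ 2 * (r t ^ 2 + prev (fun t => r t ^ 2) t) + 8 * (N t + prev N t))
    (hδ : ‖δ 0‖ ^ 2 ≤ 2 * N 0) (hyy0 : yy 0 = 0) (hyy : ∀ t, yy (t + 1) = y (t + 2)) :
    ∑ t ∈ Finset.range (k + 1), c.γ t * Q t + c.γ (k + 1) * c.η (k + 1) * W (k + 1)
        + c.γ (k + 1) * dualStep K (k + 1) / 4 * ‖Y - y (k + 1)‖ ^ 2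
      ≤ c.γ 0 * c.η 0 * W 0 + c.γ 0 * K / 2 * ‖Y‖ ^ 2
        + ∑ t ∈ Finset.range (k + 1), 8 / c.α₀ * (H ^ 2 + d t ^ 2) + c.extrapNoise K N k
        - ∑ t ∈ Finset.range (k + 1), c.γ t * e t
        - inner ℝ Y (∑ t ∈ Finset.range (k + 1), c.γ t • δ t)
        + ∑ t ∈ Finset.range (k + 1), c.γ t * inner ℝ (yy t) (δ t) := by
  have hκpos : ∀ t, 0 < c.γ t * dualStep K t := fun t =>
    mul_pos (c.γ_pos t) (by unfold dualStep; positivity)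
  have hT := telescope (fun t => (c.γ_pos t).le) c.γ_mul_η_succ (c.γ_mul_dualStep_succ_le hK.le)
    hp0 hp hs hstep hy
  have hrnn : ∀ t, 0 ≤ r t ^ 2 := fun t => sq_nonneg _
  have hRnn : ∀ t, 0 ≤ r t ^ 2 + prev (fun t => r t ^ 2) t := fun t =>
    add_nonneg (hrnn t) (prev_nonneg hrnn t)
  have hNnn : ∀ t, 0 ≤ N t + prev N t := fun t => add_nonneg (hN t) (prev_nonneg hN t)
  -- The bounds `b t` for `‖p_{t+1}‖² / (2 κ_{t+1})`.
  let b : ℕ → ℝ := fun t => c.absorb t * (r t ^ 2 + prev (fun t => r t ^ 2) t)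
    + 4 / K * ((t + 2) * c.γ t * (N t + prev N t))
  have hb : ∀ t < k + 1,
      ‖p (t + 1)‖ ^ 2 / (2 * (c.γ (t + 1) * dualStep K (t + 1))) ≤ b t := by
    intro t ht
    rw [hp]
    exact extrapolation_term_le c hK hKM t (hRnn t) (hNnn t) (hq t ht)
  -- The end term is split with half the weight `κ_{k+1} / 2`, so that a quarter of `κ_{k+1}` remains
  -- to control the dual error.
  have hend : inner ℝ (Y - y (k + 1)) (p (k + 1))
      ≤ c.γ (k + 1) * dualStep K (k + 1) / 4 * ‖Y - y (k + 1)‖ ^ 2 + 2 * b k := by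
    have h1 := inner_le_young (half_pos (hκpos (k + 1))) (Y - y (k + 1)) (p (k + 1))
    have h2 := hb k (by omega)
    have h3 : ‖p (k + 1)‖ ^ 2 / (2 * (c.γ (k + 1) * dualStep K (k + 1) / 2))
        = 2 * (‖p (k + 1)‖ ^ 2 / (2 * (c.γ (k + 1) * dualStep K (k + 1)))) := by
      have := (hκpos (k + 1)).ne'
      field_simp
    rw [h3] at h1
    linarith
  -- At `t = 0` the extrapolation term vanishes and the quadratic term in `y₁` is free to absorb
  -- the inner product of `y₁` with `δ₀`.
  have hterm : ∀ t < k + 1, inner ℝ (y (t + 1) - y t) (p t)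
          - c.γ t * dualStep K t / 2 * ‖y (t + 1) - y t‖ ^ 2
          - c.γ t * inner ℝ (Y - y (t + 1)) (δ t)
        ≤ prev b t + (if t = 0 then c.γ 0 * N 0 / K else 0) - c.γ t * inner ℝ Y (δ t)
          + c.γ t * inner ℝ (yy t) (δ t) := by
    intro t ht
    cases t with
    | zero =>
      have h1 := inner_le_young (hκpos 0) (y 1) (c.γ 0 • δ 0)
      have h2 : ‖c.γ 0 • δ 0‖ ^ 2 / (2 * (c.γ 0 * dualStep K 0)) ≤ c.γ 0 * N 0 / K := by
        rw [norm_smul, Real.norm_of_nonneg (c.γ_pos 0).le]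
        have hg := c.γ_pos 0
        have : (c.γ 0 * ‖δ 0‖) ^ 2 / (2 * (c.γ 0 * dualStep K 0))
            = c.γ 0 / (2 * K) * ‖δ 0‖ ^ 2 := by
          unfold dualStep; field_simp; simp
        rw [this]
        refine (mul_le_mul_of_nonneg_left hδ (by positivity)).trans (le_of_eq ?_)
        field_simp
      rw [inner_smul_right] at h1
      simp only [hp0, hyy0, hy0, inner_zero_right, inner_zero_left, sub_zero, inner_sub_left,
        prev, if_true, mul_zero, zero_add]
      linarith
    | succ t =>
      have h1 := inner_le_young (hκpos (t + 1)) (y (t + 1 + 1) - y (t + 1)) (p (t + 1))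
      have h2 := hb t (by omega)
      rw [hyy, inner_sub_left (x := Y)]
      simp only [prev, Nat.add_eq_zero_iff, one_ne_zero, and_false, if_false]
      linarith
  have hprox : ∀ t, -(c.γ t * (c.η t - (c.L₀ + c.B * c.LfAgg)) / 2 * r t ^ 2)
      + c.γ t * (H + d t) * r t ≤ -((c.absorb t + 2 * c.absorb (t + 1)) * r t ^ 2)
        + 8 / c.α₀ * (H ^ 2 + d t ^ 2) := by
    intro t
    have h1 := mul_le_mul_of_nonneg_right (c.absorb_add_le t) (hrnn t)
    have h2 := prox_term_le (g := c.γ t) (H := H) (d := d t) (r := r t) c.α₀_pos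
    linarith
  have hsum : ∑ t ∈ Finset.range (k + 1), (inner ℝ (y (t + 1) - y t) (p t)
          - c.γ t * dualStep K t / 2 * ‖y (t + 1) - y t‖ ^ 2
          - c.γ t * (c.η t - (c.L₀ + c.B * c.LfAgg)) / 2 * r t ^ 2
          + c.γ t * (H + d t) * r t - c.γ t * e t - c.γ t * inner ℝ (Y - y (t + 1)) (δ t))
      ≤ ∑ t ∈ Finset.range (k + 1), (prev b t + (if t = 0 then c.γ 0 * N 0 / K else 0)
          - c.γ t * inner ℝ Y (δ t) + c.γ t * inner ℝ (yy t) (δ t)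
          - ((c.absorb t + 2 * c.absorb (t + 1)) * r t ^ 2)
          + 8 / c.α₀ * (H ^ 2 + d t ^ 2) - c.γ t * e t) := by
    refine Finset.sum_le_sum fun t ht => ?_
    have h1 := hterm t (Finset.mem_range.1 ht)
    have h2 := hprox t
    linarith
  have hprev : ∑ t ∈ Finset.range (k + 1), prev b t + 2 * b k
      = ∑ t ∈ Finset.range (k + 1), b t + b k := by
    rw [Finset.sum_range_succ', Finset.sum_range_succ]
    simp only [prev]; ring
  have hbsum : ∑ t ∈ Finset.range (k + 1), b t + b k
      ≤ ∑ t ∈ Finset.range (k + 1), (c.absorb t + 2 * c.absorb (t + 1)) * r t ^ 2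
        + 4 / K * (∑ t ∈ Finset.range (k + 1), ((t : ℝ) + 2) * c.γ t * (N t + prev N t)
          + ((k : ℝ) + 2) * c.γ k * (N k + prev N k)) := by
    have := sum_add_prev_le c.absorb_nonneg c.absorb_mono hrnn k
    simp only [b, Finset.sum_add_distrib, ← Finset.mul_sum]
    linarith
  have hite : ∑ t ∈ Finset.range (k + 1), (if t = 0 then c.γ 0 * N 0 / K else 0)
      = c.γ 0 * N 0 / K := by
    rw [Finset.sum_ite_eq' (Finset.range (k + 1)) 0 (fun _ => c.γ 0 * N 0 / K)]; simp
  have hY : inner ℝ Y (∑ t ∈ Finset.range (k + 1), c.γ t • δ t)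
      = ∑ t ∈ Finset.range (k + 1), c.γ t * inner ℝ Y (δ t) := by
    rw [inner_sum]; simp only [inner_smul_right]
  have hτ0 : dualStep K 0 = K := by unfold dualStep; simp
  rw [hy0, sub_zero, hτ0] at hT
  rw [hY]
  unfold Constants.extrapNoise
  replace hT := hT.trans (add_le_add_right hsum _)
  simp only [Finset.sum_add_distrib, Finset.sum_sub_distrib, hite] at hT
  linarith

end SummationBound

end ConEx

namespace ConEx

/-! ### Vectors of linear functionals -/

section DualVectors

variable {E : Type*} [NormedAddCommGroup E] [NormedSpace ℝ E] {m : ℕ}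

theorem inner_mkVec (a : Vec m) (b : Fin m → ℝ) : inner ℝ a (mkVec b) = ∑ i, a i * b i := by
  simp [PiLp.inner_apply, mkVec, mul_comm]

theorem norm_mkVec_le {a b : Fin m → ℝ} {r : ℝ} (hr : 0 ≤ r) (h : ∀ i, |a i| ≤ b i * r) :
    ‖mkVec a‖ ≤ ‖mkVec b‖ * r := by
  refine le_of_sq_le_sq ?_ (by positivity)
  rw [mul_pow, norm_mkVec_sq, norm_mkVec_sq, Finset.sum_mul]
  refine Finset.sum_le_sum fun i _ => ?_
  rw [← sq_abs, ← mul_pow]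
  exact pow_le_pow_left₀ (abs_nonneg _) (h i) 2

theorem sum_mul_le_norm_mul_norm (a : Vec m) (b : Fin m → ℝ) :
    ∑ i, a i * b i ≤ ‖a‖ * ‖mkVec b‖ := by
  rw [← inner_mkVec]; exact real_inner_le_norm _ _

/-- The vector of values `(⟨g_i, u⟩)_i`. -/
def applyVec (g : Fin m → StrongDual ℝ E) (u : E) : Vec m := mkVec fun i => g i u

/-- The Euclidean norm of the vector of dual norms `(‖g_i‖_*)_i`. -/
noncomputable def dualNorm (g : Fin m → StrongDual ℝ E) : ℝ := ‖mkVec fun i => ‖g i‖‖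

theorem dualNorm_nonneg (g : Fin m → StrongDual ℝ E) : 0 ≤ dualNorm g := norm_nonneg _

theorem dualNorm_sq (g : Fin m → StrongDual ℝ E) : dualNorm g ^ 2 = ∑ i, ‖g i‖ ^ 2 :=
  norm_mkVec_sq _

theorem norm_applyVec_le (g : Fin m → StrongDual ℝ E) (u : E) :
    ‖applyVec g u‖ ≤ dualNorm g * ‖u‖ :=
  norm_mkVec_le (norm_nonneg u) fun i => (g i).le_opNorm u

theorem norm_sum_smul_le (w : Vec m) (g : Fin m → StrongDual ℝ E) :
    ‖∑ i, w i • g i‖ ≤ ‖w‖ * dualNorm g := by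
  refine (norm_sum_le _ _).trans ?_
  have h : ‖mkVec fun i => |w i|‖ = ‖w‖ := by
    rw [← sq_eq_sq₀ (norm_nonneg _) (norm_nonneg _), norm_mkVec_sq, EuclideanSpace.norm_sq_eq]
    simp
  have := sum_mul_le_norm_mul_norm (mkVec fun i => |w i|) fun i => ‖g i‖
  rw [h] at this
  refine le_trans (le_of_eq (Finset.sum_congr rfl fun i _ => ?_)) this
  rw [norm_smul]; rfl

/-- The projection onto the nonnegative orthant satisfies the variational inequality. -/
theorem inner_sub_posVec_le (u : Vec m) {Y : Vec m} (hY : ∀ i, 0 ≤ Y i) :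
    inner ℝ (Y - posVec u) (u - posVec u) ≤ 0 := by
  rw [PiLp.inner_apply]
  refine Finset.sum_nonpos fun i _ => ?_
  simp only [PiLp.sub_apply, posVec, mkVec, RCLike.inner_apply, conj_trivial]
  rcases le_total (u i) 0 with h | h
  · rw [max_eq_right h]
    nlinarith [hY i]
  · rw [max_eq_left h]; simp

theorem posVec_nonneg (u : Vec m) (i : Fin m) : 0 ≤ posVec u i := le_max_right _ _

theorem inner_posVec_self (u : Vec m) : inner ℝ (posVec u) u = ‖posVec u‖ ^ 2 := by
  rw [← real_inner_self_eq_norm_sq, PiLp.inner_apply, PiLp.inner_apply]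
  refine Finset.sum_congr rfl fun i _ => ?_
  simp only [posVec, mkVec, RCLike.inner_apply, conj_trivial]
  rcases le_total (u i) 0 with h | h
  · rw [max_eq_right h]; simp
  · rw [max_eq_left h]

theorem inner_le_inner_posVec {w : Vec m} (hw : ∀ i, 0 ≤ w i) (u : Vec m) :
    inner ℝ w u ≤ inner ℝ w (posVec u) := by
  rw [PiLp.inner_apply, PiLp.inner_apply]
  refine Finset.sum_le_sum fun i _ => ?_
  simp only [posVec, mkVec, RCLike.inner_apply, conj_trivial]
  exact mul_le_mul_of_nonneg_right (le_max_left _ _) (hw i)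

/-- The projected dual step with step size `1 / τ` satisfies the proximal inequality. -/
theorem inner_dual_step_le {τ : ℝ} (hτ : 0 < τ) (y s : Vec m) {Y : Vec m} (hY : ∀ i, 0 ≤ Y i) :
    inner ℝ (Y - posVec (y + (1 / τ) • s)) s
      ≤ τ * inner ℝ (Y - posVec (y + (1 / τ) • s)) (posVec (y + (1 / τ) • s) - y) := by
  have h := inner_sub_posVec_le (y + (1 / τ) • s) hY
  set z := posVec (y + (1 / τ) • s)
  have e : y + (1 / τ) • s - z = (1 / τ) • s - (z - y) := by abel
  rw [e, inner_sub_right, inner_smul_right] at h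
  have h2 := mul_nonpos_of_nonneg_of_nonpos hτ.le h
  have h3 : τ * (1 / τ * inner ℝ (Y - z) s - inner ℝ (Y - z) (z - y))
      = inner ℝ (Y - z) s - τ * inner ℝ (Y - z) (z - y) := by field_simp
  linarith

end DualVectors

/-! ### The one-step inequality -/

section OneStep

variable {E : Type*} [NormedAddCommGroup E] [NormedSpace ℝ E] {m : ℕ} {S : Type*}

/-- The error `F(x, s) - f(x)` of the stochastic constraint value. -/
def Oracle.valueNoise (o : Oracle E m S) (p : Problem E m) (x : E) (s : S) : Vec m :=
  o.F x s - p.fVec x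

/-- The errors `G_i(x, s) - f_i'(x)` of the stochastic constraint subgradients. -/
def Oracle.gradNoise (o : Oracle E m S) (f' : Fin m → E → StrongDual ℝ E) (x : E) (s : S) :
    Fin m → StrongDual ℝ E :=
  fun i => o.G i x s - f' i x

/-- The error `G₀(x, s) - f₀'(x) + ∑ᵢ wᵢ (Gᵢ(x, s) - fᵢ'(x))` of the stochastic subgradient of the
Lagrange function with multipliers `w`. -/
def Oracle.lagrNoise (o : Oracle E m S) (f₀' : E → StrongDual ℝ E)
    (f' : Fin m → E → StrongDual ℝ E) (x : E) (w : Vec m) (s : S) : StrongDual ℝ E :=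
  o.G₀ x s - f₀' x + ∑ i, w i • o.gradNoise f' x s i

/-- The nonsmoothness constant of `f₀ + ∑ᵢ Yᵢ fᵢ` for `‖Y‖₂ = R`, where the part of the smoothness
constant exceeding `L₀ + B L_f` is converted by means of the diameter `D`. -/
noncomputable def Constants.nonsmooth (c : Constants m) (D R : ℝ) : ℝ :=
  c.H₀ + R * c.HfAgg + c.LfAgg * D * max (R - c.B) 0 / 2

theorem Constants.nonsmooth_nonneg (c : Constants m) {D R : ℝ} (hD : 0 ≤ D) (hR : 0 ≤ R) :
    0 ≤ c.nonsmooth D R := by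
  have h1 := c.H₀_nonneg
  have h2 : 0 ≤ c.HfAgg := norm_nonneg _
  have h3 : 0 ≤ c.LfAgg := norm_nonneg _
  have h4 : 0 ≤ max (R - c.B) 0 := le_max_right _ _
  unfold Constants.nonsmooth; positivity

theorem Constants.nonsmooth_mono (c : Constants m) {D R R' : ℝ} (hD : 0 ≤ D) (h : R ≤ R') :
    c.nonsmooth D R ≤ c.nonsmooth D R' := by
  have h2 : 0 ≤ c.HfAgg := norm_nonneg _
  have h3 : 0 ≤ c.LfAgg := norm_nonneg _
  unfold Constants.nonsmooth
  gcongr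

/-- The gap `ψ₀(x') - ψ₀(x^*) + ⟨Y, ψ(x')⟩ - ⟨w, ψ(x^*)⟩` of the Lagrange function. -/
noncomputable def Problem.gap (p : Problem E m) (xs : E) (Y w : Vec m) (x' : E) : ℝ :=
  p.ψ₀ x' - p.ψ₀ xs + inner ℝ Y (p.ψ x') - inner ℝ w (p.ψ xs)

/-- One step of the method.  The constraints at the new point are compared with their exact
linearization at the old point, which is what the dual step extrapolates. -/
theorem one_step [FiniteDimensional ℝ E] {p : Problem E m} (hp : p.IsConvex) {d : DistGen p.X}
    {c : Constants m} (hreg : p.Regular d c) {o : Oracle E m S}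
    {f₀' : E → StrongDual ℝ E} {f' : Fin m → E → StrongDual ℝ E} {x x' xs : E}
    (hx : x ∈ p.X) (hx' : x' ∈ p.X) (hxs : xs ∈ p.X)
    (hf₀ : f₀' x ∈ subdiff p.X p.f₀ x) (hf : ∀ i, f' i x ∈ subdiff p.X (p.f i) x)
    {w Y : Vec m} (hw : ∀ i, 0 ≤ w i) (hY : ∀ i, 0 ≤ Y i) {s : S} {η : ℝ} (hη : 0 ≤ η)
    (hprox : p.IsProx d w (o.G₀ x s + ∑ i, w i • o.G i x s) x η x') :
    p.gap xs Y w x' ≤ η * d.W xs x - (η + c.α₀) * d.W xs x' - η / 2 * ‖x' - x‖ ^ 2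
      + (c.L₀ + c.B * c.LfAgg) / 2 * ‖x' - x‖ ^ 2 + c.nonsmooth d.diam ‖Y‖ * ‖x' - x‖
      + ‖o.lagrNoise f₀' f' x w s‖ * ‖x' - x‖ - o.lagrNoise f₀' f' x w s (x - xs)
      + inner ℝ (Y - w) (p.χVec x' + (p.fVec x + applyVec (fun i => f' i x) (x' - x))) := by
  set r := ‖x' - x‖ with hr
  have hr0 : 0 ≤ r := norm_nonneg _
  have hrD : r ≤ d.diam := d.norm_sub_le_diam hp.compact_X hx hx'
  set g := o.lagrNoise f₀' f' x w s with hg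
  have h3p := hprox.three_point hp hreg.strong_χ₀ hw hxs
  have hWr := mul_le_mul_of_nonneg_left (d.half_sq_norm_le_W hx hx') hη
  -- the linear term of the prox step, in terms of true subgradients and noise
  have hv : ∀ u, (o.G₀ x s + ∑ i, w i • o.G i x s) u
      = f₀' x u + ∑ i, w i * f' i x u + g u := by
    intro u
    simp only [hg, Oracle.lagrNoise, Oracle.gradNoise, FunLike.coe_add, Pi.add_apply,
      FunLike.coe_sub, Pi.sub_apply, FunLike.coe_sum, Finset.sum_apply,
      FunLike.coe_smul, Pi.smul_apply, smul_eq_mul, mul_sub, Finset.sum_sub_distrib]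
    ring
  have hf₀1 := hreg.smooth_f₀ x' hx' x hx _ hf₀
  have hf₀2 := le_of_mem_subdiff hp.continuous_f₀ hx hf₀ hxs
  have hfi : ∑ i, Y i * p.f i x' - ∑ i, Y i * (p.f i x + f' i x (x' - x))
      ≤ ‖Y‖ * c.LfAgg / 2 * r ^ 2 + ‖Y‖ * c.HfAgg * r := by
    have h1 : ∑ i, Y i * p.f i x' - ∑ i, Y i * (p.f i x + f' i x (x' - x))
        ≤ ∑ i, Y i * (c.L i / 2 * r ^ 2 + c.H i * r) := by
      rw [← Finset.sum_sub_distrib]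
      refine Finset.sum_le_sum fun i _ => ?_
      have := mul_le_mul_of_nonneg_left (hreg.smooth_f i x' hx' x hx _ (hf i)) (hY i)
      linarith
    have h2 : ∑ i, Y i * (c.L i / 2 * r ^ 2 + c.H i * r)
        = (∑ i, Y i * c.L i) / 2 * r ^ 2 + (∑ i, Y i * c.H i) * r := by
      rw [Finset.sum_div, Finset.sum_mul, Finset.sum_mul, ← Finset.sum_add_distrib]
      exact Finset.sum_congr rfl fun i _ => by ring
    have h3 : ∑ i, Y i * c.L i ≤ ‖Y‖ * c.LfAgg := sum_mul_le_norm_mul_norm Y c.L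
    have h4 : ∑ i, Y i * c.H i ≤ ‖Y‖ * c.HfAgg := sum_mul_le_norm_mul_norm Y c.H
    have h5 := mul_le_mul_of_nonneg_right h3 (sq_nonneg r)
    have h6 := mul_le_mul_of_nonneg_right h4 hr0
    nlinarith
  have hfw : ∑ i, w i * (p.f i x + f' i x (xs - x)) ≤ ∑ i, w i * p.f i xs :=
    Finset.sum_le_sum fun i _ => mul_le_mul_of_nonneg_left
      (le_of_mem_subdiff (hp.continuous_f i) hx (hf i) hxs) (hw i)
  have hLf : 0 ≤ c.LfAgg := norm_nonneg _
  -- smoothness in excess of `B L_f` is turned into nonsmoothness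
  have hexc : ‖Y‖ * c.LfAgg / 2 * r ^ 2 ≤ c.B * c.LfAgg / 2 * r ^ 2
      + c.LfAgg * d.diam * max (‖Y‖ - c.B) 0 / 2 * r := by
    have h1 : ‖Y‖ - c.B ≤ max (‖Y‖ - c.B) 0 := le_max_left _ _
    have h2 : 0 ≤ max (‖Y‖ - c.B) 0 := le_max_right _ _
    have h3 := mul_le_mul_of_nonneg_right h1 (show 0 ≤ c.LfAgg / 2 * r ^ 2 by positivity)
    have h4 := mul_le_mul_of_nonneg_left hrD
      (show 0 ≤ max (‖Y‖ - c.B) 0 * c.LfAgg / 2 * r by positivity)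
    nlinarith
  have hnoise : -g (x' - x) ≤ ‖g‖ * r := by
    have := g.le_opNorm (x' - x)
    rw [Real.norm_eq_abs] at this
    exact (neg_le_abs _).trans this
  have e1 : inner ℝ Y (p.ψ x') = ∑ i, Y i * p.f i x' + ∑ i, Y i * p.χ i x' := by
    rw [Problem.ψ, inner_mkVec, ← Finset.sum_add_distrib]
    exact Finset.sum_congr rfl fun i _ => by ring
  have e2 : inner ℝ w (p.ψ xs) = ∑ i, w i * p.f i xs + ∑ i, w i * p.χ i xs := by
    rw [Problem.ψ, inner_mkVec, ← Finset.sum_add_distrib]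
    exact Finset.sum_congr rfl fun i _ => by ring
  have e3 : ∀ Z : Vec m,
      inner ℝ Z (p.χVec x' + (p.fVec x + applyVec (fun i => f' i x) (x' - x)))
        = ∑ i, Z i * p.χ i x' + ∑ i, Z i * (p.f i x + f' i x (x' - x)) := by
    intro Z
    simp only [inner_add_right, Problem.χVec, Problem.fVec, applyVec, inner_mkVec, mul_add,
      Finset.sum_add_distrib]
  have e4 : ∑ i, w i * (p.f i x + f' i x (x' - x)) - ∑ i, w i * (p.f i x + f' i x (xs - x))
      = ∑ i, w i * f' i x x' - ∑ i, w i * f' i x xs := by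
    rw [← Finset.sum_sub_distrib, ← Finset.sum_sub_distrib]
    exact Finset.sum_congr rfl fun i _ => by simp only [map_sub]; ring
  rw [inner_sub_left, e3, e3]
  unfold Problem.gap Constants.nonsmooth Problem.ψ₀
  rw [e1, e2]
  rw [hv, hv] at h3p
  simp only [map_sub] at hf₀1 hf₀2 hnoise
  rw [map_sub g]
  rw [← hr] at hf₀1 hWr
  linarith

end OneStep

end ConEx

namespace ConEx

/-! ### The bound along a trajectory of the method -/

section PathBound

variable {E : Type*} [NormedAddCommGroup E] [NormedSpace ℝ E] {m : ℕ} {S : Type*}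

/-- The sequence with its initial term replaced by `0`. -/
def zeroAtStart {α : Type*} [Zero α] (f : ℕ → α) : ℕ → α
  | 0 => 0
  | t + 1 => f (t + 1)

/-- The error of the stochastic linearization at `x`, evaluated at displacement `u`. -/
def Oracle.linNoise (o : Oracle E m S) (p : Problem E m) (f' : Fin m → E → StrongDual ℝ E)
    (x u : E) (s : S) : Vec m :=
  o.valueNoise p x s + applyVec (o.gradNoise f' x s) u

/-- Half of a bound for the squared error of the stochastic linearization at displacements of
length at most `D`. -/
noncomputable def Oracle.noiseSq (o : Oracle E m S) (p : Problem E m)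
    (f' : Fin m → E → StrongDual ℝ E) (D : ℝ) (x : E) (s : S) : ℝ :=
  ‖o.valueNoise p x s‖ ^ 2 + D ^ 2 * dualNorm (o.gradNoise f' x s) ^ 2

theorem Oracle.noiseSq_nonneg (o : Oracle E m S) (p : Problem E m)
    (f' : Fin m → E → StrongDual ℝ E) (D : ℝ) (x : E) (s : S) : 0 ≤ o.noiseSq p f' D x s := by
  unfold Oracle.noiseSq; positivity

theorem norm_applyVec_sq_le {g : Fin m → StrongDual ℝ E} {u : E} {D : ℝ} (hu : ‖u‖ ≤ D) :
    ‖applyVec g u‖ ^ 2 ≤ D ^ 2 * dualNorm g ^ 2 := by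
  rw [← mul_pow]
  refine pow_le_pow_left₀ (norm_nonneg _) ((norm_applyVec_le g u).trans ?_) 2
  rw [mul_comm]
  exact mul_le_mul_of_nonneg_right hu (dualNorm_nonneg g)

theorem norm_add_sq_le_two {V : Type*} [NormedAddCommGroup V] (a b : V) :
    ‖a + b‖ ^ 2 ≤ 2 * ‖a‖ ^ 2 + 2 * ‖b‖ ^ 2 := by
  have := norm_add_le a b
  have h := norm_nonneg (a + b)
  nlinarith [sq_nonneg (‖a‖ - ‖b‖)]

theorem Oracle.norm_linNoise_sq_le (o : Oracle E m S) (p : Problem E m)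
    (f' : Fin m → E → StrongDual ℝ E) {D : ℝ} (x : E) {u : E} (hu : ‖u‖ ≤ D) (s : S) :
    ‖o.linNoise p f' x u s‖ ^ 2 ≤ 2 * o.noiseSq p f' D x s := by
  have h1 := norm_add_sq_le_two (o.valueNoise p x s) (applyVec (o.gradNoise f' x s) u)
  have h2 := norm_applyVec_sq_le (g := o.gradNoise f' x s) hu
  unfold Oracle.linNoise Oracle.noiseSq
  linarith

theorem Oracle.linF_succ (o : Oracle E m S) (p : Problem E m) (f' : Fin m → E → StrongDual ℝ E)
    (x : ℕ → E) (sbar : ℕ → S) (t : ℕ) :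
    o.linF x sbar (t + 1) = p.fVec (x t) + applyVec (fun i => f' i (x t)) (x (t + 1) - x t)
      + o.linNoise p f' (x t) (x (t + 1) - x t) (sbar t) := by
  ext i
  simp [Oracle.linF, Oracle.linNoise, Oracle.valueNoise, Oracle.gradNoise, applyVec, mkVec]
  ring

/-- The exact linearizations, together with `χ`, vary by at most `ℳ` times the lengths of the last
two steps. -/
theorem norm_linearization_sub_le {p : Problem E m} {d : DistGen p.X}
    {c : Constants m} (hreg : p.Regular d c) {f' : Fin m → E → StrongDual ℝ E} {a x x' : E}
    (ha : a ∈ p.X) (hx : x ∈ p.X) (hx' : x' ∈ p.X)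
    (hfa : ∀ i, f' i a ∈ subdiff p.X (p.f i) a) (hfx : ∀ i, f' i x ∈ subdiff p.X (p.f i) x) :
    ‖p.χVec x' - p.χVec x + (p.fVec x + applyVec (fun i => f' i x) (x' - x)
      - (p.fVec a + applyVec (fun i => f' i a) (x - a)))‖
      ≤ c.calM * (‖x' - x‖ + ‖x - a‖) := by
  have e : p.χVec x' - p.χVec x + (p.fVec x + applyVec (fun i => f' i x) (x' - x)
      - (p.fVec a + applyVec (fun i => f' i a) (x - a)))
      = mkVec (fun i => p.χ i x' - p.χ i x) + mkVec (fun i => f' i x (x' - x))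
        + mkVec (fun i => p.f i x - p.f i a - f' i a (x - a)) := by
    ext i
    simp [Problem.χVec, Problem.fVec, applyVec, mkVec]
    ring
  have h1 : ‖mkVec (fun i => p.χ i x' - p.χ i x)‖ ≤ c.MχAgg * ‖x' - x‖ := by
    refine norm_mkVec_le (norm_nonneg _) fun i => abs_le.2 ⟨?_, hreg.lip_χ i _ hx' _ hx⟩
    have := hreg.lip_χ i _ hx _ hx'
    rw [norm_sub_rev] at this; linarith
  have h2 : ‖mkVec (fun i => f' i x (x' - x))‖ ≤ c.MfAgg * ‖x' - x‖ :=
    norm_mkVec_le (norm_nonneg _) fun i => abs_le_of_mem_subdiff (hreg.lip_f i) (hfx i) hx'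
  have h3 : ‖mkVec (fun i => p.f i x - p.f i a - f' i a (x - a))‖ ≤ c.MfAgg * (2 * ‖x - a‖) := by
    refine norm_mkVec_le (by positivity) fun i => ?_
    have h4 := abs_le.1 (abs_le_of_mem_subdiff (hreg.lip_f i) (hfa i) hx)
    have h5 := hreg.lip_f i _ hx _ ha
    have h6 := hreg.lip_f i _ ha _ hx
    rw [norm_sub_rev] at h6
    rw [abs_le]; constructor <;> linarith
  have h4 : c.MχAgg + c.MfAgg ≤ c.calM := le_max_right _ _
  have h5 : 2 * c.MfAgg ≤ c.calM := le_max_left _ _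
  rw [e]
  refine (norm_add_le _ _).trans ((add_le_add (norm_add_le _ _) le_rfl).trans ?_)
  have h6 := mul_le_mul_of_nonneg_right h4 (norm_nonneg (x' - x))
  have h7 := mul_le_mul_of_nonneg_right h5 (norm_nonneg (x - a))
  linarith

theorem sq_norm_add_le_of_le {V : Type*} [NormedAddCommGroup V] {a b : V} {M r r' N : ℝ}
    (ha : ‖a‖ ≤ M * (r + r')) (hb : ‖b‖ ^ 2 ≤ 4 * N) : ‖a + b‖ ^ 2 ≤ 4 * M ^ 2 * (r ^ 2 + r' ^ 2) + 8 * N := by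
  have h1 := norm_add_sq_le_two a b
  have h2 := pow_le_pow_left₀ (norm_nonneg _) ha 2
  have h3 : (M * (r + r')) ^ 2 ≤ 2 * M ^ 2 * (r ^ 2 + r' ^ 2) := by
    have := mul_nonneg (sq_nonneg M) (sq_nonneg (r - r'))
    nlinarith
  linarith

/-- The stochastic part of the bound for `k + 1` steps that does not involve the dual reference
point. -/
noncomputable def pathNoise (p : Problem E m) (d : DistGen p.X) (c : Constants m)
    (o : Oracle E m S) (f₀' : E → StrongDual ℝ E) (f' : Fin m → E → StrongDual ℝ E) (K : ℝ)
    (xs : E) (s sbar : ℕ → S) (x : ℕ → E) (y : ℕ → Vec m) (k : ℕ) : ℝ :=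
  8 / c.α₀ * ∑ t ∈ Finset.range (k + 1), ‖o.lagrNoise f₀' f' (x t) (y (t + 1)) (s t)‖ ^ 2
    + c.extrapNoise K (fun t => o.noiseSq p f' d.diam (x t) (sbar t)) k
    - ∑ t ∈ Finset.range (k + 1),
        c.γ t * o.lagrNoise f₀' f' (x t) (y (t + 1)) (s t) (x t - xs)
    + ∑ t ∈ Finset.range (k + 1), c.γ t * inner ℝ (zeroAtStart (fun t => y (t + 1)) t)
        (o.linNoise p f' (x t) (zeroAtStart (fun t => x (t + 1) - x t) t) (sbar t))

/-- The weighted sum of the errors of the stochastic linearizations.  In the initial term only the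
error of the constraint value is kept, because the sample that determines this term also enters the
first step. -/
noncomputable def weightedNoise (p : Problem E m) (c : Constants m) (o : Oracle E m S)
    (f' : Fin m → E → StrongDual ℝ E) (sbar : ℕ → S) (x : ℕ → E) (n : ℕ) : Vec m :=
  ∑ t ∈ Finset.range n, c.γ t •
    o.linNoise p f' (x t) (zeroAtStart (fun t => x (t + 1) - x t) t) (sbar t)

theorem IsConExRun.mem_X {p : Problem E m} {d : DistGen p.X} {o : Oracle E m S} {θ η τ : ℕ → ℝ}
    {T : ℕ} {x₀ : E} {y₀ : Vec m} {s sbar : ℕ → S} {x : ℕ → E} {y : ℕ → Vec m}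
    (h : IsConExRun p d o θ η τ T x₀ y₀ s sbar x y) (hx₀ : x₀ ∈ p.X) : ∀ t ≤ T, x t ∈ p.X
  | 0, _ => h.x_zero ▸ hx₀
  | t + 1, ht => (h.x_step t (by omega)).1

theorem IsConExRun.dual_nonneg {p : Problem E m} {d : DistGen p.X} {o : Oracle E m S}
    {θ η τ : ℕ → ℝ} {T : ℕ} {x₀ : E} {s sbar : ℕ → S} {x : ℕ → E} {y : ℕ → Vec m}
    (h : IsConExRun p d o θ η τ T x₀ 0 s sbar x y) : ∀ t ≤ T, ∀ i, 0 ≤ y t i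
  | 0, _, i => by rw [h.y_zero]; simp
  | t + 1, ht, i => by rw [h.y_step t (by omega)]; exact posVec_nonneg _ i

/-- The bound along one trajectory, for every nonnegative dual reference point `Y`.  The dual steps
enter only through the proximal inequality `hdual` with step sizes `K / (t + 1)`. -/
theorem path_bound [FiniteDimensional ℝ E] {p : Problem E m} (hp : p.IsConvex) {d : DistGen p.X}
    {c : Constants m} (hreg : p.Regular d c) {o : Oracle E m S}
    {f₀' : E → StrongDual ℝ E} {f' : Fin m → E → StrongDual ℝ E}
    (hf₀ : ∀ x ∈ p.X, f₀' x ∈ subdiff p.X p.f₀ x)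
    (hf : ∀ i, ∀ x ∈ p.X, f' i x ∈ subdiff p.X (p.f i) x)
    {T : ℕ} {τ : ℕ → ℝ} {x₀ xs : E} (hx₀ : x₀ ∈ p.X) (hxs : xs ∈ p.X) {s sbar : ℕ → S}
    {x : ℕ → E} {y : ℕ → Vec m} (hrun : IsConExRun p d o c.θ c.η τ T x₀ 0 s sbar x y)
    {K : ℝ} (hK : 0 < K) (hKM : 32 * c.calM ^ 2 / c.α₀ ≤ K) {Y : Vec m} (hY : ∀ i, 0 ≤ Y i)
    (hdual : ∀ t < T, inner ℝ (Y - y (t + 1)) (o.extrap p c.θ x sbar t)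
      ≤ dualStep K t * inner ℝ (Y - y (t + 1)) (y (t + 1) - y t)) {k : ℕ} (hk : k < T) :
    ∑ t ∈ Finset.range (k + 1), c.γ t * p.gap xs Y (y (t + 1)) (x (t + 1))
        + c.γ (k + 1) * c.η (k + 1) * d.W xs (x (k + 1))
        + c.γ (k + 1) * dualStep K (k + 1) / 4 * ‖Y - y (k + 1)‖ ^ 2
      ≤ c.α₀ * (c.t₀ + 1) * (c.t₀ + 2) * d.diam ^ 2 / 2 + (c.t₀ + 2) * K / 2 * ‖Y‖ ^ 2
        + 8 / c.α₀ * ((k + 1) * c.nonsmooth d.diam ‖Y‖ ^ 2)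
        + (c.t₀ + 2) * ‖Y‖ ^ 2 / c.α₀ * dualNorm (o.gradNoise f' (x 0) (sbar 0)) ^ 2
        + pathNoise p d c o f₀' f' K xs s sbar x y k
        - inner ℝ Y (weightedNoise p c o f' sbar x (k + 1)) := by
  have hX := hrun.mem_X hx₀
  have hD := fun {a b : E} (ha : a ∈ p.X) (hb : b ∈ p.X) => d.norm_sub_le_diam hp.compact_X ha hb
  let v : ℕ → Vec m := fun t => p.χVec (x t) + o.linF x sbar t
  let pp : ℕ → Vec m := fun t => match t with
    | 0 => 0
    | t + 1 => c.γ t • (v (t + 1) - v t)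
  let δ : ℕ → Vec m := fun t => o.linNoise p f' (x t) (x (t + 1) - x t) (sbar t)
  let N : ℕ → ℝ := fun t => o.noiseSq p f' d.diam (x t) (sbar t)
  have hv : ∀ t, v (t + 1) - δ t = p.χVec (x (t + 1))
      + (p.fVec (x t) + applyVec (fun i => f' i (x t)) (x (t + 1) - x t)) := by
    intro t
    simp only [v, δ, o.linF_succ p f']
    abel
  have hS := summation_bound c hK hKM (k := k) (H := c.nonsmooth d.diam ‖Y‖)
    (Q := fun t => p.gap xs Y (y (t + 1)) (x (t + 1))) (W := fun t => d.W xs (x t))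
    (r := fun t => ‖x (t + 1) - x t‖)
    (d := fun t => ‖o.lagrNoise f₀' f' (x t) (y (t + 1)) (s t)‖)
    (e := fun t => o.lagrNoise f₀' f' (x t) (y (t + 1)) (s t) (x t - xs))
    (N := N) (fun t => o.noiseSq_nonneg p f' _ _ _) (y := y) (v := v)
    (s := o.extrap p c.θ x sbar) (p := pp) (δ := δ) (yy := zeroAtStart fun t => y (t + 1)) (Y := Y)
    rfl (fun t => rfl)
    (by
      intro t
      cases t with
      | zero =>
        simp only [pp, v, Oracle.extrap]; module
      | succ t =>
        simp only [pp, Oracle.extrap]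
        rw [← c.γ_mul_θ_succ t]
        simp only [v]
        module)
    (by
      intro t ht
      have ht' : t < T := by omega
      rw [hv]
      exact one_step hp hreg (hX t ht'.le) (hX (t + 1) ht') hxs (hf₀ _ (hX t ht'.le))
        (fun i => hf i _ (hX t ht'.le)) (hrun.dual_nonneg (t + 1) ht') hY (c.η_pos t).le
        (hrun.x_step t ht'))
    (fun t ht => hdual t (by omega)) hrun.y_zero
    (by
      intro t ht
      have ht' : t < T := by omega
      cases t with
      | zero =>
        have e : v (0 + 1) - v 0 = (p.χVec (x 1) - p.χVec (x 0)
            + (p.fVec (x 0) + applyVec (fun i => f' i (x 0)) (x 1 - x 0)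
              - (p.fVec (x 0) + applyVec (fun i => f' i (x 0)) (x 0 - x 0))))
            + applyVec (o.gradNoise f' (x 0) (sbar 0)) (x 1 - x 0) := by
          ext i
          simp [v, Oracle.linF, Oracle.gradNoise, applyVec, mkVec]
          ring
        have h1 := norm_linearization_sub_le hreg (hX 0 (by omega)) (hX 0 (by omega))
          (hX 1 ht') (fun i => hf i _ (hX 0 (by omega))) (fun i => hf i _ (hX 0 (by omega)))
        have h2 : ‖applyVec (o.gradNoise f' (x 0) (sbar 0)) (x 1 - x 0)‖ ^ 2 ≤ 4 * N 0 := by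
          refine (norm_applyVec_sq_le (hD (hX 0 (by omega)) (hX 1 ht'))).trans ?_
          simp only [N, Oracle.noiseSq]
          nlinarith [sq_nonneg ‖o.valueNoise p (x 0) (sbar 0)‖,
            sq_nonneg (d.diam * dualNorm (o.gradNoise f' (x 0) (sbar 0)))]
        have h3 := sq_norm_add_le_of_le h1 h2
        rw [e]
        refine h3.trans (le_of_eq ?_)
        simp [prev]
      | succ t =>
        have e : v (t + 1 + 1) - v (t + 1) = (p.χVec (x (t + 1 + 1)) - p.χVec (x (t + 1))
            + (p.fVec (x (t + 1))
                + applyVec (fun i => f' i (x (t + 1))) (x (t + 1 + 1) - x (t + 1))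
              - (p.fVec (x t) + applyVec (fun i => f' i (x t)) (x (t + 1) - x t))))
            + (δ (t + 1) - δ t) := by
          simp only [v, δ, o.linF_succ p f']
          abel
        have h1 := norm_linearization_sub_le hreg (hX t (by omega)) (hX (t + 1) (by omega))
          (hX (t + 1 + 1) ht') (fun i => hf i _ (hX t (by omega)))
          (fun i => hf i _ (hX (t + 1) (by omega)))
        have h2 : ‖δ (t + 1) - δ t‖ ^ 2 ≤ 4 * (N (t + 1) + N t) := by
          have h4 := norm_add_sq_le_two (δ (t + 1)) (-δ t)
          rw [← sub_eq_add_neg, norm_neg] at h4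
          have h5 := o.norm_linNoise_sq_le p f' (x (t + 1))
            (hD (hX (t + 1) (by omega)) (hX (t + 1 + 1) ht')) (sbar (t + 1))
          have h6 := o.norm_linNoise_sq_le p f' (x t)
            (hD (hX t (by omega)) (hX (t + 1) (by omega))) (sbar t)
          simp only [N]
          linarith
        have h3 := sq_norm_add_le_of_le h1 h2
        rw [e]
        exact h3)
    (o.norm_linNoise_sq_le p f' (x 0) (hD (hX 0 (by omega)) (hX 1 (by omega))) (sbar 0))
    rfl (fun t => rfl)
  refine hS.trans ?_
  have hα := c.α₀_pos
  have ht0 := c.two_le_t₀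
  have hγ0 : c.γ 0 = c.t₀ + 2 := by simp [Constants.γ]
  have hη0 : c.η 0 = c.α₀ * (c.t₀ + 1) / 2 := by simp [Constants.η]
  -- replace the first error by the error of the constraint value alone
  have hδ0 : ∀ t, δ t = o.linNoise p f' (x t) (zeroAtStart (fun t => x (t + 1) - x t) t) (sbar t)
      + (if t = 0 then applyVec (o.gradNoise f' (x 0) (sbar 0)) (x 1 - x 0) else 0) := by
    intro t
    cases t with
    | zero =>
      ext i
      simp [δ, Oracle.linNoise, zeroAtStart, applyVec, mkVec]
    | succ t => simp [δ, zeroAtStart]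
  have hM : ∑ t ∈ Finset.range (k + 1), c.γ t • δ t
      = weightedNoise p c o f' sbar x (k + 1)
        + c.γ 0 • applyVec (o.gradNoise f' (x 0) (sbar 0)) (x 1 - x 0) := by
    simp only [hδ0, smul_add, Finset.sum_add_distrib, weightedNoise]
    congr 1
    simp [smul_ite, Finset.sum_ite_eq']
  have hyy : ∑ t ∈ Finset.range (k + 1),
        c.γ t * inner ℝ (zeroAtStart (fun t => y (t + 1)) t) (δ t)
      = ∑ t ∈ Finset.range (k + 1), c.γ t * inner ℝ (zeroAtStart (fun t => y (t + 1)) t)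
        (o.linNoise p f' (x t) (zeroAtStart (fun t => x (t + 1) - x t) t) (sbar t)) := by
    refine Finset.sum_congr rfl fun t _ => ?_
    cases t with
    | zero => simp [zeroAtStart]
    | succ t => rfl
  set b := dualNorm (o.gradNoise f' (x 0) (sbar 0)) with hb
  -- The sample at `x₀` also determines `x₁`, so this term has no zero mean; it is split by Young's
  -- inequality.
  have hinit : -inner ℝ Y (c.γ 0 • applyVec (o.gradNoise f' (x 0) (sbar 0)) (x 1 - x 0))
      ≤ c.α₀ * (c.t₀ + 1) * (c.t₀ + 2) * d.diam ^ 2 / 4 + (c.t₀ + 2) * ‖Y‖ ^ 2 / c.α₀ * b ^ 2 := by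
    rw [inner_smul_right]
    have h1 : -inner ℝ Y (applyVec (o.gradNoise f' (x 0) (sbar 0)) (x 1 - x 0))
        ≤ ‖Y‖ * (b * d.diam) := by
      refine (neg_le_abs _).trans ((abs_real_inner_le_norm _ _).trans ?_)
      refine mul_le_mul_of_nonneg_left ((norm_applyVec_le _ _).trans ?_) (norm_nonneg _)
      exact mul_le_mul_of_nonneg_left (hD (hX 0 (by omega)) (hX 1 (by omega))) (dualNorm_nonneg _)
    have h2 : (c.t₀ + 2) * (‖Y‖ * (b * d.diam)) ≤ (c.t₀ + 2) * (c.α₀ * (c.t₀ + 1) * d.diam ^ 2 / 4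
        + ‖Y‖ ^ 2 * b ^ 2 / c.α₀) := by
      refine mul_le_mul_of_nonneg_left ?_ (by linarith)
      have h3 : c.α₀ * d.diam ^ 2 / 4 + ‖Y‖ ^ 2 * b ^ 2 / c.α₀ - ‖Y‖ * (b * d.diam)
          = (c.α₀ * d.diam / 2 - ‖Y‖ * b) ^ 2 / c.α₀ := by
        field_simp; ring
      have h4 : 0 ≤ (c.α₀ * d.diam / 2 - ‖Y‖ * b) ^ 2 / c.α₀ := by positivity
      have h5 : 0 ≤ c.α₀ * c.t₀ * d.diam ^ 2 / 4 := by positivity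
      linarith
    rw [hγ0]
    have h6 := mul_le_mul_of_nonneg_left h1 (show 0 ≤ c.t₀ + 2 by linarith)
    have h7 : (c.t₀ + 2) * (c.α₀ * (c.t₀ + 1) * d.diam ^ 2 / 4 + ‖Y‖ ^ 2 * b ^ 2 / c.α₀)
      = c.α₀ * (c.t₀ + 1) * (c.t₀ + 2) * d.diam ^ 2 / 4 + (c.t₀ + 2) * ‖Y‖ ^ 2 / c.α₀ * b ^ 2 := by
      ring
    linarith
  have hW : c.γ 0 * c.η 0 * d.W xs (x 0) ≤ c.α₀ * (c.t₀ + 1) * (c.t₀ + 2) * d.diam ^ 2 / 4 := by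
    rw [hγ0, hη0]
    have := mul_le_mul_of_nonneg_left
      (d.W_le_half_sq_diam hp.compact_X (hX 0 (by omega)) hxs)
      (show 0 ≤ (c.t₀ + 2) * (c.α₀ * (c.t₀ + 1) / 2) by positivity)
    linarith
  have hsq : ∑ t ∈ Finset.range (k + 1), 8 / c.α₀ * (c.nonsmooth d.diam ‖Y‖ ^ 2
        + ‖o.lagrNoise f₀' f' (x t) (y (t + 1)) (s t)‖ ^ 2)
      = 8 / c.α₀ * ((k + 1) * c.nonsmooth d.diam ‖Y‖ ^ 2) + 8 / c.α₀ *
        ∑ t ∈ Finset.range (k + 1), ‖o.lagrNoise f₀' f' (x t) (y (t + 1)) (s t)‖ ^ 2 := by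
    rw [← Finset.mul_sum, Finset.sum_add_distrib, mul_add]
    simp
  rw [hM, hyy, inner_add_right, hsq, hγ0]
  unfold pathNoise
  rw [hγ0] at hinit hW
  linarith

end PathBound

end ConEx

namespace ConEx

/-! ### Measurability of the iterates -/

section Measurability

theorem measurable_mkVec {Ω : Type*} [MeasurableSpace Ω] {m : ℕ} {a : Ω → Fin m → ℝ}
    (h : ∀ i, Measurable fun w => a w i) : Measurable fun w => mkVec (a w) :=
  (WithLp.measurable_toLp 2 (Fin m → ℝ)).comp (measurable_pi_lambda _ h)

theorem measurable_coord {Ω : Type*} [MeasurableSpace Ω] {m : ℕ} {a : Ω → Vec m}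
    (h : Measurable a) (i : Fin m) : Measurable fun w => a w i :=
  (measurable_pi_apply i).comp ((WithLp.measurable_ofLp 2 (Fin m → ℝ)).comp h)

theorem measurable_comp_of_continuousOn {Ω A B : Type*} [MeasurableSpace Ω] [TopologicalSpace A]
    [MeasurableSpace A] [BorelSpace A] [TopologicalSpace B] [MeasurableSpace B] [BorelSpace B]
    {X : Set A} {f : A → B} (hf : ContinuousOn f X) {x : Ω → A} (hx : Measurable x)
    (hX : ∀ w, x w ∈ X) : Measurable fun w => f (x w) :=
  (continuousOn_iff_continuous_domRestrict.1 hf).measurable.comp (hx.subtype_mk (h := hX))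

variable {E : Type*} [NormedAddCommGroup E] [NormedSpace ℝ E] [FiniteDimensional ℝ E]
  [MeasurableSpace E] [BorelSpace E]

/-- A function into a finite-dimensional space that depends on a measurable function in a Lipschitz
way is measurable. -/
theorem measurable_of_dist_le {Ω A : Type*} [MeasurableSpace Ω] [PseudoMetricSpace A]
    [MeasurableSpace A] [OpensMeasurableSpace A] {U : Ω → A} (hU : Measurable U) {z : Ω → E}
    {C : ℝ} (hC : 0 ≤ C) (h : ∀ w w', dist (z w) (z w') ≤ C * dist (U w) (U w')) :
    Measurable z := by
  have hfac : z.FactorsThrough U := by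
    intro w w' hww
    have := h w w'
    rw [hww, dist_self, mul_zero] at this
    exact dist_le_zero.1 this
  have hL : LipschitzOnWith (Real.toNNReal C) (Function.extend U z 0) (Set.range U) := by
    refine LipschitzOnWith.of_dist_le_mul ?_
    rintro _ ⟨w, rfl⟩ _ ⟨w', rfl⟩
    rw [hfac.extend_apply, hfac.extend_apply, Real.coe_toNNReal _ hC]
    exact h w w'
  obtain ⟨g, hg, hgeq⟩ := hL.extend_finite_dimension
  have : z = g ∘ U := by
    funext w
    rw [Function.comp_apply, ← hgeq ⟨w, rfl⟩, hfac.extend_apply]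
  rw [this]
  exact hg.continuous.measurable.comp hU

theorem measurable_clm_apply {Ω : Type*} [MeasurableSpace Ω] {g : Ω → StrongDual ℝ E} {u : Ω → E}
    (hg : Measurable g) (hu : Measurable u) : Measurable fun w => g w (u w) := by
  have : ProperSpace E := FiniteDimensional.proper_real E
  have hc : Continuous fun q : StrongDual ℝ E × E => q.1 q.2 :=
    isBoundedBilinearMap_apply.continuous
  exact hc.measurable.comp (hg.prodMk hu)

theorem measurable_applyVec {Ω : Type*} [MeasurableSpace Ω] {m : ℕ}
    {g : Ω → Fin m → StrongDual ℝ E} {u : Ω → E} (hg : ∀ i, Measurable fun w => g w i)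
    (hu : Measurable u) : Measurable fun w => applyVec (g w) (u w) :=
  measurable_mkVec fun i => measurable_clm_apply (hg i) hu

variable {Ω S : Type*} [mΩ : MeasurableSpace Ω] [MeasurableSpace S] {m : ℕ}
  {p : Problem E m} {d : DistGen p.X} {c : Constants m} {o : Oracle E m S}

/-- The prox step is a measurable function of the data entering it. -/
theorem measurable_prox (hp : p.IsConvex) (hreg : p.Regular d c) {w : Ω → Vec m}
    {v : Ω → StrongDual ℝ E} {xt z : Ω → E} {η : ℝ} (hη : 0 < η) (hw : Measurable w)
    (hw0 : ∀ a i, 0 ≤ w a i) (hv : Measurable v) (hxt : Measurable xt) (hX : ∀ a, xt a ∈ p.X)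
    (hz : ∀ a, p.IsProx d (w a) (v a) (xt a) η (z a)) : Measurable z := by
  have : ProperSpace E := FiniteDimensional.proper_real E
  have : FiniteDimensional ℝ (StrongDual ℝ E) := inferInstance
  have : ProperSpace (StrongDual ℝ E) := FiniteDimensional.proper_real _
  have hMs : 0 ≤ ∑ i, c.Mχ i := Finset.sum_nonneg fun i _ => c.Mχ_nonneg i
  refine measurable_of_dist_le (U := fun a => (w a, v a, xt a)) (hw.prodMk (hv.prodMk hxt))
    (C := (∑ i, c.Mχ i + 1 + η * |d.Lω|) / η) (by positivity) fun a b => ?_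
  have h := (hz a).norm_sub_le hp c.α₀_pos.le hreg.strong_χ₀ c.Mχ_nonneg hreg.lip_χ hη.le
    (hw0 a) (hw0 b) (hX a) (hX b) (hz b)
  set r := dist (w a, v a, xt a) (w b, v b, xt b) with hr
  have h1 : dist (w a) (w b) ≤ r := le_max_left _ _
  have h2 : dist (v a) (v b) ≤ r := (le_max_left _ _).trans (le_max_right _ _)
  have h3 : dist (xt a) (xt b) ≤ r := (le_max_right _ _).trans (le_max_right _ _)
  rw [dist_eq_norm] at h1 h2 h3 ⊢
  have h4 : ∑ i, |w a i - w b i| * c.Mχ i ≤ r * ∑ i, c.Mχ i := by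
    rw [Finset.mul_sum]
    refine Finset.sum_le_sum fun i _ => mul_le_mul_of_nonneg_right ?_ (c.Mχ_nonneg i)
    exact (PiLp.norm_apply_le (w a - w b) i).trans h1
  have h5 : d.Lω * ‖xt a - xt b‖ ≤ |d.Lω| * r :=
    (mul_le_mul_of_nonneg_right (le_abs_self _) (norm_nonneg _)).trans
      (mul_le_mul_of_nonneg_left h3 (abs_nonneg _))
  have h6 := mul_le_mul_of_nonneg_left h5 hη.le
  rw [div_mul_eq_mul_div, le_div_iff₀ hη]
  nlinarith

section Run

variable {θ τ : ℕ → ℝ} {T : ℕ} {x₀ : E} {ξ ξbar : ℕ → Ω → S} {x : Ω → ℕ → E} {y : Ω → ℕ → Vec m}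
  (hp : p.IsConvex) (hreg : p.Regular d c)
  (hG₀ : Measurable fun q : E × S => o.G₀ q.1 q.2)
  (hG : ∀ i, Measurable fun q : E × S => o.G i q.1 q.2)
  (hF : Measurable fun q : E × S => o.F q.1 q.2)
  (hx₀ : x₀ ∈ p.X)
  (hrun : ∀ w, IsConExRun p d o θ c.η τ T x₀ 0 (fun t => ξ t w) (fun t => ξbar t w) (x w) (y w))

theorem measurable_posVec {a : Ω → Vec m} (h : Measurable a) : Measurable fun w => posVec (a w) :=
  measurable_mkVec fun i => (measurable_coord h i).max measurable_const

omit [FiniteDimensional ℝ E] in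
theorem measurable_χVec (hp : p.IsConvex) {z : Ω → E} (hz : Measurable z) (hX : ∀ w, z w ∈ p.X) :
    Measurable fun w => p.χVec (z w) :=
  measurable_mkVec fun i => measurable_comp_of_continuousOn (hp.continuous_χ i) hz hX

theorem measurable_linF (hG : ∀ i, Measurable fun q : E × S => o.G i q.1 q.2)
    (hF : Measurable fun q : E × S => o.F q.1 q.2) {t : ℕ}
    (hx : ∀ s ≤ t, Measurable fun w => x w s)
    (hb : ∀ s, s < t ∨ s = 0 → Measurable (ξbar s)) :
    Measurable fun w => o.linF (x w) (fun s => ξbar s w) t := by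
  cases t with
  | zero => exact hF.comp ((hx 0 le_rfl).prodMk (hb 0 (Or.inr rfl)))
  | succ t =>
    have h1 := (hx t (by omega)).prodMk (hb t (Or.inl (by omega)))
    exact (hF.comp h1).add
      (measurable_applyVec (g := fun w i => o.G i (x w t) (ξbar t w)) (fun i => (hG i).comp h1)
        ((hx (t + 1) le_rfl).sub (hx t (by omega))))

include hp hG hF hx₀ hrun in
theorem measurable_dual_step {t : ℕ} (ht : t < T) (hx : ∀ s ≤ t, Measurable fun w => x w s)
    (hy : Measurable fun w => y w t) (hb : ∀ s, s < t ∨ s = 0 → Measurable (ξbar s)) :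
    Measurable fun w => y w (t + 1) := by
  have hX : ∀ s ≤ t, ∀ w, x w s ∈ p.X := fun s hs w => (hrun w).mem_X hx₀ s (by omega)
  have hv : ∀ s ≤ t, Measurable fun w => p.χVec (x w s) + o.linF (x w) (fun s => ξbar s w) s :=
    fun s hs => (measurable_χVec hp (hx s hs) (hX s hs)).add
      (measurable_linF hG hF (fun r hr => hx r (by omega)) (fun r hr => hb r (by omega)))
  have he : Measurable fun w => o.extrap p θ (x w) (fun s => ξbar s w) t := by
    cases t with
    | zero =>
      simp only [Oracle.extrap]
      exact ((hv 0 le_rfl).const_smul (1 + θ 0)).sub ((hv 0 le_rfl).const_smul (θ 0))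
    | succ t =>
      simp only [Oracle.extrap]
      exact ((hv (t + 1) le_rfl).const_smul (1 + θ (t + 1))).sub
        ((hv t (by omega)).const_smul (θ (t + 1)))
  have : (fun w => y w (t + 1)) = fun w =>
      posVec (y w t + (1 / τ t) • o.extrap p θ (x w) (fun s => ξbar s w) t) :=
    funext fun w => (hrun w).y_step t ht
  rw [this]
  exact measurable_posVec (hy.add (he.const_smul (1 / τ t)))

include hp hreg hG₀ hG hF hx₀ hrun in
/-- The first `n` iterates are determined measurably by the samples `ξ_s`, `s < n`, and `ξ̄_s`,
`s + 1 < n`, together with `ξ̄_0`. -/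
theorem measurable_iterates {n : ℕ} (hn : n ≤ T) (hs : ∀ s < n, Measurable (ξ s))
    (hb : ∀ s, s + 1 < n ∨ (s = 0 ∧ 0 < n) → Measurable (ξbar s)) :
    ∀ t ≤ n, (Measurable fun w => x w t) ∧ Measurable fun w => y w t := by
  intro t
  induction t using Nat.strong_induction_on with
  | _ t ih =>
    intro ht
    cases t with
    | zero =>
      simp only [fun w => (hrun w).x_zero, fun w => (hrun w).y_zero]
      exact ⟨measurable_const, measurable_const⟩
    | succ t =>
      have hx : ∀ s ≤ t, Measurable fun w => x w s :=
        fun s hs => (ih s (by omega) (by omega)).1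
      have hX : ∀ w, x w t ∈ p.X := fun w => (hrun w).mem_X hx₀ t (by omega)
      have hyt := measurable_dual_step hp hG hF hx₀ hrun (by omega) hx
        (ih t (by omega) (by omega)).2 (fun s h => hb s (by omega))
      refine ⟨?_, hyt⟩
      have h1 := (hx t le_rfl).prodMk (hs t (by omega))
      have hv : Measurable fun w => o.G₀ (x w t) (ξ t w)
          + ∑ i, y w (t + 1) i • o.G i (x w t) (ξ t w) :=
        (hG₀.comp h1).add (Finset.measurable_sum _ fun i _ =>
          (measurable_coord hyt i).smul ((hG i).comp h1))
      exact measurable_prox hp hreg (c.η_pos t) hyt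
        (fun w i => (hrun w).dual_nonneg (t + 1) (by omega) i) hv (hx t le_rfl) hX
        (fun w => (hrun w).x_step t (by omega))

end Run

end Measurability

end ConEx

namespace ConEx

/-! ### Integrals over an independent sample -/

section Independence

variable {Ω S U : Type*} [MeasurableSpace Ω] [MeasurableSpace S] [MeasurableSpace U]
  {μ : Measure Ω} [IsProbabilityMeasure μ] {P : Measure S} [IsProbabilityMeasure P]
  {u : Ω → U} {ζ : Ω → S}

/-- Nonnegative functions of an independent sample: a bound for the conditional expectation gives
integrability and a bound for the expectation. -/
theorem integrable_and_integral_le_of_indep (hu : Measurable u) (hζ : Measurable ζ)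
    (hind : IndepFun u ζ μ) (hlaw : μ.map ζ = P) {φ : U × S → ℝ} (hφ : Measurable φ)
    (h0 : ∀ q, 0 ≤ φ q) {b : Ω → ℝ} (hb : Integrable b μ)
    (h : ∀ w, Integrable (fun s => φ (u w, s)) P ∧ ∫ s, φ (u w, s) ∂P ≤ b w) :
    Integrable (fun w => φ (u w, ζ w)) μ ∧ ∫ w, φ (u w, ζ w) ∂μ ≤ ∫ w, b w ∂μ := by
  have hmap := (indepFun_iff_map_prod_eq_prod_map_map hu.aemeasurable hζ.aemeasurable).1 hind
  rw [hlaw] at hmap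
  have : IsProbabilityMeasure (μ.map u) := Measure.isProbabilityMeasure_map hu.aemeasurable
  have hpair : Measurable fun w => (u w, ζ w) := hu.prodMk hζ
  have hsm : StronglyMeasurable φ := hφ.stronglyMeasurable
  have hsm1 : StronglyMeasurable fun a => ∫ s, φ (a, s) ∂P := hsm.integral_prod_right'
  have hmajor : Integrable (fun w => ∫ s, φ (u w, s) ∂P) μ := by
    refine hb.mono' (hsm1.comp_measurable hu).aestronglyMeasurable (ae_of_all _ fun w => ?_)
    rw [Real.norm_of_nonneg (integral_nonneg fun s => h0 _)]
    exact (h w).2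
  have hint : Integrable φ ((μ.map u).prod P) := by
    rw [integrable_prod_iff hsm.aestronglyMeasurable]
    constructor
    · rw [ae_map_iff hu.aemeasurable
        (measurableSet_integrable (f := fun a s => φ (a, s)) hsm)]
      exact ae_of_all _ fun w => (h w).1
    · simp only [Real.norm_of_nonneg (h0 _)]
      rw [integrable_map_measure hsm1.aestronglyMeasurable hu.aemeasurable]
      exact hmajor
  have hint' : Integrable (fun w => φ (u w, ζ w)) μ := by
    rw [← hmap, integrable_map_measure hsm.aestronglyMeasurable hpair.aemeasurable] at hint
    exact hint
  refine ⟨hint', ?_⟩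
  calc ∫ w, φ (u w, ζ w) ∂μ = ∫ q, φ q ∂(μ.map fun w => (u w, ζ w)) :=
        (integral_map hpair.aemeasurable hsm.aestronglyMeasurable).symm
    _ = ∫ a, ∫ s, φ (a, s) ∂P ∂(μ.map u) := by rw [hmap, integral_prod _ hint]
    _ = ∫ w, ∫ s, φ (u w, s) ∂P ∂μ := integral_map hu.aemeasurable hsm1.aestronglyMeasurable
    _ ≤ ∫ w, b w ∂μ := integral_mono hmajor hb fun w => (h w).2

theorem integral_eq_zero_of_indep (hu : Measurable u) (hζ : Measurable ζ)
    (hind : IndepFun u ζ μ) (hlaw : μ.map ζ = P) {φ : U × S → ℝ} (hφ : Measurable φ)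
    (hint : Integrable (fun w => φ (u w, ζ w)) μ) (h : ∀ w, ∫ s, φ (u w, s) ∂P = 0) :
    ∫ w, φ (u w, ζ w) ∂μ = 0 := by
  have hmap := (indepFun_iff_map_prod_eq_prod_map_map hu.aemeasurable hζ.aemeasurable).1 hind
  rw [hlaw] at hmap
  have : IsProbabilityMeasure (μ.map u) := Measure.isProbabilityMeasure_map hu.aemeasurable
  have hpair : Measurable fun w => (u w, ζ w) := hu.prodMk hζ
  have hsm : StronglyMeasurable φ := hφ.stronglyMeasurable
  have hsm1 : StronglyMeasurable fun a => ∫ s, φ (a, s) ∂P := hsm.integral_prod_right'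
  have hint' : Integrable φ ((μ.map u).prod P) := by
    rw [← hmap, integrable_map_measure hsm.aestronglyMeasurable hpair.aemeasurable]
    exact hint
  calc ∫ w, φ (u w, ζ w) ∂μ = ∫ q, φ q ∂(μ.map fun w => (u w, ζ w)) :=
        (integral_map hpair.aemeasurable hsm.aestronglyMeasurable).symm
    _ = ∫ a, ∫ s, φ (a, s) ∂P ∂(μ.map u) := by rw [hmap, integral_prod _ hint']
    _ = ∫ w, ∫ s, φ (u w, s) ∂P ∂μ := integral_map hu.aemeasurable hsm1.aestronglyMeasurable
    _ = 0 := by simp [h]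

omit [IsProbabilityMeasure μ] in
/-- A function that is measurable with respect to the samples with indices in `A` is independent of
a sample whose index is not in `A`. -/
theorem indepFun_of_measurable_iSup {ι : Type*} {Z : ι → Ω → S} (hZ : ∀ i, Measurable (Z i))
    (hind : iIndepFun Z μ) {A : Set ι} {j : ι} (hj : j ∉ A)
    (hu : Measurable[⨆ i ∈ A, MeasurableSpace.comap (Z i) inferInstance] u) :
    IndepFun u (Z j) μ := by
  rw [iIndepFun_iff_iIndep] at hind
  have h := indep_iSup_of_disjoint (fun i => (hZ i).comap_le) hind
    (Set.disjoint_singleton_right.2 hj)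
  rw [IndepFun_iff_Indep]
  refine indep_of_indep_of_le_left ?_ hu.comap_le
  refine indep_of_indep_of_le_right h ?_
  simp

omit [MeasurableSpace Ω] in
theorem measurable_of_mem_iSup {ι : Type*} {Z : ι → Ω → S} {A : Set ι} {j : ι} (hj : j ∈ A) :
    Measurable[⨆ i ∈ A, MeasurableSpace.comap (Z i) inferInstance] (Z j) :=
  Measurable.mono (comap_measurable (Z j))
    (le_iSup₂_of_le (f := fun i (_ : i ∈ A) => MeasurableSpace.comap (Z i) inferInstance)
      j hj le_rfl) le_rfl

end Independence

/-! ### Moments of the oracle noise at a fixed point -/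

section Moments

variable {E : Type*} [NormedAddCommGroup E] [NormedSpace ℝ E] [FiniteDimensional ℝ E]
  [MeasurableSpace E] [BorelSpace E] {S : Type*} [MeasurableSpace S] {m : ℕ}
  {p : Problem E m} {c : Constants m} {o : Oracle E m S} {P : Measure S} [IsProbabilityMeasure P]
  {f₀' : E → StrongDual ℝ E} {f' : Fin m → E → StrongDual ℝ E}

theorem Oracle.IsStochasticOracle.measurable_f₀' (ho : o.IsStochasticOracle p c P f₀' f') :
    Measurable fun x : p.X => f₀' x := by
  have : ProperSpace (StrongDual ℝ E) := FiniteDimensional.proper_real _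
  have h : (fun x : p.X => f₀' x) = fun x : p.X => ∫ s, o.G₀ x s ∂P :=
    funext fun x => (ho.mean_G₀ x x.2).2.symm
  rw [h]
  have h2 : Measurable fun x : E => ∫ s, o.G₀ x s ∂P :=
    (ho.measurable_G₀.stronglyMeasurable.integral_prod_right' (ν := P)).measurable
  exact h2.comp measurable_subtype_coe

theorem Oracle.IsStochasticOracle.measurable_f' (ho : o.IsStochasticOracle p c P f₀' f')
    (i : Fin m) : Measurable fun x : p.X => f' i x := by
  have : ProperSpace (StrongDual ℝ E) := FiniteDimensional.proper_real _
  have h : (fun x : p.X => f' i x) = fun x : p.X => ∫ s, o.G i x s ∂P :=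
    funext fun x => (ho.mean_G i x x.2).2.symm
  rw [h]
  have h2 : Measurable fun x : E => ∫ s, o.G i x s ∂P :=
    ((ho.measurable_G i).stronglyMeasurable.integral_prod_right' (ν := P)).measurable
  exact h2.comp measurable_subtype_coe

omit [FiniteDimensional ℝ E] in
theorem Oracle.IsStochasticOracle.measurable_fVec (ho : o.IsStochasticOracle p c P f₀' f') :
    Measurable fun x : p.X => p.fVec x := by
  have h : (fun x : p.X => p.fVec x) = fun x : p.X => ∫ s, o.F x s ∂P :=
    funext fun x => (ho.mean_F x x.2).2.symm
  rw [h]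
  have h2 : Measurable fun x : E => ∫ s, o.F x s ∂P :=
    (ho.measurable_F.stronglyMeasurable.integral_prod_right' (ν := P)).measurable
  exact h2.comp measurable_subtype_coe

variable {Q : Type*} [mQ : MeasurableSpace Q] {z : Q → p.X} {ζ : Q → S}

theorem Oracle.IsStochasticOracle.measurable_gradNoise (ho : o.IsStochasticOracle p c P f₀' f')
    (hz : Measurable z) (hζ : Measurable ζ) (i : Fin m) :
    Measurable fun q => o.gradNoise f' (z q) (ζ q) i := by
  have : ProperSpace (StrongDual ℝ E) := FiniteDimensional.proper_real _
  exact ((ho.measurable_G i).comp ((measurable_subtype_coe.comp hz).prodMk hζ)).sub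
    ((ho.measurable_f' i).comp hz)

omit [FiniteDimensional ℝ E] in
theorem Oracle.IsStochasticOracle.measurable_valueNoise (ho : o.IsStochasticOracle p c P f₀' f')
    (hz : Measurable z) (hζ : Measurable ζ) :
    Measurable fun q => o.valueNoise p (z q) (ζ q) :=
  (ho.measurable_F.comp ((measurable_subtype_coe.comp hz).prodMk hζ)).sub
    (ho.measurable_fVec.comp hz)

theorem Oracle.IsStochasticOracle.measurable_lagrNoise (ho : o.IsStochasticOracle p c P f₀' f')
    (hz : Measurable z) (hζ : Measurable ζ) {a : Q → Vec m} (ha : Measurable a) :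
    Measurable fun q => o.lagrNoise f₀' f' (z q) (a q) (ζ q) := by
  have : ProperSpace (StrongDual ℝ E) := FiniteDimensional.proper_real _
  exact ((ho.measurable_G₀.comp ((measurable_subtype_coe.comp hz).prodMk hζ)).sub
    (ho.measurable_f₀'.comp hz)).add (Finset.measurable_sum _ fun i _ =>
      (measurable_coord ha i).smul (ho.measurable_gradNoise hz hζ i))

theorem Oracle.IsStochasticOracle.measurable_linNoise (ho : o.IsStochasticOracle p c P f₀' f')
    (hz : Measurable z) (hζ : Measurable ζ) {a : Q → E} (ha : Measurable a) :
    Measurable fun q => o.linNoise p f' (z q) (a q) (ζ q) :=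
  (ho.measurable_valueNoise hz hζ).add
    (measurable_applyVec (g := fun q => o.gradNoise f' (z q) (ζ q))
      (ho.measurable_gradNoise hz hζ) ha)

theorem Oracle.IsStochasticOracle.measurable_dualNorm_sq
    (ho : o.IsStochasticOracle p c P f₀' f') (hz : Measurable z) (hζ : Measurable ζ) :
    Measurable fun q => dualNorm (o.gradNoise f' (z q) (ζ q)) ^ 2 := by
  simp only [dualNorm_sq]
  exact Finset.measurable_sum _ fun i _ => ((ho.measurable_gradNoise hz hζ i).norm).pow_const 2

theorem Oracle.IsStochasticOracle.measurable_noiseSq (ho : o.IsStochasticOracle p c P f₀' f')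
    (hz : Measurable z) (hζ : Measurable ζ) (D : ℝ) :
    Measurable fun q => o.noiseSq p f' D (z q) (ζ q) :=
  ((ho.measurable_valueNoise hz hζ).norm.pow_const 2).add
    ((ho.measurable_dualNorm_sq hz hζ).const_mul (D ^ 2))

omit [FiniteDimensional ℝ E] [IsProbabilityMeasure P] in
theorem Oracle.IsStochasticOracle.integral_dualNorm_sq_le
    (ho : o.IsStochasticOracle p c P f₀' f') {x : E} (hx : x ∈ p.X) :
    Integrable (fun s => dualNorm (o.gradNoise f' x s) ^ 2) P ∧
      ∫ s, dualNorm (o.gradNoise f' x s) ^ 2 ∂P ≤ c.σNorm ^ 2 := by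
  simp only [dualNorm_sq, Oracle.gradNoise]
  refine ⟨integrable_finsetSum _ fun i _ => (ho.var_G i x hx).1, ?_⟩
  rw [integral_finsetSum _ fun i _ => (ho.var_G i x hx).1, Constants.σNorm, norm_mkVec_sq]
  exact Finset.sum_le_sum fun i _ => (ho.var_G i x hx).2

omit [FiniteDimensional ℝ E] [IsProbabilityMeasure P] in
theorem Oracle.IsStochasticOracle.integral_noiseSq_le
    (ho : o.IsStochasticOracle p c P f₀' f') {x : E} (hx : x ∈ p.X) (D : ℝ) :
    Integrable (fun s => o.noiseSq p f' D x s) P ∧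
      ∫ s, o.noiseSq p f' D x s ∂P ≤ c.σX D ^ 2 := by
  have h1 := ho.var_F x hx
  have h2 := ho.integral_dualNorm_sq_le hx
  unfold Oracle.noiseSq Oracle.valueNoise
  refine ⟨h1.1.add (h2.1.const_mul _), ?_⟩
  rw [integral_add h1.1 (h2.1.const_mul _), integral_const_mul, Constants.σX,
    Real.sq_sqrt (by positivity)]
  exact add_le_add h1.2 (mul_le_mul_of_nonneg_left h2.2 (sq_nonneg D))

theorem Oracle.IsStochasticOracle.integral_lagrNoise_sq_le
    (ho : o.IsStochasticOracle p c P f₀' f') {x : E} (hx : x ∈ p.X) (w : Vec m) :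
    Integrable (fun s => ‖o.lagrNoise f₀' f' x w s‖ ^ 2) P ∧
      ∫ s, ‖o.lagrNoise f₀' f' x w s‖ ^ 2 ∂P
        ≤ 2 * c.σ₀ ^ 2 + 2 * c.σNorm ^ 2 * ‖w‖ ^ 2 := by
  have h1 := ho.var_G₀ x hx
  have h2 := ho.integral_dualNorm_sq_le hx
  have hb : ∀ s, ‖o.lagrNoise f₀' f' x w s‖ ^ 2 ≤ 2 * ‖o.G₀ x s - f₀' x‖ ^ 2
      + 2 * ‖w‖ ^ 2 * dualNorm (o.gradNoise f' x s) ^ 2 := by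
    intro s
    have h3 := norm_add_sq_le_two (o.G₀ x s - f₀' x) (∑ i, w i • o.gradNoise f' x s i)
    have h4 := pow_le_pow_left₀ (norm_nonneg _) (norm_sum_smul_le w (o.gradNoise f' x s)) 2
    unfold Oracle.lagrNoise
    rw [mul_pow] at h4
    linarith
  have hint : Integrable (fun s => 2 * ‖o.G₀ x s - f₀' x‖ ^ 2
      + 2 * ‖w‖ ^ 2 * dualNorm (o.gradNoise f' x s) ^ 2) P :=
    (h1.1.const_mul _).add (h2.1.const_mul _)
  have hmeas : Measurable fun s => ‖o.lagrNoise f₀' f' x w s‖ ^ 2 :=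
    ((ho.measurable_lagrNoise (z := fun _ : S => (⟨x, hx⟩ : p.X)) measurable_const measurable_id
      (measurable_const (a := w))).norm).pow_const 2
  have hint2 : Integrable (fun s => ‖o.lagrNoise f₀' f' x w s‖ ^ 2) P :=
    hint.mono' hmeas.aestronglyMeasurable (ae_of_all _ fun s => by
      rw [Real.norm_of_nonneg (by positivity)]; exact hb s)
  refine ⟨hint2, (integral_mono hint2 hint hb).trans ?_⟩
  rw [integral_add (h1.1.const_mul _) (h2.1.const_mul _), integral_const_mul, integral_const_mul]
  have h5 := mul_le_mul_of_nonneg_left h2.2 (show 0 ≤ 2 * ‖w‖ ^ 2 by positivity)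
  linarith [h1.2]

omit [FiniteDimensional ℝ E] [MeasurableSpace E] [BorelSpace E] in
theorem integral_apply_eq_zero {g : S → StrongDual ℝ E} {a : StrongDual ℝ E}
    (hg : Integrable g P ∧ ∫ s, g s ∂P = a) (u : E) :
    Integrable (fun s => (g s - a) u) P ∧ ∫ s, (g s - a) u ∂P = 0 := by
  have h1 : Integrable (fun s => g s - a) P := hg.1.sub (integrable_const a)
  refine ⟨h1.apply_continuousLinearMap u, ?_⟩
  rw [← ContinuousLinearMap.integral_apply h1, integral_sub hg.1 (integrable_const a), hg.2]
  simp

omit [FiniteDimensional ℝ E] in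
theorem Oracle.IsStochasticOracle.integral_lagrNoise_eq_zero
    (ho : o.IsStochasticOracle p c P f₀' f') {x : E} (hx : x ∈ p.X) (w : Vec m) (u : E) :
    ∫ s, o.lagrNoise f₀' f' x w s u ∂P = 0 := by
  have h1 := integral_apply_eq_zero (ho.mean_G₀ x hx) u
  have h2 := fun i => integral_apply_eq_zero (ho.mean_G i x hx) u
  simp only [Oracle.lagrNoise, Oracle.gradNoise, FunLike.coe_add, Pi.add_apply, FunLike.coe_sum,
    Finset.sum_apply, FunLike.coe_smul, Pi.smul_apply, smul_eq_mul]
  rw [integral_add h1.1 (integrable_finsetSum _ fun i _ => (h2 i).1.const_mul _),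
    integral_finsetSum _ fun i _ => (h2 i).1.const_mul _, h1.2]
  simp only [integral_const_mul, (h2 _).2, mul_zero, Finset.sum_const_zero, add_zero]

omit [FiniteDimensional ℝ E] in
theorem Oracle.IsStochasticOracle.integral_inner_linNoise_eq_zero
    (ho : o.IsStochasticOracle p c P f₀' f') {x : E} (hx : x ∈ p.X) (a : Vec m) (u : E) :
    ∫ s, inner ℝ a (o.linNoise p f' x u s) ∂P = 0 := by
  have h1 := ho.mean_F x hx
  have h2 := fun i => integral_apply_eq_zero (ho.mean_G i x hx) u
  have h3 : Integrable (fun s => o.valueNoise p x s) P := h1.1.sub (integrable_const _)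
  have h4 : ∫ s, o.valueNoise p x s ∂P = 0 := by
    unfold Oracle.valueNoise
    rw [integral_sub h1.1 (integrable_const _), h1.2]; simp
  have h5 : ∫ s, inner ℝ a (o.valueNoise p x s) ∂P = 0 := by
    rw [integral_inner h3, h4, inner_zero_right]
  simp only [Oracle.linNoise, inner_add_right, applyVec, inner_mkVec, Oracle.gradNoise]
  rw [integral_add (h3.const_inner a) (integrable_finsetSum _ fun i _ => (h2 i).1.const_mul _),
    h5, integral_finsetSum _ fun i _ => (h2 i).1.const_mul _]
  simp only [integral_const_mul, (h2 _).2, mul_zero, Finset.sum_const_zero, add_zero]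

end Moments

end ConEx

namespace ConEx

/-! ### Expectations along a stochastic run -/

section StochasticRun

variable {E : Type*} [NormedAddCommGroup E] [NormedSpace ℝ E]
  [MeasurableSpace E] [BorelSpace E] {S : Type*} [MeasurableSpace S] {m : ℕ}
  {Ω : Type*} [mΩ : MeasurableSpace Ω]

/-- A run of the method with independent samples, together with the standing assumptions. -/
structure StochasticRun (μ : Measure Ω) (P : Measure S) (p : Problem E m) (d : DistGen p.X)
    (c : Constants m) (o : Oracle E m S) (f₀' : E → StrongDual ℝ E)
    (f' : Fin m → E → StrongDual ℝ E) (τ : ℕ → ℝ) (T : ℕ) (x₀ : E) (ξ ξbar : ℕ → Ω → S)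
    (x : Ω → ℕ → E) (y : Ω → ℕ → Vec m) : Prop where
  convex : p.IsConvex
  regular : p.Regular d c
  oracle : o.IsStochasticOracle p c P f₀' f'
  samples : AreSamples μ P ξ ξbar
  mem : x₀ ∈ p.X
  run : ∀ w, IsConExRun p d o c.θ c.η τ T x₀ 0 (fun t => ξ t w) (fun t => ξbar t w) (x w) (y w)

variable [FiniteDimensional ℝ E] {μ : Measure Ω} [IsProbabilityMeasure μ] {P : Measure S}
  [IsProbabilityMeasure P] {p : Problem E m} {d : DistGen p.X}
  {c : Constants m} {o : Oracle E m S} {f₀' : E → StrongDual ℝ E}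
  {f' : Fin m → E → StrongDual ℝ E} {τ : ℕ → ℝ} {T : ℕ} {x₀ : E} {ξ ξbar : ℕ → Ω → S}
  {x : Ω → ℕ → E} {y : Ω → ℕ → Vec m}

namespace StochasticRun

omit [FiniteDimensional ℝ E] [IsProbabilityMeasure μ] [IsProbabilityMeasure P] in
theorem mem_X (h : StochasticRun μ P p d c o f₀' f' τ T x₀ ξ ξbar x y) {t : ℕ} (ht : t ≤ T)
    (w : Ω) : x w t ∈ p.X :=
  (h.run w).mem_X h.mem t ht

omit [FiniteDimensional ℝ E] [IsProbabilityMeasure μ] [IsProbabilityMeasure P] in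
theorem norm_step_le (h : StochasticRun μ P p d c o f₀' f' τ T x₀ ξ ξbar x y) {t : ℕ} (ht : t < T)
    (w : Ω) : ‖zeroAtStart (fun t => x w (t + 1) - x w t) t‖ ≤ d.diam := by
  cases t with
  | zero => simpa [zeroAtStart] using d.diam_nonneg
  | succ t => exact d.norm_sub_le_diam h.convex.compact_X (h.mem_X (by omega) w) (h.mem_X ht w)

omit [IsProbabilityMeasure μ] [IsProbabilityMeasure P] in
theorem measurable (h : StochasticRun μ P p d c o f₀' f' τ T x₀ ξ ξbar x y) {t : ℕ} (ht : t ≤ T) :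
    (Measurable fun w => x w t) ∧ Measurable fun w => y w t :=
  measurable_iterates h.convex h.regular h.oracle.measurable_G₀ h.oracle.measurable_G
    h.oracle.measurable_F h.mem h.run le_rfl (fun s _ => h.samples.measurable_ξ s)
    (fun s _ => h.samples.measurable_ξbar s) t ht

/-- The `σ`-algebra generated by all samples except the one with index `j`. -/
@[reducible]
def others (ξ ξbar : ℕ → Ω → S) (j : ℕ ⊕ ℕ) : MeasurableSpace Ω :=
  ⨆ i ∈ ({j}ᶜ : Set (ℕ ⊕ ℕ)), MeasurableSpace.comap (Sum.elim ξ ξbar i) inferInstance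

omit mΩ in
theorem measurable_others_ξ {j : ℕ ⊕ ℕ} {s : ℕ} (hs : Sum.inl s ≠ j) :
    Measurable[others ξ ξbar j] (ξ s) :=
  measurable_of_mem_iSup (Z := Sum.elim ξ ξbar) (j := Sum.inl s) hs

omit mΩ in
theorem measurable_others_ξbar {j : ℕ ⊕ ℕ} {s : ℕ} (hs : Sum.inr s ≠ j) :
    Measurable[others ξ ξbar j] (ξbar s) :=
  measurable_of_mem_iSup (Z := Sum.elim ξ ξbar) (j := Sum.inr s) hs

omit [IsProbabilityMeasure μ] [IsProbabilityMeasure P] [MeasurableSpace E] [BorelSpace E]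
  [FiniteDimensional ℝ E] [NormedSpace ℝ E] [NormedAddCommGroup E] in
theorem indepFun_ξ (hξ : AreSamples μ P ξ ξbar) {U : Type*} [MeasurableSpace U] {t : ℕ}
    {u : Ω → U} (hu : Measurable[others ξ ξbar (Sum.inl t)] u) : IndepFun u (ξ t) μ :=
  indepFun_of_measurable_iSup (Z := Sum.elim ξ ξbar) (j := Sum.inl t)
    (by rintro (i | i); exacts [hξ.measurable_ξ i, hξ.measurable_ξbar i]) hξ.indep (by simp) hu

omit [IsProbabilityMeasure μ] [IsProbabilityMeasure P] [MeasurableSpace E] [BorelSpace E]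
  [FiniteDimensional ℝ E] [NormedSpace ℝ E] [NormedAddCommGroup E] in
theorem indepFun_ξbar (hξ : AreSamples μ P ξ ξbar) {U : Type*} [MeasurableSpace U] {t : ℕ}
    {u : Ω → U} (hu : Measurable[others ξ ξbar (Sum.inr t)] u) : IndepFun u (ξbar t) μ :=
  indepFun_of_measurable_iSup (Z := Sum.elim ξ ξbar) (j := Sum.inr t)
    (by rintro (i | i); exacts [hξ.measurable_ξ i, hξ.measurable_ξbar i]) hξ.indep (by simp) hu

omit [IsProbabilityMeasure μ] [IsProbabilityMeasure P] in
/-- The data entering the stochastic gradient of step `t` do not involve the sample `ξ_t`. -/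
theorem measurable_others_inl (h : StochasticRun μ P p d c o f₀' f' τ T x₀ ξ ξbar x y) {t : ℕ}
    (ht : t < T) : (Measurable[others ξ ξbar (Sum.inl t)] fun w => x w t) ∧
      Measurable[others ξ ξbar (Sum.inl t)] fun w => y w (t + 1) := by
  have hb : ∀ s, Measurable[others ξ ξbar (Sum.inl t)] (ξbar s) := fun s =>
    measurable_others_ξbar (by simp)
  have h1 := measurable_iterates (mΩ := others ξ ξbar (Sum.inl t)) h.convex h.regular
    h.oracle.measurable_G₀ h.oracle.measurable_G h.oracle.measurable_F h.mem h.run ht.le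
    (fun s hs => measurable_others_ξ (by simp; omega)) (fun s _ => hb s)
  exact ⟨(h1 t le_rfl).1, measurable_dual_step (mΩ := others ξ ξbar (Sum.inl t)) h.convex
    h.oracle.measurable_G h.oracle.measurable_F h.mem h.run ht (fun s hs => (h1 s hs).1)
    (h1 t le_rfl).2 (fun s _ => hb s)⟩

omit [IsProbabilityMeasure μ] [IsProbabilityMeasure P] in
theorem measurable_others_inr (h : StochasticRun μ P p d c o f₀' f' τ T x₀ ξ ξbar x y) {t : ℕ}
    (ht : t < T) {s : ℕ} (hs : s ≤ t ∨ (s = t + 1 ∧ 0 < t)) :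
    (Measurable[others ξ ξbar (Sum.inr t)] fun w => x w s) ∧
      Measurable[others ξ ξbar (Sum.inr t)] fun w => y w s := by
  have hx : ∀ s, Measurable[others ξ ξbar (Sum.inr t)] (ξ s) := fun s =>
    measurable_others_ξ (by simp)
  refine measurable_iterates (mΩ := others ξ ξbar (Sum.inr t)) h.convex h.regular
    h.oracle.measurable_G₀ h.oracle.measurable_G h.oracle.measurable_F h.mem h.run
    (n := s) (by omega) (fun s _ => hx s)
    (fun r hr => measurable_others_ξbar ?_) s le_rfl
  simp only [ne_eq, Sum.inr.injEq]
  omega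

omit [IsProbabilityMeasure μ] [IsProbabilityMeasure P] in
/-- The displacement entering the constraint linearization at `x_t`, except for `t = 0`, does not
involve the sample `ξ̄_t`. -/
theorem measurable_others_step (h : StochasticRun μ P p d c o f₀' f' τ T x₀ ξ ξbar x y) {t : ℕ}
    (ht : t < T) : Measurable[others ξ ξbar (Sum.inr t)]
      fun w => zeroAtStart (fun t => x w (t + 1) - x w t) t := by
  cases t with
  | zero => simp only [zeroAtStart]; exact measurable_const
  | succ t =>
    exact (h.measurable_others_inr ht (Or.inr ⟨rfl, by omega⟩)).1.sub
      (h.measurable_others_inr ht (Or.inl le_rfl)).1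

omit [IsProbabilityMeasure μ] [IsProbabilityMeasure P] in
theorem measurable_others_dual (h : StochasticRun μ P p d c o f₀' f' τ T x₀ ξ ξbar x y) {t : ℕ}
    (ht : t < T) : Measurable[others ξ ξbar (Sum.inr t)]
      fun w => zeroAtStart (fun t => y w (t + 1)) t := by
  cases t with
  | zero => simp only [zeroAtStart]; exact measurable_const
  | succ t => exact (h.measurable_others_inr ht (Or.inr ⟨rfl, by omega⟩)).2

omit [IsProbabilityMeasure μ] [IsProbabilityMeasure P] in
theorem others_le (hξ : AreSamples μ P ξ ξbar) (j : ℕ ⊕ ℕ) : others ξ ξbar j ≤ mΩ := by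
  refine iSup₂_le fun i _ => Measurable.comap_le ?_
  rcases i with i | i
  exacts [hξ.measurable_ξ i, hξ.measurable_ξbar i]

theorem integrable_lagrNoise_sq (h : StochasticRun μ P p d c o f₀' f' τ T x₀ ξ ξbar x y) {t : ℕ}
    (ht : t < T) (hy : Integrable (fun w => ‖y w (t + 1)‖ ^ 2) μ) :
    Integrable (fun w => ‖o.lagrNoise f₀' f' (x w t) (y w (t + 1)) (ξ t w)‖ ^ 2) μ ∧
      ∫ w, ‖o.lagrNoise f₀' f' (x w t) (y w (t + 1)) (ξ t w)‖ ^ 2 ∂μ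
        ≤ 2 * c.σ₀ ^ 2 + 2 * c.σNorm ^ 2 * ∫ w, ‖y w (t + 1)‖ ^ 2 ∂μ := by
  have hm := h.measurable_others_inl ht
  let u : Ω → p.X × Vec m := fun w => (⟨x w t, h.mem_X ht.le w⟩, y w (t + 1))
  have hu : Measurable[others ξ ξbar (Sum.inl t)] u :=
    (hm.1.subtype_mk (h := h.mem_X ht.le)).prodMk hm.2
  have hb : Integrable (fun w => 2 * c.σ₀ ^ 2 + 2 * c.σNorm ^ 2 * ‖y w (t + 1)‖ ^ 2) μ :=
    (integrable_const _).add (hy.const_mul _)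
  have := integrable_and_integral_le_of_indep (hu.mono (others_le h.samples _) le_rfl)
    (h.samples.measurable_ξ t) (indepFun_ξ h.samples hu) (h.samples.law_ξ t)
    (φ := fun q => ‖o.lagrNoise f₀' f' q.1.1 q.1.2 q.2‖ ^ 2)
    ((h.oracle.measurable_lagrNoise (measurable_fst.comp measurable_fst) measurable_snd
      (measurable_snd.comp measurable_fst)).norm.pow_const 2) (fun q => sq_nonneg _) hb
    (fun w => h.oracle.integral_lagrNoise_sq_le (h.mem_X ht.le w) _)
  refine ⟨this.1, this.2.trans (le_of_eq ?_)⟩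
  rw [integral_add (integrable_const _) (hy.const_mul _)]
  simp [integral_const_mul]

theorem integral_lagrNoise (h : StochasticRun μ P p d c o f₀' f' τ T x₀ ξ ξbar x y) {t : ℕ}
    (ht : t < T) (hy : Integrable (fun w => ‖y w (t + 1)‖ ^ 2) μ) {xs : E} (hxs : xs ∈ p.X) :
    Integrable (fun w => o.lagrNoise f₀' f' (x w t) (y w (t + 1)) (ξ t w) (x w t - xs)) μ ∧
      ∫ w, o.lagrNoise f₀' f' (x w t) (y w (t + 1)) (ξ t w) (x w t - xs) ∂μ = 0 := by
  have hm := h.measurable_others_inl ht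
  let u : Ω → p.X × Vec m := fun w => (⟨x w t, h.mem_X ht.le w⟩, y w (t + 1))
  have hu : Measurable[others ξ ξbar (Sum.inl t)] u :=
    (hm.1.subtype_mk (h := h.mem_X ht.le)).prodMk hm.2
  have hu' : Measurable u := hu.mono (others_le h.samples _) le_rfl
  have hφ : Measurable fun q : (p.X × Vec m) × S =>
      o.lagrNoise f₀' f' q.1.1 q.1.2 q.2 ((q.1.1 : E) - xs) :=
    measurable_clm_apply (h.oracle.measurable_lagrNoise (measurable_fst.comp measurable_fst)
      measurable_snd (measurable_snd.comp measurable_fst))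
      ((measurable_subtype_coe.comp (measurable_fst.comp measurable_fst)).sub_const xs)
  have hsq := (h.integrable_lagrNoise_sq ht hy).1
  have hint : Integrable
      (fun w => o.lagrNoise f₀' f' (x w t) (y w (t + 1)) (ξ t w) (x w t - xs)) μ := by
    refine ((hsq.add (integrable_const (d.diam ^ 2)))).mono'
      (hφ.comp (hu'.prodMk (h.samples.measurable_ξ t))).aestronglyMeasurable
      (ae_of_all _ fun w => ?_)
    have h1 := (o.lagrNoise f₀' f' (x w t) (y w (t + 1)) (ξ t w)).le_opNorm (x w t - xs)
    have h2 := d.norm_sub_le_diam h.convex.compact_X hxs (h.mem_X ht.le w)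
    have h3 := mul_le_mul_of_nonneg_left h2
      (norm_nonneg (o.lagrNoise f₀' f' (x w t) (y w (t + 1)) (ξ t w)))
    refine h1.trans ?_
    simp only [Pi.add_apply]
    nlinarith [sq_nonneg (‖o.lagrNoise f₀' f' (x w t) (y w (t + 1)) (ξ t w)‖ - d.diam),
      sq_nonneg ‖o.lagrNoise f₀' f' (x w t) (y w (t + 1)) (ξ t w)‖, sq_nonneg d.diam]
  exact ⟨hint, integral_eq_zero_of_indep hu' (h.samples.measurable_ξ t)
    (indepFun_ξ h.samples hu) (h.samples.law_ξ t) hφ hint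
    (fun w => h.oracle.integral_lagrNoise_eq_zero (h.mem_X ht.le w) (y w (t + 1)) (x w t - xs))⟩

theorem integrable_noiseSq (h : StochasticRun μ P p d c o f₀' f' τ T x₀ ξ ξbar x y) {t : ℕ}
    (ht : t < T) :
    Integrable (fun w => o.noiseSq p f' d.diam (x w t) (ξbar t w)) μ ∧
      ∫ w, o.noiseSq p f' d.diam (x w t) (ξbar t w) ∂μ ≤ c.σX d.diam ^ 2 := by
  have hu : Measurable[others ξ ξbar (Sum.inr t)]
      fun w => (⟨x w t, h.mem_X ht.le w⟩ : p.X) :=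
    (h.measurable_others_inr ht (Or.inl le_rfl)).1.subtype_mk (h := h.mem_X ht.le)
  have := integrable_and_integral_le_of_indep (hu.mono (others_le h.samples _) le_rfl)
    (h.samples.measurable_ξbar t) (indepFun_ξbar h.samples hu) (h.samples.law_ξbar t)
    (φ := fun q => o.noiseSq p f' d.diam q.1 q.2)
    (h.oracle.measurable_noiseSq measurable_fst measurable_snd _)
    (fun q => o.noiseSq_nonneg p f' _ _ _) (integrable_const (c.σX d.diam ^ 2))
    (fun w => h.oracle.integral_noiseSq_le (h.mem_X ht.le w) _)
  simpa using this

theorem integrable_dualNorm_sq (h : StochasticRun μ P p d c o f₀' f' τ T x₀ ξ ξbar x y) {t : ℕ}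
    (ht : t < T) :
    Integrable (fun w => dualNorm (o.gradNoise f' (x w t) (ξbar t w)) ^ 2) μ ∧
      ∫ w, dualNorm (o.gradNoise f' (x w t) (ξbar t w)) ^ 2 ∂μ ≤ c.σNorm ^ 2 := by
  have hu : Measurable[others ξ ξbar (Sum.inr t)]
      fun w => (⟨x w t, h.mem_X ht.le w⟩ : p.X) :=
    (h.measurable_others_inr ht (Or.inl le_rfl)).1.subtype_mk (h := h.mem_X ht.le)
  have := integrable_and_integral_le_of_indep (hu.mono (others_le h.samples _) le_rfl)
    (h.samples.measurable_ξbar t) (indepFun_ξbar h.samples hu) (h.samples.law_ξbar t)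
    (φ := fun q => dualNorm (o.gradNoise f' q.1 q.2) ^ 2)
    (h.oracle.measurable_dualNorm_sq measurable_fst measurable_snd)
    (fun q => sq_nonneg _) (integrable_const (c.σNorm ^ 2))
    (fun w => h.oracle.integral_dualNorm_sq_le (h.mem_X ht.le w))
  simpa using this

/-- Inner products of the errors of the constraint linearizations with square integrable vectors not
involving the current sample have mean zero. -/
theorem integral_inner_linNoise (h : StochasticRun μ P p d c o f₀' f' τ T x₀ ξ ξbar x y) {t : ℕ}
    (ht : t < T) {a : Ω → Vec m} (ha : Measurable[others ξ ξbar (Sum.inr t)] a)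
    (ha2 : Integrable (fun w => ‖a w‖ ^ 2) μ) :
    Integrable (fun w => inner ℝ (a w) (o.linNoise p f' (x w t)
        (zeroAtStart (fun t => x w (t + 1) - x w t) t) (ξbar t w))) μ ∧
      ∫ w, inner ℝ (a w) (o.linNoise p f' (x w t)
        (zeroAtStart (fun t => x w (t + 1) - x w t) t) (ξbar t w)) ∂μ = 0 := by
  let u : Ω → (p.X × E) × Vec m := fun w => ((⟨x w t, h.mem_X ht.le w⟩,
    zeroAtStart (fun t => x w (t + 1) - x w t) t), a w)
  have hu : Measurable[others ξ ξbar (Sum.inr t)] u :=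
    (((h.measurable_others_inr ht (Or.inl le_rfl)).1.subtype_mk (h := h.mem_X ht.le)).prodMk
      (h.measurable_others_step ht)).prodMk ha
  have hu' : Measurable u := hu.mono (others_le h.samples _) le_rfl
  have hφ : Measurable fun q : ((p.X × E) × Vec m) × S =>
      inner ℝ q.1.2 (o.linNoise p f' q.1.1.1 q.1.1.2 q.2) :=
    (measurable_snd.comp measurable_fst).inner
      (h.oracle.measurable_linNoise (measurable_fst.comp (measurable_fst.comp measurable_fst))
        measurable_snd (measurable_snd.comp (measurable_fst.comp measurable_fst)))
  have hint : Integrable (fun w => inner ℝ (a w) (o.linNoise p f' (x w t)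
        (zeroAtStart (fun t => x w (t + 1) - x w t) t) (ξbar t w))) μ := by
    refine (ha2.add ((h.integrable_noiseSq ht).1.const_mul 2)).mono'
      (hφ.comp (hu'.prodMk (h.samples.measurable_ξbar t))).aestronglyMeasurable
      (ae_of_all _ fun w => ?_)
    have h1 := abs_real_inner_le_norm (a w) (o.linNoise p f' (x w t)
        (zeroAtStart (fun t => x w (t + 1) - x w t) t) (ξbar t w))
    have h2 := o.norm_linNoise_sq_le p f' (x w t) (h.norm_step_le ht w) (ξbar t w)
    simp only [Real.norm_eq_abs, Pi.add_apply]
    nlinarith [sq_nonneg (‖a w‖ - ‖o.linNoise p f' (x w t)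
        (zeroAtStart (fun t => x w (t + 1) - x w t) t) (ξbar t w)‖), sq_nonneg ‖a w‖,
        sq_nonneg ‖o.linNoise p f' (x w t)
        (zeroAtStart (fun t => x w (t + 1) - x w t) t) (ξbar t w)‖]
  exact ⟨hint, integral_eq_zero_of_indep hu' (h.samples.measurable_ξbar t)
    (indepFun_ξbar h.samples hu) (h.samples.law_ξbar t) hφ hint
    (fun w => h.oracle.integral_inner_linNoise_eq_zero (h.mem_X ht.le w) _ _)⟩

end StochasticRun

end StochasticRun

end ConEx

namespace ConEx

/-! ### Integrated bounds for the noise along a run -/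

section IntegralLE

variable {Ω : Type*} [MeasurableSpace Ω] {μ : Measure Ω}

/-- `f` is integrable with integral at most `a`. -/
def IntegralLE (μ : Measure Ω) (f : Ω → ℝ) (a : ℝ) : Prop := Integrable f μ ∧ ∫ w, f w ∂μ ≤ a

theorem IntegralLE.add {f g : Ω → ℝ} {a b : ℝ} (hf : IntegralLE μ f a) (hg : IntegralLE μ g b) :
    IntegralLE μ (fun w => f w + g w) (a + b) :=
  ⟨hf.1.add hg.1, by rw [integral_add hf.1 hg.1]; exact add_le_add hf.2 hg.2⟩

theorem IntegralLE.const_mul {f : Ω → ℝ} {a r : ℝ} (hf : IntegralLE μ f a) (hr : 0 ≤ r) :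
    IntegralLE μ (fun w => r * f w) (r * a) :=
  ⟨hf.1.const_mul r, by rw [integral_const_mul]; exact mul_le_mul_of_nonneg_left hf.2 hr⟩

theorem IntegralLE.sum {ι : Type*} {s : Finset ι} {f : ι → Ω → ℝ} {a : ι → ℝ}
    (h : ∀ i ∈ s, IntegralLE μ (f i) (a i)) :
    IntegralLE μ (fun w => ∑ i ∈ s, f i w) (∑ i ∈ s, a i) :=
  ⟨integrable_finsetSum _ fun i hi => (h i hi).1, by
    rw [integral_finsetSum _ fun i hi => (h i hi).1]
    exact Finset.sum_le_sum fun i hi => (h i hi).2⟩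

theorem IntegralLE.const [IsProbabilityMeasure μ] (a : ℝ) : IntegralLE μ (fun _ => a) a :=
  ⟨integrable_const a, by simp⟩

theorem IntegralLE.mono {f : Ω → ℝ} {a b : ℝ} (hf : IntegralLE μ f a) (h : a ≤ b) :
    IntegralLE μ f b :=
  ⟨hf.1, hf.2.trans h⟩

theorem IntegralLE.of_eq_zero {f : Ω → ℝ} (h : Integrable f μ ∧ ∫ w, f w ∂μ = 0) (r : ℝ) :
    IntegralLE μ (fun w => r * f w) 0 :=
  ⟨h.1.const_mul r, by rw [integral_const_mul, h.2, mul_zero]⟩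

theorem IntegralLE.prev {f : ℕ → Ω → ℝ} {a : ℝ} {t : ℕ}
    (h : ∀ s ≤ t, IntegralLE μ (f s) a) :
    IntegralLE μ (fun w => prev (fun s => f s w) t) (ConEx.prev (fun _ => a) t) := by
  cases t with
  | zero => exact ⟨by simp [ConEx.prev], by simp [ConEx.prev]⟩
  | succ t => exact h t (by omega)

theorem Constants.integralLE_extrapNoise {m : ℕ} (c : Constants m) {K : ℝ} (hK : 0 < K)
    {f : ℕ → Ω → ℝ} {a : ℝ} {k : ℕ} (h : ∀ t ≤ k, IntegralLE μ (f t) a) :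
    IntegralLE μ (fun w => c.extrapNoise K (fun t => f t w) k)
      (c.extrapNoise K (fun _ => a) k) := by
  have hg := fun t => (c.γ_pos t).le
  have h1 : ∀ t ≤ k, IntegralLE μ
      (fun w => ((t : ℝ) + 2) * c.γ t * (f t w + ConEx.prev (fun s => f s w) t))
      (((t : ℝ) + 2) * c.γ t * (a + ConEx.prev (fun _ => a) t)) := fun t ht =>
    ((h t ht).add (IntegralLE.prev fun s hs => h s (by omega))).const_mul
      (mul_nonneg (by positivity) (hg t))
  have h2 := (((IntegralLE.sum (s := Finset.range (k + 1)) fun t ht =>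
    h1 t (Nat.lt_succ_iff.1 (Finset.mem_range.1 ht))).add (h1 k le_rfl)).const_mul
      (show 0 ≤ 4 / K by positivity)).add
    ((h 0 (by omega)).const_mul (show 0 ≤ c.γ 0 / K from div_nonneg (hg 0) hK.le))
  unfold Constants.extrapNoise
  simp only [mul_div_right_comm (c.γ 0)]
  exact h2

end IntegralLE

theorem continuousOn_mkVec {A : Type*} [TopologicalSpace A] {X : Set A} {m : ℕ}
    {f : Fin m → A → ℝ} (h : ∀ i, ContinuousOn (f i) X) :
    ContinuousOn (fun x => mkVec fun i => f i x) X :=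
  (PiLp.continuous_toLp 2 _).comp_continuousOn (continuousOn_pi.2 h)

theorem norm_posVec_le {m : ℕ} (u : Vec m) : ‖posVec u‖ ≤ ‖u‖ := by
  rw [← sq_le_sq₀ (norm_nonneg _) (norm_nonneg _), EuclideanSpace.norm_sq_eq,
    EuclideanSpace.norm_sq_eq]
  refine Finset.sum_le_sum fun i _ => ?_
  have e : posVec u i = max (u i) 0 := rfl
  rw [e, Real.norm_eq_abs, Real.norm_eq_abs, sq_abs, sq_abs]
  rcases le_total (u i) 0 with h | h
  · rw [max_eq_right h]; nlinarith [sq_nonneg (u i)]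
  · rw [max_eq_left h]

namespace StochasticRun

variable {E : Type*} [NormedAddCommGroup E] [NormedSpace ℝ E]
  [MeasurableSpace E] [BorelSpace E] {S : Type*} [MeasurableSpace S] {m : ℕ}
  {Ω : Type*} [mΩ : MeasurableSpace Ω]
  [FiniteDimensional ℝ E] {μ : Measure Ω} [IsProbabilityMeasure μ] {P : Measure S}
  [IsProbabilityMeasure P] {p : Problem E m} {d : DistGen p.X}
  {c : Constants m} {o : Oracle E m S} {f₀' : E → StrongDual ℝ E}
  {f' : Fin m → E → StrongDual ℝ E} {τ : ℕ → ℝ} {T : ℕ} {x₀ : E} {ξ ξbar : ℕ → Ω → S}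
  {x : Ω → ℕ → E} {y : Ω → ℕ → Vec m}

theorem memLp_linNoise (h : StochasticRun μ P p d c o f₀' f' τ T x₀ ξ ξbar x y) {t : ℕ}
    (ht : t < T) {a : Ω → E} (ha : Measurable a) (haD : ∀ w, ‖a w‖ ≤ d.diam) :
    MemLp (fun w => o.linNoise p f' (x w t) (a w) (ξbar t w)) 2 μ := by
  have hm : Measurable fun w => o.linNoise p f' (x w t) (a w) (ξbar t w) :=
    h.oracle.measurable_linNoise (z := fun w => (⟨x w t, h.mem_X ht.le w⟩ : p.X))
      (h.measurable ht.le).1.subtype_mk (h.samples.measurable_ξbar t) ha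
  rw [memLp_two_iff_integrable_sq_norm hm.aestronglyMeasurable]
  refine ((h.integrable_noiseSq ht).1.const_mul 2).mono'
    (hm.norm.pow_const 2).aestronglyMeasurable (ae_of_all _ fun w => ?_)
  rw [Real.norm_of_nonneg (sq_nonneg _)]
  exact o.norm_linNoise_sq_le p f' _ (haD w) _

theorem memLp_linF (h : StochasticRun μ P p d c o f₀' f' τ T x₀ ξ ξbar x y) {t : ℕ} (ht : t < T) :
    MemLp (fun w => p.χVec (x w t) + o.linF (x w) (fun s => ξbar s w) t) 2 μ := by
  have hX := h.convex.compact_X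
  have hx : ∀ s ≤ T, Measurable fun w => x w s := fun s hs => (h.measurable hs).1
  have hz : ∀ s (hs : s ≤ T), Measurable fun w => (⟨x w s, h.mem_X hs w⟩ : p.X) :=
    fun s hs => (hx s hs).subtype_mk
  obtain ⟨Cχ, hCχ⟩ := hX.exists_bound_of_continuousOn (f := p.χVec)
    (continuousOn_mkVec h.convex.continuous_χ)
  obtain ⟨Cf, hCf⟩ := hX.exists_bound_of_continuousOn (f := p.fVec)
    (continuousOn_mkVec h.convex.continuous_f)
  have h1 : MemLp (fun w => p.χVec (x w t)) 2 μ :=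
    MemLp.of_bound (measurable_χVec h.convex (hx t ht.le)
      (fun w => h.mem_X ht.le w)).aestronglyMeasurable Cχ
      (ae_of_all _ fun w => hCχ _ (h.mem_X ht.le w))
  have hfm : ∀ s ≤ T, MemLp (fun w => p.fVec (x w s)) 2 μ := fun s hs =>
    MemLp.of_bound (h.oracle.measurable_fVec.comp (hz s hs)).aestronglyMeasurable Cf
      (ae_of_all _ fun w => hCf _ (h.mem_X hs w))
  refine h1.add ?_
  cases t with
  | zero =>
    have h2 := h.memLp_linNoise ht (a := fun _ => (0 : E)) measurable_const
      (fun w => by simpa using d.diam_nonneg)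
    have e : (fun w => o.linF (x w) (fun s => ξbar s w) 0) = fun w =>
        p.fVec (x w 0) + o.linNoise p f' (x w 0) 0 (ξbar 0 w) := by
      funext w
      ext i
      simp [Oracle.linF, Oracle.linNoise, Oracle.valueNoise, applyVec, mkVec]
    rw [e]
    exact (hfm 0 ht.le).add h2
  | succ t =>
    have h2 := h.memLp_linNoise (t := t) (by omega)
      (a := fun w => x w (t + 1) - x w t) ((hx (t + 1) ht.le).sub (hx t (by omega)))
      (fun w => d.norm_sub_le_diam hX (h.mem_X (by omega) w) (h.mem_X ht.le w))
    have h3 : MemLp (fun w => applyVec (fun i => f' i (x w t)) (x w (t + 1) - x w t)) 2 μ := by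
      refine MemLp.of_bound (C := c.MfAgg * d.diam) ?_ (ae_of_all _ fun w => ?_)
      · exact (measurable_applyVec (g := fun w i => f' i (x w t))
          (fun i => (h.oracle.measurable_f' i).comp (hz t (by omega)))
          ((hx (t + 1) ht.le).sub (hx t (by omega)))).aestronglyMeasurable
      · have hxt := h.mem_X (t := t) (by omega) w
        have hxt' := h.mem_X ht.le w
        refine (norm_mkVec_le (norm_nonneg (x w (t + 1) - x w t)) fun i =>
          abs_le_of_mem_subdiff (h.regular.lip_f i) (h.oracle.mem_f' i _ hxt) hxt').trans ?_
        exact mul_le_mul_of_nonneg_left (d.norm_sub_le_diam hX hxt hxt') (norm_nonneg _)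
    have e : (fun w => o.linF (x w) (fun s => ξbar s w) (t + 1)) = fun w =>
        p.fVec (x w t) + applyVec (fun i => f' i (x w t)) (x w (t + 1) - x w t)
          + o.linNoise p f' (x w t) (x w (t + 1) - x w t) (ξbar t w) :=
      funext fun w => o.linF_succ p f' _ _ t
    rw [e]
    exact ((hfm t (by omega)).add h3).add h2

/-- The dual iterates are square integrable. -/
theorem integrable_dual_sq (h : StochasticRun μ P p d c o f₀' f' τ T x₀ ξ ξbar x y) :
    ∀ t ≤ T, Integrable (fun w => ‖y w t‖ ^ 2) μ := by
  have key : ∀ t ≤ T, MemLp (fun w => y w t) 2 μ := by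
    intro t
    induction t with
    | zero => intro _; simp only [fun w => (h.run w).y_zero]; exact MemLp.zero
    | succ t ih =>
      intro ht
      have he : MemLp (fun w => o.extrap p c.θ (x w) (fun s => ξbar s w) t) 2 μ := by
        cases t with
        | zero =>
          simp only [Oracle.extrap]
          exact ((h.memLp_linF ht).const_smul (1 + c.θ 0)).sub
            ((h.memLp_linF ht).const_smul (c.θ 0))
        | succ t =>
          simp only [Oracle.extrap]
          exact ((h.memLp_linF ht).const_smul (1 + c.θ (t + 1))).sub
            ((h.memLp_linF (t := t) (by omega)).const_smul (c.θ (t + 1)))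
      have hs := (ih (by omega)).add (he.const_smul (1 / τ t))
      refine hs.of_le (h.measurable ht).2.aestronglyMeasurable (ae_of_all _ fun w => ?_)
      rw [(h.run w).y_step t (by omega)]
      exact norm_posVec_le _
  exact fun t ht => (memLp_two_iff_integrable_sq_norm
    (h.measurable ht).2.aestronglyMeasurable).1 (key t ht)

omit [IsProbabilityMeasure μ] in
theorem measurable_weightedNoise (h : StochasticRun μ P p d c o f₀' f' τ T x₀ ξ ξbar x y) {n : ℕ}
    (hn : n < T) : Measurable[others ξ ξbar (Sum.inr n)]
      fun w => weightedNoise p c o f' (fun t => ξbar t w) (x w) n := by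
  refine Finset.measurable_sum (m := others ξ ξbar (Sum.inr n)) _ fun t ht => ?_
  have ht := Finset.mem_range.1 ht
  have hx := fun s (hs : s ≤ n) => (h.measurable_others_inr hn (Or.inl hs)).1
  have hstep : Measurable[others ξ ξbar (Sum.inr n)]
      fun w => zeroAtStart (fun t => x w (t + 1) - x w t) t := by
    cases t with
    | zero => simp only [zeroAtStart]; exact measurable_const
    | succ t => exact (hx _ ht).sub (hx _ (by omega))
  exact (h.oracle.measurable_linNoise (mQ := others ξ ξbar (Sum.inr n))
    (z := fun w => (⟨x w t, h.mem_X (by omega) w⟩ : p.X)) ((hx t ht.le).subtype_mk)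
    (measurable_others_ξbar (by simp; omega)) hstep).const_smul (c.γ t)

/-- The weighted errors of the constraint linearizations are orthogonal, so their second moments
add up. -/
theorem integralLE_weightedNoise_sq (h : StochasticRun μ P p d c o f₀' f' τ T x₀ ξ ξbar x y) :
    ∀ n ≤ T, IntegralLE μ
      (fun w => ‖weightedNoise p c o f' (fun t => ξbar t w) (x w) n‖ ^ 2)
      (2 * c.σX d.diam ^ 2 * ∑ t ∈ Finset.range n, c.γ t ^ 2) := by
  intro n
  induction n with
  | zero => intro _; simpa [weightedNoise] using IntegralLE.const (μ := μ) 0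
  | succ n ih =>
    intro hn
    have ih := ih (by omega)
    have hlin := h.memLp_linNoise hn
      ((h.measurable_others_step hn).mono (others_le h.samples _) le_rfl) (h.norm_step_le hn)
    have h1 := h.integral_inner_linNoise hn (h.measurable_weightedNoise hn) ih.1
    have h2 : IntegralLE μ (fun w => ‖o.linNoise p f' (x w n)
        (zeroAtStart (fun t => x w (t + 1) - x w t) n) (ξbar n w)‖ ^ 2)
        (2 * c.σX d.diam ^ 2) := by
      have h3 := (memLp_two_iff_integrable_sq_norm hlin.1).1 hlin
      have h4 := h.integrable_noiseSq hn
      refine ⟨h3, (integral_mono h3 (h4.1.const_mul 2) fun w =>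
        o.norm_linNoise_sq_le p f' _ (h.norm_step_le hn w) _).trans ?_⟩
      rw [integral_const_mul]
      linarith [h4.2]
    have h5 := (ih.add (IntegralLE.of_eq_zero h1 (2 * c.γ n))).add
      (h2.const_mul (sq_nonneg (c.γ n)))
    have e : (fun w => ‖weightedNoise p c o f' (fun t => ξbar t w) (x w) (n + 1)‖ ^ 2)
        = fun w => ‖weightedNoise p c o f' (fun t => ξbar t w) (x w) n‖ ^ 2
          + 2 * c.γ n * inner ℝ (weightedNoise p c o f' (fun t => ξbar t w) (x w) n)
            (o.linNoise p f' (x w n)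
              (zeroAtStart (fun t => x w (t + 1) - x w t) n) (ξbar n w))
          + c.γ n ^ 2 * ‖o.linNoise p f' (x w n)
        (zeroAtStart (fun t => x w (t + 1) - x w t) n) (ξbar n w)‖ ^ 2 := by
      funext w
      have : weightedNoise p c o f' (fun t => ξbar t w) (x w) (n + 1)
          = weightedNoise p c o f' (fun t => ξbar t w) (x w) n + c.γ n • o.linNoise p f' (x w n)
              (zeroAtStart (fun t => x w (t + 1) - x w t) n) (ξbar n w) := by
        simp only [weightedNoise, Finset.sum_range_succ]
      rw [this, norm_add_sq_real, inner_smul_right, norm_smul, mul_pow, Real.norm_eq_abs, sq_abs]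
      ring
    rw [e, Finset.sum_range_succ]
    exact h5.mono (by ring_nf; exact le_rfl)

theorem integral_inner_weightedNoise (h : StochasticRun μ P p d c o f₀' f' τ T x₀ ξ ξbar x y)
    {n : ℕ} (hn : n ≤ T) (Y : Vec m) :
    Integrable (fun w => inner ℝ Y (weightedNoise p c o f' (fun t => ξbar t w) (x w) n)) μ ∧
      ∫ w, inner ℝ Y (weightedNoise p c o f' (fun t => ξbar t w) (x w) n) ∂μ = 0 := by
  have h1 := fun t (ht : t ∈ Finset.range n) => h.integral_inner_linNoise (t := t)
    (by have := Finset.mem_range.1 ht; omega) (a := fun _ => Y)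
    (@measurable_const _ _ _ (others ξ ξbar (Sum.inr t)) Y) (integrable_const _)
  simp only [weightedNoise, inner_sum, inner_smul_right]
  refine ⟨integrable_finsetSum _ fun t ht => (h1 t ht).1.const_mul _, ?_⟩
  rw [integral_finsetSum _ fun t ht => (h1 t ht).1.const_mul _]
  refine Finset.sum_eq_zero fun t ht => ?_
  rw [integral_const_mul, (h1 t ht).2, mul_zero]

/-- The expectation of the stochastic part of the path bound. -/
theorem integralLE_pathNoise (h : StochasticRun μ P p d c o f₀' f' τ T x₀ ξ ξbar x y) {K : ℝ}
    (hK : 0 < K) {xs : E} (hxs : xs ∈ p.X) {k : ℕ} (hk : k < T) {b : ℝ}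
    (hb : ∀ t ≤ k, ∫ w, ‖o.lagrNoise f₀' f' (x w t) (y w (t + 1)) (ξ t w)‖ ^ 2 ∂μ ≤ b) :
    IntegralLE μ (fun w => pathNoise p d c o f₀' f' K xs (fun t => ξ t w) (fun t => ξbar t w)
        (x w) (y w) k)
      (8 / c.α₀ * ((k + 1) * b) + c.extrapNoise K (fun _ => c.σX d.diam ^ 2) k) := by
  have hy := h.integrable_dual_sq
  have h1 := (IntegralLE.sum (s := Finset.range (k + 1)) fun t ht =>
    (⟨(h.integrable_lagrNoise_sq (t := t) (by have := Finset.mem_range.1 ht; omega)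
      (hy _ (by have := Finset.mem_range.1 ht; omega))).1,
      hb t (Nat.lt_succ_iff.1 (Finset.mem_range.1 ht))⟩ :
      IntegralLE μ (fun w => ‖o.lagrNoise f₀' f' (x w t) (y w (t + 1)) (ξ t w)‖ ^ 2) b)).const_mul
    (show 0 ≤ 8 / c.α₀ from div_nonneg (by norm_num) c.α₀_pos.le)
  have h2 := c.integralLE_extrapNoise (μ := μ) hK (k := k)
    (f := fun t w => o.noiseSq p f' d.diam (x w t) (ξbar t w))
    (fun t ht => h.integrable_noiseSq (t := t) (by omega))
  have h3 := IntegralLE.sum (μ := μ) (s := Finset.range (k + 1)) fun t ht =>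
    IntegralLE.of_eq_zero (h.integral_lagrNoise (t := t)
      (by have := Finset.mem_range.1 ht; omega)
      (hy _ (by have := Finset.mem_range.1 ht; omega)) hxs) (-c.γ t)
  have h4 := IntegralLE.sum (μ := μ) (s := Finset.range (k + 1)) fun t ht =>
    have ht' : t < T := by have := Finset.mem_range.1 ht; omega
    IntegralLE.of_eq_zero (h.integral_inner_linNoise (t := t) ht'
      (h.measurable_others_dual ht')
      (by
        cases t with
        | zero => simp [zeroAtStart]
        | succ t => exact hy _ ht')) (c.γ t)
  have h5 := ((h1.add h2).add h3).add h4
  have e : (fun w => pathNoise p d c o f₀' f' K xs (fun t => ξ t w) (fun t => ξbar t w)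
      (x w) (y w) k) = _ := funext fun w => (by
    unfold pathNoise
    simp only [neg_mul, Finset.sum_neg_distrib]
    ring :
      _ = 8 / c.α₀ * ∑ t ∈ Finset.range (k + 1),
          ‖o.lagrNoise f₀' f' (x w t) (y w (t + 1)) (ξ t w)‖ ^ 2
        + c.extrapNoise K (fun t => o.noiseSq p f' d.diam (x w t) (ξbar t w)) k
        + ∑ t ∈ Finset.range (k + 1), -c.γ t *
          o.lagrNoise f₀' f' (x w t) (y w (t + 1)) (ξ t w) (x w t - xs)
        + ∑ t ∈ Finset.range (k + 1), c.γ t * inner ℝ (zeroAtStart (fun t => y w (t + 1)) t)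
          (o.linNoise p f' (x w t) (zeroAtStart (fun t => x w (t + 1) - x w t) t) (ξbar t w)))
  rw [e]
  refine IntegralLE.mono h5 ?_
  simp

end StochasticRun

end ConEx

namespace ConEx

/-! ### Saddle points and sums of step sizes -/

section Saddle

variable {E : Type*} [NormedAddCommGroup E] [NormedSpace ℝ E] {m : ℕ} {p : Problem E m}
  {xs : E} {ys : Vec m}

theorem sum_mul_eq_inner (a b : Vec m) : ∑ i, a i * b i = inner ℝ a b := by
  simp [PiLp.inner_apply, mul_comm]

omit [NormedAddCommGroup E] [NormedSpace ℝ E] in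
theorem Problem.IsSaddlePoint.inner_nonpos (hs : p.IsSaddlePoint xs ys) {w : Vec m}
    (hw : ∀ i, 0 ≤ w i) : inner ℝ w (p.ψ xs) ≤ 0 := by
  have h := hs.dual (ys + w) fun i => add_nonneg (hs.nonneg i) (hw i)
  simp only [Problem.lagrangian, sum_mul_eq_inner, inner_add_left] at h
  linarith

omit [NormedAddCommGroup E] [NormedSpace ℝ E] in
/-- Complementary slackness. -/
theorem Problem.IsSaddlePoint.inner_eq_zero (hs : p.IsSaddlePoint xs ys) :
    inner ℝ ys (p.ψ xs) = 0 := by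
  have h := hs.dual 0 fun i => le_rfl
  simp only [Problem.lagrangian, sum_mul_eq_inner, inner_zero_left] at h
  exact le_antisymm (hs.inner_nonpos hs.nonneg) (by linarith)

omit [NormedAddCommGroup E] [NormedSpace ℝ E] in
theorem Problem.IsSaddlePoint.obj_add_inner_nonneg (hs : p.IsSaddlePoint xs ys) {z : E}
    (hz : z ∈ p.X) : 0 ≤ p.ψ₀ z - p.ψ₀ xs + inner ℝ ys (p.ψ z) := by
  have h := hs.primal z hz
  simp only [Problem.lagrangian, sum_mul_eq_inner, hs.inner_eq_zero] at h
  linarith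

omit [NormedAddCommGroup E] [NormedSpace ℝ E] in
theorem Problem.IsSaddlePoint.le_gap (hs : p.IsSaddlePoint xs ys) {w : Vec m}
    (hw : ∀ i, 0 ≤ w i) (Y : Vec m) (z : E) :
    p.ψ₀ z - p.ψ₀ xs + inner ℝ Y (p.ψ z) ≤ p.gap xs Y w z := by
  have := hs.inner_nonpos hw
  unfold Problem.gap
  linarith

end Saddle

namespace Constants

variable {m : ℕ} (c : Constants m)

/-- The scale `K` of the dual stepsizes `τ_t = K / (t + 1)` dominates the three quantities in the
definition of the method. -/
structure IsDualScale (D : ℝ) (T : ℕ) (K : ℝ) : Prop where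
  pos : 0 < K
  calM_le : 32 * c.calM ^ 2 / c.α₀ ≤ K
  σ_le : 384 * c.σNorm ^ 2 * T / c.α₀ ≤ K
  σX_le : c.σX D * (T : ℝ) ^ (3 / 2 : ℝ) / (c.B * Real.sqrt (c.t₀ + 2)) ≤ K

theorem σX_nonneg (D : ℝ) : 0 ≤ c.σX D := Real.sqrt_nonneg _

theorem σX_sq (D : ℝ) : c.σX D ^ 2 = c.σf ^ 2 + D ^ 2 * c.σNorm ^ 2 :=
  Real.sq_sqrt (by positivity)

theorem diam_mul_σNorm_le {D : ℝ} : D ^ 2 * c.σNorm ^ 2 ≤ c.σX D ^ 2 := by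
  rw [c.σX_sq]; nlinarith [sq_nonneg c.σf]

theorem rpow_three_halves {a : ℝ} (ha : 0 ≤ a) : a ^ (3 / 2 : ℝ) = Real.sqrt a ^ 3 := by
  rw [Real.sqrt_eq_rpow, ← Real.rpow_natCast, ← Real.rpow_mul ha]
  norm_num

variable {c}

theorem IsDualScale.σX_mul_le {D : ℝ} {T : ℕ} {K : ℝ} (h : c.IsDualScale D T K) :
    c.σX D * Real.sqrt T ^ 3 ≤ K * (c.B * Real.sqrt (c.t₀ + 2)) := by
  have h1 := h.σX_le
  have hB := c.one_le_B
  have ht := c.two_le_t₀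
  rwa [rpow_three_halves (Nat.cast_nonneg T), div_le_iff₀ (by positivity)] at h1

theorem IsDualScale.σ_mul_le {D : ℝ} {T : ℕ} {K : ℝ} (h : c.IsDualScale D T K) :
    384 * c.σNorm ^ 2 * T ≤ K * c.α₀ := by
  have h1 := h.σ_le
  rwa [div_le_iff₀ c.α₀_pos] at h1

/-- The factor of `a / K` in a bound for the contribution of the extrapolated constraint values when
the noise has variance `a` at every step. -/
noncomputable def extrapWeight (c : Constants m) (k : ℕ) : ℝ :=
  8 * (∑ t ∈ Finset.range (k + 1), ((t : ℝ) + 2) * c.γ t + (k + 2) * c.γ k) + c.γ 0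

theorem extrapNoise_const_le {K a : ℝ} (hK : 0 < K) (ha : 0 ≤ a) (k : ℕ) :
    c.extrapNoise K (fun _ => a) k ≤ a / K * c.extrapWeight k := by
  have hp : ∀ t, prev (fun _ => a) t ≤ a := fun t => by cases t <;> simp [prev, ha]
  have hg := fun t => (c.γ_pos t).le
  have h1 : ∀ t : ℕ, ((t : ℝ) + 2) * c.γ t * (a + prev (fun _ => a) t)
      ≤ 2 * a * (((t : ℝ) + 2) * c.γ t) := fun t => by
    have := mul_le_mul_of_nonneg_left (hp t)
      (mul_nonneg (show (0:ℝ) ≤ (t:ℝ) + 2 by positivity) (hg t))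
    linarith
  have h2 := Finset.sum_le_sum fun t (_ : t ∈ Finset.range (k + 1)) => h1 t
  rw [← Finset.mul_sum] at h2
  have h3 := mul_le_mul_of_nonneg_left (add_le_add h2 (h1 k)) (show 0 ≤ 4 / K by positivity)
  unfold extrapNoise extrapWeight
  refine (add_le_add_left h3 _).trans (le_of_eq ?_)
  ring

theorem sum_γ (c : Constants m) (n : ℕ) :
    ∑ t ∈ Finset.range n, c.γ t = n * (n + 2 * c.t₀ + 3) / 2 := by
  induction n with
  | zero => simp
  | succ n ih => rw [Finset.sum_range_succ, ih, γ]; push_cast; ring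

theorem sum_mul_γ (c : Constants m) (n : ℕ) : ∑ t ∈ Finset.range n, ((t : ℝ) + 2) * c.γ t
    = n * (2 * n ^ 2 + 9 * n + 13) / 6 + c.t₀ * (n * (n + 3) / 2) := by
  induction n with
  | zero => simp
  | succ n ih => rw [Finset.sum_range_succ, ih, γ]; push_cast; ring

theorem extrapWeight_nonneg (k : ℕ) : 0 ≤ c.extrapWeight k := by
  have hg := fun t => (c.γ_pos t).le
  have := Finset.sum_nonneg fun t (_ : t ∈ Finset.range (k + 1)) =>
    mul_nonneg (show (0:ℝ) ≤ (t:ℝ) + 2 by positivity) (hg t)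
  unfold extrapWeight
  have h2 := hg k
  have h3 := hg 0
  positivity

theorem extrapWeight_mul_le (k : ℕ) :
    c.extrapWeight k * (k + 2) ≤ 66 * ((k : ℝ) + 1) ^ 3 * c.γ (k + 1) := by
  unfold extrapWeight
  rw [sum_mul_γ]
  simp only [γ]
  obtain ⟨b, hb⟩ : ∃ b, c.t₀ = 2 + b := ⟨c.t₀ - 2, by ring⟩
  have hb0 : 0 ≤ b := by linarith [c.two_le_t₀]
  rw [hb, ← sub_nonneg]
  push_cast
  ring_nf
  positivity

/-- The total noise of the extrapolated constraint values after `k + 1` steps. -/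
theorem extrapWeight_le (k : ℕ) : c.extrapWeight k
    ≤ (12 * (c.t₀ + 1) + 8 * (k + 1)) * ∑ t ∈ Finset.range (k + 1), c.γ t := by
  unfold extrapWeight
  rw [sum_mul_γ, sum_γ]
  simp only [γ]
  obtain ⟨b, hb⟩ : ∃ b, c.t₀ = 2 + b := ⟨c.t₀ - 2, by ring⟩
  have hb0 : 0 ≤ b := by linarith [c.two_le_t₀]
  rw [hb, ← sub_nonneg]
  push_cast
  ring_nf
  positivity

end Constants

end ConEx

namespace ConEx

/-! ### Boundedness of the dual iterates in mean square -/

section Gronwall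

variable {m : ℕ}

/-- The self-bounding step for the dual error: the bound for `e = E ‖y* - y_{k+1}‖²` in terms of the
gradient noise, which in turn is bounded through `e`, is a contraction. -/
theorem Constants.IsDualScale.dual_error_le {c : Constants m} {D K N : ℝ} {T k : ℕ}
    (h : c.IsDualScale D T K) (hk : k < T) {e : ℝ} (he0 : 0 ≤ e)
    (he : c.γ (k + 1) * dualStep K (k + 1) / 4 * e
      ≤ c.α₀ * (c.t₀ + 1) * (c.t₀ + 2) * D ^ 2 / 2 + (c.t₀ + 2) * K / 2 * N ^ 2
        + 8 / c.α₀ * ((k + 1) * c.nonsmooth D N ^ 2)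
        + (c.t₀ + 2) * N ^ 2 / c.α₀ * c.σNorm ^ 2
        + (8 / c.α₀ * ((k + 1) * (2 * c.σ₀ ^ 2 + 4 * c.σNorm ^ 2 * N ^ 2 + 4 * c.σNorm ^ 2 * e))
          + c.extrapNoise K (fun _ => c.σX D ^ 2) k)) :
    4 * c.σNorm ^ 2 * e ≤ c.σ₀ ^ 2 + (13 * (c.t₀ + 2) + 2) * c.σNorm ^ 2 * N ^ 2
      + 1584 * (c.t₀ + 2) * c.B ^ 2 * c.σNorm ^ 2 + c.nonsmooth D N ^ 2 / 2
      + 24 * (c.α₀ * c.B * c.σX D * Real.sqrt (c.t₀ + 2) ^ 3) := by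
  have hα := c.α₀_pos
  have hB := c.one_le_B
  have ht := c.two_le_t₀
  have hK := h.pos
  have hγ := c.γ_pos (k + 1)
  have hγ' : c.γ (k + 1) = k + c.t₀ + 3 := by unfold Constants.γ; push_cast; ring
  have hk0 : (0 : ℝ) ≤ k := Nat.cast_nonneg k
  have hkT : (k : ℝ) + 1 ≤ T := by exact_mod_cast hk
  set S := c.σNorm ^ 2 with hS
  have hS0 : 0 ≤ S := sq_nonneg _
  set H := c.nonsmooth D N
  set r := Real.sqrt (c.t₀ + 2) with hr
  have hr0 : 0 ≤ r := Real.sqrt_nonneg _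
  have hr2 : r ^ 2 = c.t₀ + 2 := Real.sq_sqrt (by linarith)
  set Q := Real.sqrt T with hQ
  have hQ2 : Q ^ 2 = T := Real.sq_sqrt (by linarith)
  have hQ1 : 1 ≤ Q := Real.one_le_sqrt.2 (by linarith)
  have hσX := h.σX_mul_le
  rw [← hr, ← hQ] at hσX
  have hX0 := c.σX_nonneg D
  have hSD : D ^ 2 * S ≤ c.σX D ^ 2 := c.diam_mul_σNorm_le
  set X := c.σX D
  have hσ := h.σ_mul_le
  rw [← hS] at hσ
  have hQ3 : (T : ℝ) ≤ Q ^ 3 := by nlinarith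
  -- `q` is the reciprocal of the weight of the dual error
  set q := ((k : ℝ) + 2) / (c.γ (k + 1) * K) with hq
  have hq0 : 0 ≤ q := by positivity
  have hx := Constants.extrapNoise_const_le (c := c) hK (sq_nonneg X) k
  have hw := Constants.extrapWeight_mul_le (c := c) k
  clear_value S H r Q X q
  have hqK : q * K ≤ 1 := by
    rw [hq, div_mul_eq_mul_div, div_le_one (by positivity)]
    exact mul_le_mul_of_nonneg_right (by linarith) hK.le
  have hqe : q * (c.γ (k + 1) * dualStep K (k + 1) / 4 * e) = e / 4 := by
    rw [hq, dualStep]; push_cast; field_simp; ring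
  have hSk : S * (k + 1) / c.α₀ * q ≤ 1 / 384 := by
    rw [div_mul_eq_mul_div, div_le_iff₀ hα]
    have h1 : 384 * (S * (k + 1)) ≤ K * c.α₀ := by
      linarith [mul_le_mul_of_nonneg_left hkT hS0]
    linarith [mul_le_mul_of_nonneg_right h1 hq0, mul_le_mul_of_nonneg_right hqK hα.le]
  have hSq : S / c.α₀ * q ≤ 1 / 384 := by
    refine le_trans (mul_le_mul_of_nonneg_right ?_ hq0) hSk
    gcongr
    linarith [mul_nonneg hS0 hk0]
  -- multiplication of `he` by `16 σ² q` turns its left-hand side into `4 σ² e`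
  have b1 : 16 * S * q * (c.α₀ * (c.t₀ + 1) * (c.t₀ + 2) * D ^ 2 / 2)
      ≤ 16 * (c.α₀ * c.B * X * r ^ 3) := by
    have e1 : (c.t₀ + 1) * q * X ≤ 2 * c.B * r := by
      rw [hq, mul_div_assoc', div_mul_eq_mul_div, div_le_iff₀ (by positivity)]
      have e2 : (c.t₀ + 1) * ((k : ℝ) + 2) ≤ 2 * c.γ (k + 1) * Q ^ 3 := by
        have : (c.t₀ + 1) * ((k : ℝ) + 2) ≤ 2 * c.γ (k + 1) * (k + 1) := by
          rw [hγ']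
          nlinarith only [hk0, ht, mul_nonneg hk0 hk0, mul_nonneg hk0 (sub_nonneg.2 ht)]
        exact this.trans (mul_le_mul_of_nonneg_left (hkT.trans hQ3) (by positivity))
      have e3 := mul_le_mul_of_nonneg_right e2 hX0
      have e4 := mul_le_mul_of_nonneg_left hσX (show 0 ≤ 2 * c.γ (k + 1) by positivity)
      linarith only [e3, e4]
    have e5 := mul_le_mul_of_nonneg_left e1 (show 0 ≤ 8 * c.α₀ * r ^ 2 * X by positivity)
    have e6 := mul_le_mul_of_nonneg_left hSD
      (show 0 ≤ 8 * c.α₀ * r ^ 2 * ((c.t₀ + 1) * q) by positivity)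
    rw [← hr2]
    linarith only [e5, e6]
  have b2 : 16 * S * q * ((c.t₀ + 2) * K / 2 * N ^ 2) ≤ 8 * (c.t₀ + 2) * S * N ^ 2 := by
    have := mul_le_mul_of_nonneg_left hqK (show 0 ≤ 8 * (c.t₀ + 2) * S * N ^ 2 by positivity)
    linarith only [this]
  have b3 : 16 * S * q * (8 / c.α₀ * ((k + 1) * H ^ 2)) ≤ H ^ 2 / 3 := by
    have := mul_le_mul_of_nonneg_left hSk (show 0 ≤ 128 * H ^ 2 by positivity)
    refine le_trans (le_of_eq ?_) (this.trans (le_of_eq ?_)) <;> ring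
  have b4 : 16 * S * q * ((c.t₀ + 2) * N ^ 2 / c.α₀ * S) ≤ (c.t₀ + 2) * S * N ^ 2 / 24 := by
    have := mul_le_mul_of_nonneg_left hSq (show 0 ≤ 16 * S * ((c.t₀ + 2) * N ^ 2) by positivity)
    refine le_trans (le_of_eq ?_) (this.trans (le_of_eq ?_)) <;> ring
  -- the self-referential term returns with the factor `1 / 3`
  have b5 : 16 * S * q * (8 / c.α₀ * ((k + 1) * (2 * c.σ₀ ^ 2 + 4 * S * N ^ 2 + 4 * S * e)))
      ≤ (2 * c.σ₀ ^ 2 + 4 * S * N ^ 2 + 4 * S * e) / 3 := by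
    have := mul_le_mul_of_nonneg_left hSk
      (show 0 ≤ 128 * (2 * c.σ₀ ^ 2 + 4 * S * N ^ 2 + 4 * S * e) by positivity)
    refine le_trans (le_of_eq ?_) (this.trans (le_of_eq ?_)) <;> ring
  have b6 : 16 * S * q * c.extrapNoise K (fun _ => X ^ 2) k
      ≤ 1056 * (c.t₀ + 2) * c.B ^ 2 * S := by
    have e2 : q * (X ^ 2 / K * c.extrapWeight k) ≤ 66 * (c.B ^ 2 * (c.t₀ + 2)) := by
      have e3 : X ^ 2 * ((k : ℝ) + 1) ^ 3 ≤ K ^ 2 * (c.B ^ 2 * (c.t₀ + 2)) := by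
        have e4 := pow_le_pow_left₀ (by positivity) hσX 2
        have e5 : ((k : ℝ) + 1) ^ 3 ≤ (Q ^ 3) ^ 2 := by
          rw [← pow_mul, mul_comm 3 2, pow_mul, hQ2]
          gcongr
        have e6 := mul_le_mul_of_nonneg_left e5 (sq_nonneg X)
        rw [← hr2]
        linarith only [e4, e6]
      have e7 := mul_le_mul_of_nonneg_left hw (sq_nonneg X)
      have e8 := mul_le_mul_of_nonneg_left e3 (show 0 ≤ 66 * c.γ (k + 1) by positivity)
      rw [hq, show ((k : ℝ) + 2) / (c.γ (k + 1) * K) * (X ^ 2 / K * c.extrapWeight k)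
        = X ^ 2 * (c.extrapWeight k * (k + 2)) / (c.γ (k + 1) * K ^ 2) by field_simp,
        div_le_iff₀ (by positivity)]
      linarith only [e7, e8]
    have e9 := mul_le_mul_of_nonneg_left hx hq0
    have e10 := mul_le_mul_of_nonneg_left (e9.trans e2) (show 0 ≤ 16 * S by positivity)
    linarith only [e10]
  have hmul := mul_le_mul_of_nonneg_left he (show 0 ≤ 16 * S * q by positivity)
  have hl : 16 * S * q * (c.γ (k + 1) * dualStep K (k + 1) / 4 * e) = 4 * S * e := by
    rw [mul_assoc (16 * S), hqe]; ring
  rw [hl, mul_add, mul_add, mul_add, mul_add, mul_add] at hmul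
  have : 0 ≤ (c.t₀ + 2) * S * N ^ 2 := by positivity
  linarith only [hmul, b1, b2, b3, b4, b5, b6, this]

end Gronwall

variable {E : Type*} [NormedAddCommGroup E] [NormedSpace ℝ E]
  [MeasurableSpace E] [BorelSpace E] {S : Type*} [MeasurableSpace S] {m : ℕ}
  {Ω : Type*} [mΩ : MeasurableSpace Ω]
  [FiniteDimensional ℝ E] {μ : Measure Ω} [IsProbabilityMeasure μ] {P : Measure S}
  [IsProbabilityMeasure P] {p : Problem E m} {d : DistGen p.X}
  {c : Constants m} {o : Oracle E m S} {f₀' : E → StrongDual ℝ E}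
  {f' : Fin m → E → StrongDual ℝ E} {τ : ℕ → ℝ} {T : ℕ} {x₀ : E} {ξ ξbar : ℕ → Ω → S}
  {x : Ω → ℕ → E} {y : Ω → ℕ → Vec m}

/-- The right-hand side of the bound along one trajectory for dual reference points of norm at most
`R`, up to the inner product with the weighted noise. -/
noncomputable def pathMajorant (p : Problem E m) (d : DistGen p.X) (c : Constants m)
    (o : Oracle E m S) (f₀' : E → StrongDual ℝ E) (f' : Fin m → E → StrongDual ℝ E) (K : ℝ)
    (xs : E) (s sbar : ℕ → S) (x : ℕ → E) (y : ℕ → Vec m) (k : ℕ) (R : ℝ) : ℝ :=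
  c.α₀ * (c.t₀ + 1) * (c.t₀ + 2) * d.diam ^ 2 / 2 + (c.t₀ + 2) * K / 2 * R ^ 2
    + 8 / c.α₀ * ((k + 1) * c.nonsmooth d.diam R ^ 2)
    + (c.t₀ + 2) * R ^ 2 / c.α₀ * dualNorm (o.gradNoise f' (x 0) (sbar 0)) ^ 2
    + pathNoise p d c o f₀' f' K xs s sbar x y k

/-- An upper bound for the expectation of `pathMajorant`, when the second moments of the gradient noise are at most
`b`. -/
noncomputable def Constants.meanMajorant (c : Constants m) (D K b : ℝ) (k : ℕ) (R : ℝ) : ℝ :=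
  c.α₀ * (c.t₀ + 1) * (c.t₀ + 2) * D ^ 2 / 2 + (c.t₀ + 2) * K / 2 * R ^ 2
    + 8 / c.α₀ * ((k + 1) * c.nonsmooth D R ^ 2)
    + (c.t₀ + 2) * R ^ 2 / c.α₀ * c.σNorm ^ 2
    + (8 / c.α₀ * ((k + 1) * b) + c.extrapNoise K (fun _ => c.σX D ^ 2) k)

/-- The projected dual step, with stepsizes `K / (t + 1)`, as it enters the bound along one
trajectory. -/
def DualSteps (p : Problem E m) (c : Constants m) (o : Oracle E m S) (K : ℝ) (T : ℕ)
    (sbar : ℕ → S) (x : ℕ → E) (y : ℕ → Vec m) : Prop :=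
  ∀ Y : Vec m, (∀ i, 0 ≤ Y i) → ∀ t < T, inner ℝ (Y - y (t + 1)) (o.extrap p c.θ x sbar t)
    ≤ dualStep K t * inner ℝ (Y - y (t + 1)) (y (t + 1) - y t)

namespace StochasticRun

omit [IsProbabilityMeasure μ] [IsProbabilityMeasure P] in
theorem path_le (h : StochasticRun μ P p d c o f₀' f' τ T x₀ ξ ξbar x y) {xs : E}
    {ys : Vec m} (hs : p.IsSaddlePoint xs ys) {K : ℝ} (hK : c.IsDualScale d.diam T K) {w : Ω}
    (hd : DualSteps p c o K T (fun t => ξbar t w) (x w) (y w)) {Y : Vec m} (hY : ∀ i, 0 ≤ Y i)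
    {R : ℝ} (hR : ‖Y‖ ≤ R) {k : ℕ} (hk : k < T) :
    ∑ t ∈ Finset.range (k + 1), c.γ t * (p.ψ₀ (x w (t + 1)) - p.ψ₀ xs
          + inner ℝ Y (p.ψ (x w (t + 1))))
        + c.γ (k + 1) * c.η (k + 1) * d.W xs (x w (k + 1))
        + c.γ (k + 1) * dualStep K (k + 1) / 4 * ‖Y - y w (k + 1)‖ ^ 2
      ≤ pathMajorant p d c o f₀' f' K xs (fun t => ξ t w) (fun t => ξbar t w) (x w) (y w) k R
        - inner ℝ Y (weightedNoise p c o f' (fun t => ξbar t w) (x w) (k + 1)) := by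
  have h1 := path_bound h.convex h.regular h.oracle.mem_f₀' h.oracle.mem_f' h.mem hs.mem_X
    (h.run w) hK.pos hK.calM_le hY (hd Y hY) hk
  have h2 : ∑ t ∈ Finset.range (k + 1), c.γ t * (p.ψ₀ (x w (t + 1)) - p.ψ₀ xs
      + inner ℝ Y (p.ψ (x w (t + 1))))
      ≤ ∑ t ∈ Finset.range (k + 1), c.γ t * p.gap xs Y (y w (t + 1)) (x w (t + 1)) :=
    Finset.sum_le_sum fun t ht => mul_le_mul_of_nonneg_left
      (hs.le_gap ((h.run w).dual_nonneg _ (by have := Finset.mem_range.1 ht; omega)) _ _)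
      (c.γ_pos t).le
  have hR2 : ‖Y‖ ^ 2 ≤ R ^ 2 := pow_le_pow_left₀ (norm_nonneg _) hR 2
  have ht := c.two_le_t₀
  have hα := c.α₀_pos
  have hKp := hK.pos
  have h3 := c.nonsmooth_mono d.diam_nonneg hR
  have h4 := c.nonsmooth_nonneg d.diam_nonneg (norm_nonneg Y)
  unfold pathMajorant
  refine (add_le_add_left (add_le_add_left h2 _) _).trans (h1.trans ?_)
  gcongr

theorem integralLE_pathMajorant (h : StochasticRun μ P p d c o f₀' f' τ T x₀ ξ ξbar x y) {K : ℝ}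
    (hK : 0 < K) {xs : E} (hxs : xs ∈ p.X) {k : ℕ} (hk : k < T) {b : ℝ}
    (hb : ∀ t ≤ k, ∫ w, ‖o.lagrNoise f₀' f' (x w t) (y w (t + 1)) (ξ t w)‖ ^ 2 ∂μ ≤ b) (R : ℝ) :
    IntegralLE μ (fun w => pathMajorant p d c o f₀' f' K xs (fun t => ξ t w) (fun t => ξbar t w)
      (x w) (y w) k R) (c.meanMajorant d.diam K b k R) := by
  have ht := c.two_le_t₀
  have hα := c.α₀_pos
  exact ((IntegralLE.const _).add (IntegralLE.const_mul
    (h.integrable_dualNorm_sq (by omega : 0 < T)) (by positivity))).add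
      (h.integralLE_pathNoise hK hxs hk hb)

theorem integrable_dual_error (h : StochasticRun μ P p d c o f₀' f' τ T x₀ ξ ξbar x y)
    (ys : Vec m) {t : ℕ} (ht : t ≤ T) : Integrable (fun w => ‖ys - y w t‖ ^ 2) μ := by
  have h1 := (memLp_two_iff_integrable_sq_norm (h.measurable ht).2.aestronglyMeasurable).2
    (h.integrable_dual_sq t ht)
  have h2 : MemLp (fun w => ys - y w t) 2 μ := (memLp_const ys).sub h1
  exact (memLp_two_iff_integrable_sq_norm h2.1).1 h2

theorem integral_lagrNoise_sq_le_dual_error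
    (h : StochasticRun μ P p d c o f₀' f' τ T x₀ ξ ξbar x y) (ys : Vec m) {t : ℕ} (ht : t < T) :
    ∫ w, ‖o.lagrNoise f₀' f' (x w t) (y w (t + 1)) (ξ t w)‖ ^ 2 ∂μ
      ≤ 2 * c.σ₀ ^ 2 + 4 * c.σNorm ^ 2 * ‖ys‖ ^ 2
        + 4 * c.σNorm ^ 2 * ∫ w, ‖ys - y w (t + 1)‖ ^ 2 ∂μ := by
  have h1 := h.integrable_dual_error ys (t := t + 1) ht
  have h2 := h.integrable_dual_sq (t + 1) ht
  have h3 := (h.integrable_lagrNoise_sq ht h2).2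
  have h4 : ∫ w, ‖y w (t + 1)‖ ^ 2 ∂μ ≤ ∫ w, (2 * ‖ys‖ ^ 2 + 2 * ‖ys - y w (t + 1)‖ ^ 2) ∂μ := by
    refine integral_mono h2 ((integrable_const _).add (h1.const_mul 2)) fun w => ?_
    have := norm_add_sq_le_two ys (y w (t + 1) - ys)
    rw [add_sub_cancel, norm_sub_rev] at this
    exact this
  rw [integral_add (integrable_const _) (h1.const_mul 2), integral_const_mul] at h4
  simp only [integral_const, probReal_univ, one_smul, integral_const_mul] at h4
  have := mul_le_mul_of_nonneg_left h4 (sq_nonneg c.σNorm)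
  linarith

/-- The gradient noise along the iterates is bounded in mean square, although the dual iterates
that enter it are not bounded a priori. -/
theorem integral_lagrNoise_sq_le (h : StochasticRun μ P p d c o f₀' f' τ T x₀ ξ ξbar x y) {xs : E}
    {ys : Vec m} (hs : p.IsSaddlePoint xs ys) {K : ℝ} (hK : c.IsDualScale d.diam T K)
    (hd : ∀ᵐ w ∂μ, DualSteps p c o K T (fun t => ξbar t w) (x w) (y w)) :
    ∀ k < T, ∫ w, ‖o.lagrNoise f₀' f' (x w k) (y w (k + 1)) (ξ k w)‖ ^ 2 ∂μ
      ≤ 2 * c.σ₀ ^ 2 + 4 * c.σNorm ^ 2 * ‖ys‖ ^ 2 + (c.σ₀ ^ 2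
        + (13 * (c.t₀ + 2) + 2) * c.σNorm ^ 2 * ‖ys‖ ^ 2
        + 1584 * (c.t₀ + 2) * c.B ^ 2 * c.σNorm ^ 2 + c.nonsmooth d.diam ‖ys‖ ^ 2 / 2
        + 24 * (c.α₀ * c.B * c.σX d.diam * Real.sqrt (c.t₀ + 2) ^ 3)) := by
  set R := c.σ₀ ^ 2 + (13 * (c.t₀ + 2) + 2) * c.σNorm ^ 2 * ‖ys‖ ^ 2
    + 1584 * (c.t₀ + 2) * c.B ^ 2 * c.σNorm ^ 2 + c.nonsmooth d.diam ‖ys‖ ^ 2 / 2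
    + 24 * (c.α₀ * c.B * c.σX d.diam * Real.sqrt (c.t₀ + 2) ^ 3) with hRdef
  have key : ∀ k < T, 4 * c.σNorm ^ 2 * ∫ w, ‖ys - y w (k + 1)‖ ^ 2 ∂μ ≤ R := by
    intro k
    induction k using Nat.strong_induction_on with
    | _ k ih =>
      intro hk
      -- Otherwise the current error dominates all earlier ones, and bounds the noise up to step `k`.
      by_contra! hlt
      set e := ∫ w, ‖ys - y w (k + 1)‖ ^ 2 ∂μ with he
      have hb : ∀ t ≤ k, ∫ w, ‖o.lagrNoise f₀' f' (x w t) (y w (t + 1)) (ξ t w)‖ ^ 2 ∂μ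
          ≤ 2 * c.σ₀ ^ 2 + 4 * c.σNorm ^ 2 * ‖ys‖ ^ 2 + 4 * c.σNorm ^ 2 * e := by
        intro t ht
        refine (h.integral_lagrNoise_sq_le_dual_error ys (by omega)).trans ?_
        rcases ht.lt_or_eq with ht | rfl
        · linarith [ih t ht (by omega)]
        · exact le_rfl
      have h1 := h.integralLE_pathMajorant hK.pos hs.mem_X hk hb ‖ys‖
      have h2 := h.integral_inner_weightedNoise (n := k + 1) hk ys
      have h3 := h.integrable_dual_error ys (t := k + 1) hk
      have h4 := integral_mono_ae (h3.const_mul (c.γ (k + 1) * dualStep K (k + 1) / 4))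
        (h1.1.sub h2.1) (by
          filter_upwards [hd] with w hw
          have hp := h.path_le hs hK hw hs.nonneg le_rfl hk
          have hsum : 0 ≤ ∑ t ∈ Finset.range (k + 1), c.γ t * (p.ψ₀ (x w (t + 1)) - p.ψ₀ xs
              + inner ℝ ys (p.ψ (x w (t + 1)))) := Finset.sum_nonneg fun t ht =>
            mul_nonneg (c.γ_pos t).le (hs.obj_add_inner_nonneg (h.mem_X (by
              have := Finset.mem_range.1 ht; omega) w))
          have hW := mul_nonneg (mul_nonneg (c.γ_pos (k + 1)).le (c.η_pos (k + 1)).le)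
            (d.W_nonneg (h.mem_X (t := k + 1) hk w) hs.mem_X)
          simp only [Pi.sub_apply]
          linarith)
      simp only [Pi.sub_apply] at h4
      rw [integral_const_mul, integral_sub h1.1 h2.1, h2.2, sub_zero] at h4
      exact absurd (hK.dual_error_le hk
        (integral_nonneg fun w => sq_nonneg _) (h4.trans h1.2))
        (not_le.2 hlt)
  intro k hk
  exact (h.integral_lagrNoise_sq_le_dual_error ys hk).trans (add_le_add_right (key k hk) _)

end StochasticRun

end ConEx

namespace ConEx

/-! ### The constants of the final bounds and the scale of the dual steps -/

namespace Constants

variable {m : ℕ} {c : Constants m}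

/-- The noise bound resulting from the dual error is at most `ζ²`, because `(2 e)² ≥ 25`. -/
theorem ζ_sq_ge {D N n : ℝ} (hn : 0 ≤ n) (hn' : n ≤ c.calH D N) :
    2 * c.σ₀ ^ 2 + 4 * c.σNorm ^ 2 * N ^ 2 + (c.σ₀ ^ 2
        + (13 * (c.t₀ + 2) + 2) * c.σNorm ^ 2 * N ^ 2
        + 1584 * (c.t₀ + 2) * c.B ^ 2 * c.σNorm ^ 2 + n ^ 2 / 2
        + 24 * (c.α₀ * c.B * c.σX D * Real.sqrt (c.t₀ + 2) ^ 3)) ≤ c.ζ D N ^ 2 := by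
  have hα := c.α₀_pos
  have hB := c.one_le_B
  have ht := c.two_le_t₀
  have hX := c.σX_nonneg D
  have h2 : n ^ 2 ≤ c.calH D N ^ 2 := pow_le_pow_left₀ hn hn' 2
  have hs : 0 ≤ c.α₀ * c.B * c.σX D * Real.sqrt (c.t₀ + 2) ^ 3 := by positivity
  have h4 : 0 ≤ c.σNorm ^ 2 * N ^ 2 := by positivity
  have h5 : 0 ≤ (c.t₀ + 2) * (c.σNorm ^ 2 * N ^ 2) := by positivity
  have h6 : 0 ≤ (c.t₀ + 2) * c.B ^ 2 * c.σNorm ^ 2 := by positivity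
  have he : (5 / 2 : ℝ) ≤ Real.exp 1 := by linarith [Real.exp_one_gt_d9]
  have he2 : (25 : ℝ) ≤ (2 * Real.exp 1) ^ 2 := by nlinarith
  unfold ζ
  rw [rpow_three_halves (by linarith), mul_pow, Real.sq_sqrt (by positivity)]
  refine le_trans ?_ (mul_le_mul_of_nonneg_right he2 (by positivity))
  nlinarith [sq_nonneg c.σ₀]

/-- The sum of the three quantities whose maximum is the scale of the dual stepsizes. -/
noncomputable def dualScaleSum (c : Constants m) (D : ℝ) (T : ℕ) : ℝ :=
  32 * c.calM ^ 2 / c.α₀ + 384 * c.σNorm ^ 2 * T / c.α₀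
    + c.σX D * Real.sqrt T ^ 3 / (c.B * Real.sqrt (c.t₀ + 2))

/-- The bound for the expectation, divided by the sum of the weights `γ_t`.  The parameter `ε` is the
excess of the scale `K` over the scale of the method. -/
theorem IsDualScale.meanMajorant_le {D K b ε R : ℝ} {k : ℕ} (h : c.IsDualScale D (k + 1) K)
    (hK : K ≤ c.dualScaleSum D (k + 1) + ε) (hε : 0 ≤ ε) (hb : 0 ≤ b) :
    c.meanMajorant D K b k R ≤ (∑ t ∈ Finset.range (k + 1), c.γ t) *
      (c.α₀ * (c.t₀ + 1) * (c.t₀ + 2) * D ^ 2 / ((k + 1 : ℕ) : ℝ) ^ 2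
        + (c.t₀ + 2) * R ^ 2 * (32 * c.calM ^ 2 / (c.α₀ * ((k + 1 : ℕ) : ℝ) ^ 2)
          + 386 * c.σNorm ^ 2 / (c.α₀ * (k + 1 : ℕ)) + ε)
        + Real.sqrt (c.t₀ + 2) * c.σX D * R ^ 2 / (c.B * Real.sqrt (k + 1 : ℕ))
        + 16 * (b + c.nonsmooth D R ^ 2) / (c.α₀ * (k + 1 : ℕ))
        + 12 * c.B * c.σX D * (c.t₀ + 1) * Real.sqrt (c.t₀ + 2) / Real.sqrt (k + 1 : ℕ) ^ 3
        + 8 * c.B * Real.sqrt (c.t₀ + 2) * c.σX D / Real.sqrt (k + 1 : ℕ)) := by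
  have hα := c.α₀_pos
  have hB := c.one_le_B
  have ht := c.two_le_t₀
  have hKp := h.pos
  have hσX := h.σX_mul_le
  have hX0 := c.σX_nonneg D
  have hΓ := c.sum_γ (k + 1)
  have hx := Constants.extrapNoise_const_le (c := c) hKp (sq_nonneg (c.σX D)) k
  have hw := c.extrapWeight_le k
  have hW0 := extrapWeight_nonneg (c := c) k
  unfold meanMajorant
  unfold dualScaleSum at hK
  set r := Real.sqrt (c.t₀ + 2) with hr
  have hr0 : 0 < r := Real.sqrt_pos.2 (by linarith)
  have hr2 : r ^ 2 = c.t₀ + 2 := Real.sq_sqrt (by linarith)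
  have hT1 : (1 : ℝ) ≤ (k + 1 : ℕ) := by exact_mod_cast Nat.succ_pos k
  have hkT : (k : ℝ) + 1 = (k + 1 : ℕ) := by push_cast; rfl
  rw [hkT] at hw ⊢
  generalize ((k + 1 : ℕ) : ℝ) = t at *
  set Q := Real.sqrt t with hQ
  have hQ2 : Q ^ 2 = t := Real.sq_sqrt (by linarith)
  have hQ0 : 0 < Q := Real.sqrt_pos.2 (by linarith)
  generalize c.σX D = X at *
  generalize c.nonsmooth D R = H at *
  generalize c.extrapNoise K (fun _ => X ^ 2) k = Z at *
  generalize c.extrapWeight k = W at *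
  generalize (∑ t ∈ Finset.range (k + 1), c.γ t) = Γ at *
  clear_value r Q
  have hΓt : t ^ 2 / 2 ≤ Γ := by rw [hΓ]; nlinarith
  have hΓp : 0 < Γ := lt_of_lt_of_le (by positivity) hΓt
  have hΓ1 : 1 ≤ Γ * (2 / t ^ 2) := by
    rw [mul_div_assoc', le_div_iff₀ (by positivity)]; linarith
  have hΓ2 : t ≤ Γ * (2 / t) := by
    rw [mul_div_assoc', le_div_iff₀ (by positivity)]; linarith
  have hΓ3 : 1 ≤ Γ * (2 / t) := hT1.trans hΓ2
  have b1 : c.α₀ * (c.t₀ + 1) * (c.t₀ + 2) * D ^ 2 / 2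
      ≤ Γ * (c.α₀ * (c.t₀ + 1) * (c.t₀ + 2) * D ^ 2 / t ^ 2) := by
    have := mul_le_mul_of_nonneg_left hΓ1
      (show 0 ≤ c.α₀ * (c.t₀ + 1) * (c.t₀ + 2) * D ^ 2 / 2 by positivity)
    refine le_trans (le_of_eq ?_) (this.trans (le_of_eq ?_))
    · ring
    · ring
  have b2 : (c.t₀ + 2) * K / 2 * R ^ 2 ≤ Γ * ((c.t₀ + 2) * R ^ 2 *
      (32 * c.calM ^ 2 / (c.α₀ * t ^ 2) + 384 * c.σNorm ^ 2 / (c.α₀ * t) + ε)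
        + r * X * R ^ 2 / (c.B * Q)) := by
    have e1 : (32 * c.calM ^ 2 / c.α₀ + 384 * c.σNorm ^ 2 * t / c.α₀ + X * Q ^ 3 / (c.B * r) + ε)
        ≤ Γ * 2 * (32 * c.calM ^ 2 / (c.α₀ * t ^ 2) + 384 * c.σNorm ^ 2 / (c.α₀ * t)
          + X / (c.B * r * Q) + ε) := by
      have e2 : 0 ≤ Γ * 2 / t ^ 2 - 1 := by rw [mul_div_assoc]; linarith
      have e3 : 1 ≤ Γ * 2 := by nlinarith
      have e4 := mul_le_mul_of_nonneg_right hΓ1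
        (show 0 ≤ 32 * c.calM ^ 2 / c.α₀ + 384 * c.σNorm ^ 2 * t / c.α₀ + X * Q ^ 3 / (c.B * r)
          by positivity)
      have e5 := mul_le_mul_of_nonneg_right e3 hε
      have e6 : Γ * (2 / t ^ 2) * (32 * c.calM ^ 2 / c.α₀ + 384 * c.σNorm ^ 2 * t / c.α₀
          + X * Q ^ 3 / (c.B * r)) = Γ * 2 * (32 * c.calM ^ 2 / (c.α₀ * t ^ 2)
            + 384 * c.σNorm ^ 2 / (c.α₀ * t) + X / (c.B * r * Q)) := by
        rw [← hQ2]; field_simp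
      linarith only [e4, e5, e6]
    have e7 := mul_le_mul_of_nonneg_left (hK.trans e1)
      (show 0 ≤ (c.t₀ + 2) / 2 * R ^ 2 by positivity)
    refine le_trans (le_of_eq ?_) (e7.trans (le_of_eq ?_))
    · ring
    · rw [← hr2]; field_simp; ring
  have b3 : 8 / c.α₀ * (t * H ^ 2) ≤ Γ * (16 * H ^ 2 / (c.α₀ * t)) := by
    have := mul_le_mul_of_nonneg_left hΓ2 (show 0 ≤ 8 / c.α₀ * H ^ 2 by positivity)
    refine le_trans (le_of_eq ?_) (this.trans (le_of_eq ?_))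
    · ring
    · field_simp; ring
  have b4 : 8 / c.α₀ * (t * b) ≤ Γ * (16 * b / (c.α₀ * t)) := by
    have := mul_le_mul_of_nonneg_left hΓ2 (show 0 ≤ 8 / c.α₀ * b by positivity)
    refine le_trans (le_of_eq ?_) (this.trans (le_of_eq ?_))
    · ring
    · field_simp; ring
  have b5 : (c.t₀ + 2) * R ^ 2 / c.α₀ * c.σNorm ^ 2
      ≤ Γ * ((c.t₀ + 2) * R ^ 2 * (2 * c.σNorm ^ 2 / (c.α₀ * t))) := by
    have := mul_le_mul_of_nonneg_left hΓ3
      (show 0 ≤ (c.t₀ + 2) * R ^ 2 / c.α₀ * c.σNorm ^ 2 by positivity)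
    refine le_trans (le_of_eq ?_) (this.trans (le_of_eq ?_))
    · ring
    · field_simp
  have b6 : Z ≤ Γ * (12 * c.B * X * (c.t₀ + 1) * r / Q ^ 3 + 8 * c.B * r * X / Q) := by
    have e1 : X ^ 2 / K ≤ c.B * X * r / Q ^ 3 := by
      rw [div_le_div_iff₀ hKp (by positivity)]
      have := mul_le_mul_of_nonneg_left hσX hX0
      linarith only [this]
    have e2 := mul_le_mul e1 hw hW0 (by positivity)
    refine hx.trans (e2.trans (le_of_eq ?_))
    rw [← hQ2]
    field_simp
  refine le_trans (add_le_add (add_le_add (add_le_add (add_le_add b1 b2) b3) b5)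
    (add_le_add b4 b6)) (le_of_eq ?_)
  ring

end Constants

section DualScale

variable {E : Type*} [NormedAddCommGroup E] [NormedSpace ℝ E]
  [MeasurableSpace E] [BorelSpace E] {S : Type*} [MeasurableSpace S] {m : ℕ}
  {Ω : Type*} [mΩ : MeasurableSpace Ω]
  [FiniteDimensional ℝ E] {μ : Measure Ω} [IsProbabilityMeasure μ] {P : Measure S}
  [IsProbabilityMeasure P] {p : Problem E m} {d : DistGen p.X}
  {c : Constants m} {o : Oracle E m S} {f₀' : E → StrongDual ℝ E}
  {f' : Fin m → E → StrongDual ℝ E} {τ : ℕ → ℝ} {T : ℕ} {x₀ : E} {ξ ξbar : ℕ → Ω → S}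
  {x : Ω → ℕ → E} {y : Ω → ℕ → Vec m}

theorem mkVec_eq_zero {a : Fin m → ℝ} (h : ‖mkVec a‖ = 0) (i : Fin m) : a i = 0 := by
  have h1 : mkVec a = 0 := norm_eq_zero.1 h
  have h2 : mkVec a i = (0 : Vec m) i := by rw [h1]
  simpa [mkVec] using h2

namespace StochasticRun

/-- If the noise and the Lipschitz constants of the constraints vanish, then the stochastic
linearizations of the constraints coincide with the constant value of the constraints. -/
theorem linF_eq_of_degenerate (h : StochasticRun μ P p d c o f₀' f' τ T x₀ ξ ξbar x y)
    (hM : c.calM = 0) (hσ : c.σX d.diam = 0) {xs : E} (hxs : xs ∈ p.X) :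
    ∀ᵐ w ∂μ, ∀ t < T, p.χVec (x w t) + o.linF (x w) (fun s => ξbar s w) t = p.ψ xs := by
  have hMf : c.MfAgg = 0 := le_antisymm (by
    have := le_max_left (2 * c.MfAgg) (c.MχAgg + c.MfAgg)
    rw [← Constants.calM, hM] at this; linarith) (norm_nonneg _)
  have hMχ : c.MχAgg = 0 := le_antisymm (by
    have := le_max_right (2 * c.MfAgg) (c.MχAgg + c.MfAgg)
    rw [← Constants.calM, hM] at this; linarith) (norm_nonneg _)
  have hf : ∀ i, ∀ a ∈ p.X, p.f i a = p.f i xs := fun i a ha => by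
    have h1 := h.regular.lip_f i a ha xs hxs
    have h2 := h.regular.lip_f i xs hxs a ha
    rw [mkVec_eq_zero hMf i, zero_mul] at h1 h2
    linarith
  have hχ : ∀ i, ∀ a ∈ p.X, p.χ i a = p.χ i xs := fun i a ha => by
    have h1 := h.regular.lip_χ i a ha xs hxs
    have h2 := h.regular.lip_χ i xs hxs a ha
    rw [mkVec_eq_zero hMχ i, zero_mul] at h1 h2
    linarith
  have hfV : ∀ a ∈ p.X, p.fVec a = p.fVec xs := fun a ha => by
    unfold Problem.fVec; congr 1; funext i; exact hf i a ha
  have hχV : ∀ a ∈ p.X, p.χVec a = p.χVec xs := fun a ha => by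
    unfold Problem.χVec; congr 1; funext i; exact hχ i a ha
  have hψ : p.ψ xs = p.χVec xs + p.fVec xs := by
    ext i; simp [Problem.ψ, Problem.χVec, Problem.fVec, mkVec, add_comm]
  have hz : ∀ᵐ w ∂μ, ∀ t < T, o.noiseSq p f' d.diam (x w t) (ξbar t w) = 0 := by
    refine ae_all_iff.2 fun t => ?_
    by_cases ht : t < T
    swap
    · exact ae_of_all _ fun w h => absurd h ht
    have h1 := h.integrable_noiseSq ht
    have h2 := (integral_eq_zero_iff_of_nonneg (fun w => o.noiseSq_nonneg p f' d.diam _ _) h1.1).1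
      (le_antisymm (by simpa [hσ] using h1.2)
        (integral_nonneg fun w => o.noiseSq_nonneg p f' d.diam _ _))
    filter_upwards [h2] with w hw _
    exact hw
  filter_upwards [hz] with w hw t ht
  have hlin : ∀ t < T, ∀ a : E, ‖a‖ ≤ d.diam → o.linNoise p f' (x w t) a (ξbar t w) = 0 := by
    intro t ht a ha
    have := o.norm_linNoise_sq_le p f' (x w t) ha (ξbar t w)
    rw [hw t ht, mul_zero] at this
    exact norm_eq_zero.1 (pow_eq_zero_iff two_ne_zero |>.1 (le_antisymm this (sq_nonneg _)))
  rw [hχV _ (h.mem_X ht.le w), hψ]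
  congr 1
  cases t with
  | zero =>
    have h1 := hlin 0 ht 0 (by simpa using d.diam_nonneg)
    have e : o.linF (x w) (fun s => ξbar s w) 0
        = p.fVec (x w 0) + o.linNoise p f' (x w 0) 0 (ξbar 0 w) := by
      ext i
      simp [Oracle.linF, Oracle.linNoise, Oracle.valueNoise, applyVec, mkVec]
    rw [e, h1, add_zero, hfV _ (h.mem_X ht.le w)]
  | succ t =>
    have hxt := h.mem_X (t := t) (by omega) w
    have hxt' := h.mem_X ht.le w
    rw [o.linF_succ p f', hlin t (by omega) _ (d.norm_sub_le_diam h.convex.compact_X hxt hxt'),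
      hfV _ hxt, add_zero]
    have : applyVec (fun i => f' i (x w t)) (x w (t + 1) - x w t) = 0 := by
      ext i
      have h2 := abs_le_of_mem_subdiff (h.regular.lip_f i) (h.oracle.mem_f' i _ hxt) hxt'
      rw [mkVec_eq_zero hMf i, zero_mul] at h2
      simpa [applyVec, mkVec] using h2
    rw [this, add_zero]

/-- There is a scale for the dual steps that is arbitrarily close to the one of the method.  It is
the scale of the method itself unless the latter is zero; in that case all dual iterates vanish,
the constraints are constant and free of noise, and every positive scale is admissible. -/
theorem exists_dualScale
    (h : StochasticRun μ P p d c o f₀' f' (c.τ d.diam T) T x₀ ξ ξbar x y) (hT : 1 ≤ T)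
    {xs : E} {ys : Vec m} (hs : p.IsSaddlePoint xs ys) {ε : ℝ} (hε : 0 < ε) :
    ∃ K, c.IsDualScale d.diam T K ∧ K ≤ c.dualScaleSum d.diam T + ε ∧
      ∀ᵐ w ∂μ, DualSteps p c o K T (fun t => ξbar t w) (x w) (y w) := by
  have hα := c.α₀_pos
  have hB := c.one_le_B
  have ht₀ := c.two_le_t₀
  have hX := c.σX_nonneg d.diam
  have hT' : (1 : ℝ) ≤ T := by exact_mod_cast hT
  have hQ : 0 < Real.sqrt T := Real.sqrt_pos.2 (by linarith)
  have hr : 0 < Real.sqrt (c.t₀ + 2) := Real.sqrt_pos.2 (by linarith)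
  set K₀ := max (max (32 * c.calM ^ 2 / c.α₀) (384 * c.σNorm ^ 2 * T / c.α₀))
      (c.σX d.diam * (T : ℝ) ^ (3 / 2 : ℝ) / (c.B * Real.sqrt (c.t₀ + 2))) with hK₀
  have h1 : 32 * c.calM ^ 2 / c.α₀ ≤ K₀ := (le_max_left _ _).trans (le_max_left _ _)
  have h2 : 384 * c.σNorm ^ 2 * T / c.α₀ ≤ K₀ := (le_max_right _ _).trans (le_max_left _ _)
  have h3 : c.σX d.diam * (T : ℝ) ^ (3 / 2 : ℝ) / (c.B * Real.sqrt (c.t₀ + 2)) ≤ K₀ :=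
    le_max_right _ _
  have hτ : ∀ t, c.τ d.diam T t = dualStep K₀ t := fun t => by
    unfold Constants.τ dualStep; rw [← hK₀]; ring
  have p1 : 0 ≤ 32 * c.calM ^ 2 / c.α₀ := by positivity
  have p2 : 0 ≤ 384 * c.σNorm ^ 2 * T / c.α₀ := by positivity
  have p3 : 0 ≤ c.σX d.diam * (T : ℝ) ^ (3 / 2 : ℝ) / (c.B * Real.sqrt (c.t₀ + 2)) := by positivity
  have hle : K₀ ≤ c.dualScaleSum d.diam T := by
    unfold Constants.dualScaleSum
    rw [← Constants.rpow_three_halves (by linarith)]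
    exact max_le (max_le (by linarith) (by linarith)) (by linarith)
  rcases (p1.trans h1).lt_or_eq with hpos | hzero
  · refine ⟨K₀, ⟨hpos, h1, h2, h3⟩, by linarith, ae_of_all _ fun w Y hY t ht => ?_⟩
    rw [(h.run w).y_step t ht, hτ]
    exact inner_dual_step_le (div_pos hpos (by positivity)) _ _ hY
  · rw [← hzero] at h1 h2 h3 hτ hle
    have hM : c.calM = 0 := by
      have : 32 * c.calM ^ 2 / c.α₀ = 0 := le_antisymm h1 p1
      simpa [hα.ne'] using this
    have hX0 : c.σX d.diam = 0 := by
      have := le_antisymm h3 p3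
      rw [Constants.rpow_three_halves (by linarith)] at this
      rcases div_eq_zero_iff.1 this with h4 | h4
      · exact (mul_eq_zero.1 h4).resolve_right (by positivity)
      · exact absurd h4 (by positivity)
    have hy : ∀ w, ∀ t ≤ T, y w t = 0 := by
      intro w t
      induction t with
      | zero => exact fun _ => (h.run w).y_zero
      | succ t ih =>
        intro ht
        rw [(h.run w).y_step t ht, hτ, ih (by omega)]
        ext i
        simp [dualStep, posVec, mkVec]
    refine ⟨ε, ⟨hε, h1.trans hε.le, h2.trans hε.le, h3.trans hε.le⟩, by linarith, ?_⟩
    filter_upwards [h.linF_eq_of_degenerate hM hX0 hs.mem_X] with w hw Y hY t ht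
    have he : o.extrap p c.θ (x w) (fun s => ξbar s w) t = p.ψ xs := by
      cases t with
      | zero => simp only [Oracle.extrap]; rw [hw 0 ht, ← sub_smul]; simp
      | succ t =>
        simp only [Oracle.extrap]; rw [hw _ ht, hw t (by omega), ← sub_smul]; simp
    rw [he, hy w _ ht, hy w t ht.le]
    simpa using hs.inner_nonpos hY

end StochasticRun

end DualScale

end ConEx

namespace ConEx

/-! ### Expectation bounds for the averaged and the last iterate -/

section Final

variable {E : Type*} [NormedAddCommGroup E] [NormedSpace ℝ E]
  [MeasurableSpace E] [BorelSpace E] {S : Type*} [MeasurableSpace S] {m : ℕ}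
  {Ω : Type*} [mΩ : MeasurableSpace Ω]
  [FiniteDimensional ℝ E] {μ : Measure Ω} [IsProbabilityMeasure μ] {P : Measure S}
  [IsProbabilityMeasure P] {p : Problem E m} {d : DistGen p.X}
  {c : Constants m} {o : Oracle E m S} {f₀' : E → StrongDual ℝ E}
  {f' : Fin m → E → StrongDual ℝ E} {τ : ℕ → ℝ} {T : ℕ} {x₀ : E} {ξ ξbar : ℕ → Ω → S}
  {x : Ω → ℕ → E} {y : Ω → ℕ → Vec m}

omit [IsProbabilityMeasure μ] in
theorem IntegralLE.of_le_of_le {f g l : Ω → ℝ} {a : ℝ} (hg : IntegralLE μ g a)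
    (hl : Integrable l μ) (hf : Measurable f) (h1 : ∀ᵐ w ∂μ, l w ≤ f w)
    (h2 : ∀ᵐ w ∂μ, f w ≤ g w) : IntegralLE μ f a := by
  have hi : Integrable f μ := integrable_of_le_of_le hf.aestronglyMeasurable h1 h2 hl hg.1
  exact ⟨hi, (integral_mono_ae hi hg.1 h2).trans hg.2⟩

/-- The first moment is bounded through the second one. -/
theorem integralLE_of_sq {f : Ω → ℝ} {V : ℝ} (hf : Measurable f) (hV : 0 ≤ V)
    (h : IntegralLE μ (fun w => f w ^ 2) (V ^ 2)) : IntegralLE μ f V := by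
  have h1 : MemLp f 2 μ := (memLp_two_iff_integrable_sq hf.aestronglyMeasurable).2 h.1
  have hi : Integrable f μ := h1.integrable (by norm_num)
  refine ⟨hi, abs_le_of_sq_le_sq' ?_ hV |>.2⟩
  refine le_trans ?_ h.2
  set a := ∫ w, f w ∂μ with ha
  have h2 : 0 ≤ ∫ w, (f w ^ 2 + (-2 * a * f w + a ^ 2)) ∂μ :=
    integral_nonneg fun w => by
      have := sq_nonneg (f w - a)
      simp only [Pi.zero_apply]
      linarith
  have i1 : Integrable (fun w => -2 * a * f w) μ := hi.const_mul _
  have i2 : Integrable (fun w => -2 * a * f w + a ^ 2) μ := i1.add (integrable_const _)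
  have h3 := integral_add h.1 i2
  have h4 := integral_add i1 (integrable_const (a ^ 2))
  have h5 : ∫ w, -2 * a * f w ∂μ = -2 * a * a := integral_const_mul _ _
  simp only [integral_const, probReal_univ, one_smul] at h4
  rw [h3, h4, h5] at h2
  linarith

omit [MeasurableSpace E] [BorelSpace E] [FiniteDimensional ℝ E] in
theorem Problem.IsConvex.convexOn_lagrangian (hp : p.IsConvex) (v : ℝ) {Y : Vec m}
    (hY : ∀ i, 0 ≤ Y i) : ConvexOn ℝ p.X fun z => p.ψ₀ z - v + inner ℝ Y (p.ψ z) := by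
  have h1 : ConvexOn ℝ p.X fun z => ∑ i, Y i * (p.f i z + p.χ i z) := by
    refine ⟨hp.convex_X, fun a ha b hb s t hs ht hst => ?_⟩
    simp only [smul_eq_mul, Finset.mul_sum, ← Finset.sum_add_distrib]
    refine Finset.sum_le_sum fun i _ => ?_
    have := mul_le_mul_of_nonneg_left (((hp.convex_f i).add (hp.convex_χ i)).2 ha hb hs ht hst)
      (hY i)
    simp only [Pi.add_apply, smul_eq_mul] at this
    linarith
  have h2 := ((hp.convex_f₀.add hp.convex_χ₀).add_const (-v)).add h1
  refine h2.congr fun z _ => ?_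
  simp [Problem.ψ₀, sub_eq_add_neg, ← sum_mul_eq_inner, Problem.ψ, mkVec]

theorem Constants.sum_γ_pos (c : Constants m) (k : ℕ) : 0 < ∑ t ∈ Finset.range (k + 1), c.γ t :=
  Finset.sum_pos (fun t _ => c.γ_pos t) ⟨0, by simp⟩

namespace StochasticRun

omit [FiniteDimensional ℝ E] [IsProbabilityMeasure μ] [IsProbabilityMeasure P] in
theorem avgIterate_mem {k : ℕ}
    (h : StochasticRun μ P p d c o f₀' f' τ (k + 1) x₀ ξ ξbar x y) (w : Ω) :
    avgIterate c.γ (k + 1) (x w) ∈ p.X :=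
  h.convex.convex_X.centerMass_mem (fun t _ => (c.γ_pos t).le) (c.sum_γ_pos k)
    fun t ht => h.mem_X (by have := Finset.mem_range.1 ht; omega) w

omit [FiniteDimensional ℝ E] [IsProbabilityMeasure μ] [IsProbabilityMeasure P] in
theorem avgIterate_jensen {k : ℕ}
    (h : StochasticRun μ P p d c o f₀' f' τ (k + 1) x₀ ξ ξbar x y) (w : Ω) (v : ℝ) {Y : Vec m}
    (hY : ∀ i, 0 ≤ Y i) :
    (∑ t ∈ Finset.range (k + 1), c.γ t) * (p.ψ₀ (avgIterate c.γ (k + 1) (x w)) - v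
        + inner ℝ Y (p.ψ (avgIterate c.γ (k + 1) (x w))))
      ≤ ∑ t ∈ Finset.range (k + 1), c.γ t * (p.ψ₀ (x w (t + 1)) - v
          + inner ℝ Y (p.ψ (x w (t + 1)))) := by
  have h1 := (h.convex.convexOn_lagrangian v hY).map_centerMass_le (t := Finset.range (k + 1))
    (w := c.γ) (p := fun t => x w (t + 1)) (fun t _ => (c.γ_pos t).le) (c.sum_γ_pos k)
    fun t ht => h.mem_X (by have := Finset.mem_range.1 ht; omega) w
  have h2 := mul_le_mul_of_nonneg_left h1 (c.sum_γ_pos k).le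
  rw [Finset.centerMass, Finset.centerMass] at h2
  simp only [smul_eq_mul, Function.comp_apply, mul_inv_cancel_left₀ (c.sum_γ_pos k).ne'] at h2
  exact h2

omit [IsProbabilityMeasure μ] [IsProbabilityMeasure P] in
/-- The bound along one trajectory for the averaged iterate. -/
theorem avgIterate_le {k : ℕ} (h : StochasticRun μ P p d c o f₀' f' τ (k + 1) x₀ ξ ξbar x y)
    {xs : E} {ys : Vec m} (hs : p.IsSaddlePoint xs ys) {K : ℝ}
    (hK : c.IsDualScale d.diam (k + 1) K) {w : Ω}
    (hd : DualSteps p c o K (k + 1) (fun t => ξbar t w) (x w) (y w)) {Y : Vec m}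
    (hY : ∀ i, 0 ≤ Y i) {R : ℝ} (hR : ‖Y‖ ≤ R) :
    (∑ t ∈ Finset.range (k + 1), c.γ t) * (p.ψ₀ (avgIterate c.γ (k + 1) (x w)) - p.ψ₀ xs
          + inner ℝ Y (p.ψ (avgIterate c.γ (k + 1) (x w))))
        + c.γ (k + 1) * c.η (k + 1) * d.W xs (x w (k + 1))
      ≤ pathMajorant p d c o f₀' f' K xs (fun t => ξ t w) (fun t => ξbar t w) (x w) (y w) k R
        - inner ℝ Y (weightedNoise p c o f' (fun t => ξbar t w) (x w) (k + 1)) := by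
  have h1 := h.path_le hs hK hd hY hR k.lt_succ_self
  have h2 := h.avgIterate_jensen w (p.ψ₀ xs) hY
  have h3 : 0 ≤ c.γ (k + 1) * dualStep K (k + 1) / 4 * ‖Y - y w (k + 1)‖ ^ 2 := by
    have := c.γ_pos (k + 1)
    have : 0 < dualStep K (k + 1) := div_pos hK.pos (by positivity)
    positivity
  linarith

omit [IsProbabilityMeasure μ] [IsProbabilityMeasure P] in
theorem measurable_avgIterate {k : ℕ}
    (h : StochasticRun μ P p d c o f₀' f' τ (k + 1) x₀ ξ ξbar x y) :
    Measurable fun w => avgIterate c.γ (k + 1) (x w) :=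
  (Finset.measurable_sum _ fun t ht => ((h.measurable (t := t + 1)
    (by have := Finset.mem_range.1 ht; omega)).1.const_smul (c.γ t))).const_smul _

omit [IsProbabilityMeasure μ] [IsProbabilityMeasure P] in
theorem measurable_ψ₀_avgIterate {k : ℕ}
    (h : StochasticRun μ P p d c o f₀' f' τ (k + 1) x₀ ξ ξbar x y) :
    Measurable fun w => p.ψ₀ (avgIterate c.γ (k + 1) (x w)) := by
  have h1 : Measurable (p.X.domRestrict p.χ₀) :=
    (lowerSemicontinuous_restrict_iff.2 h.convex.lsc_χ₀).measurable
  exact (measurable_comp_of_continuousOn h.convex.continuous_f₀ h.measurable_avgIterate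
    h.avgIterate_mem).add (h1.comp (h.measurable_avgIterate.subtype_mk (h := h.avgIterate_mem)))

omit [IsProbabilityMeasure μ] [IsProbabilityMeasure P] in
theorem measurable_ψ_avgIterate {k : ℕ}
    (h : StochasticRun μ P p d c o f₀' f' τ (k + 1) x₀ ξ ξbar x y) :
    Measurable fun w => p.ψ (avgIterate c.γ (k + 1) (x w)) :=
  measurable_mkVec fun i => measurable_comp_of_continuousOn
    ((h.convex.continuous_f i).add (h.convex.continuous_χ i)) h.measurable_avgIterate
    h.avgIterate_mem

theorem integralLE_norm_weightedNoise {k : ℕ}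
    (h : StochasticRun μ P p d c o f₀' f' τ (k + 1) x₀ ξ ξbar x y) :
    IntegralLE μ (fun w => ‖weightedNoise p c o f' (fun t => ξbar t w) (x w) (k + 1)‖)
      ((∑ t ∈ Finset.range (k + 1), c.γ t) * (3 * c.σX d.diam / Real.sqrt (k + 1 : ℕ))) := by
  have hX := c.σX_nonneg d.diam
  have ht := c.two_le_t₀
  have hΓ := c.sum_γ_pos k
  have hm : Measurable fun w => weightedNoise p c o f' (fun t => ξbar t w) (x w) (k + 1) := by
    refine Finset.measurable_sum _ fun t ht => ?_
    have ht : t < k + 1 := Finset.mem_range.1 ht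
    exact (h.oracle.measurable_linNoise (z := fun w => (⟨x w t, h.mem_X ht.le w⟩ : p.X))
      ((h.measurable ht.le).1.subtype_mk) (h.samples.measurable_ξbar t)
      ((h.measurable_others_step ht).mono (others_le h.samples _) le_rfl)).const_smul (c.γ t)
  refine integralLE_of_sq hm.norm (by positivity)
    ((h.integralLE_weightedNoise_sq (k + 1) le_rfl).mono ?_)
  have hn : (0 : ℝ) < (k + 1 : ℕ) := by positivity
  have h1 : ∑ t ∈ Finset.range (k + 1), c.γ t ^ 2 ≤ (k + 1 : ℕ) * c.γ k ^ 2 := by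
    have : ∀ t ∈ Finset.range (k + 1), c.γ t ^ 2 ≤ c.γ k ^ 2 := fun t ht => by
      have h2 : (t : ℝ) ≤ k := by exact_mod_cast Nat.lt_succ_iff.1 (Finset.mem_range.1 ht)
      refine pow_le_pow_left₀ (c.γ_pos t).le ?_ 2
      unfold Constants.γ
      linarith
    simpa using Finset.sum_le_sum this
  have h2 : (k + 1 : ℕ) * c.γ k ≤ 2 * ∑ t ∈ Finset.range (k + 1), c.γ t := by
    rw [c.sum_γ]
    unfold Constants.γ
    push_cast
    nlinarith [mul_nonneg (show (0 : ℝ) ≤ k + 1 by positivity) (show 0 ≤ c.t₀ by linarith)]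
  have h3 := pow_le_pow_left₀ (mul_nonneg hn.le (c.γ_pos k).le) h2 2
  rw [mul_pow, div_pow, Real.sq_sqrt hn.le, mul_div_assoc', le_div_iff₀ hn]
  generalize (∑ t ∈ Finset.range (k + 1), c.γ t) = Γ at *
  generalize ((k + 1 : ℕ) : ℝ) = n at *
  have h4 := mul_le_mul_of_nonneg_left h1 (show 0 ≤ 2 * c.σX d.diam ^ 2 * n by positivity)
  have h5 := mul_le_mul_of_nonneg_left h3 (show 0 ≤ 2 * c.σX d.diam ^ 2 by positivity)
  have h6 : 0 ≤ c.σX d.diam ^ 2 * Γ ^ 2 := by positivity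
  linarith

theorem integral_lagrNoise_sq_le_ζ {k : ℕ}
    (h : StochasticRun μ P p d c o f₀' f' τ (k + 1) x₀ ξ ξbar x y)
    {xs : E} {ys : Vec m} (hs : p.IsSaddlePoint xs ys) {K : ℝ}
    (hK : c.IsDualScale d.diam (k + 1) K)
    (hd : ∀ᵐ w ∂μ, DualSteps p c o K (k + 1) (fun t => ξbar t w) (x w) (y w)) :
    ∀ t ≤ k, ∫ w, ‖o.lagrNoise f₀' f' (x w t) (y w (t + 1)) (ξ t w)‖ ^ 2 ∂μ
      ≤ c.ζ d.diam ‖ys‖ ^ 2 := fun t ht =>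
  (h.integral_lagrNoise_sq_le hs hK hd t (by omega)).trans
    (Constants.ζ_sq_ge (c.nonsmooth_nonneg d.diam_nonneg (norm_nonneg ys))
      (c.nonsmooth_mono d.diam_nonneg (by linarith : ‖ys‖ ≤ ‖ys‖ + 1)))

theorem integralLE_ψ₀ {k : ℕ} (h : StochasticRun μ P p d c o f₀' f' τ (k + 1) x₀ ξ ξbar x y)
    {xs : E} {ys : Vec m} (hs : p.IsSaddlePoint xs ys) {K : ℝ}
    (hK : c.IsDualScale d.diam (k + 1) K)
    (hd : ∀ᵐ w ∂μ, DualSteps p c o K (k + 1) (fun t => ξbar t w) (x w) (y w)) :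
    IntegralLE μ (fun w => p.ψ₀ (avgIterate c.γ (k + 1) (x w)) - p.ψ₀ xs)
      ((∑ t ∈ Finset.range (k + 1), c.γ t)⁻¹ *
        c.meanMajorant d.diam K (c.ζ d.diam ‖ys‖ ^ 2) k 0) := by
  have hΓ := c.sum_γ_pos k
  have hM := h.integralLE_pathMajorant hK.pos hs.mem_X k.lt_succ_self
    (h.integral_lagrNoise_sq_le_ζ hs hK hd) 0
  obtain ⟨C, hC⟩ := h.convex.compact_X.exists_bound_of_continuousOn (f := p.ψ)
    (continuousOn_mkVec fun i => (h.convex.continuous_f i).add (h.convex.continuous_χ i))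
  refine (hM.const_mul (inv_nonneg.2 hΓ.le)).of_le_of_le (l := fun _ => -(‖ys‖ * C))
    (integrable_const _) (h.measurable_ψ₀_avgIterate.sub_const _) (ae_of_all _ fun w => ?_) ?_
  · have h1 := hs.obj_add_inner_nonneg (h.avgIterate_mem w)
    have h2 := (real_inner_le_norm ys (p.ψ (avgIterate c.γ (k + 1) (x w)))).trans
      (mul_le_mul_of_nonneg_left (hC _ (h.avgIterate_mem w)) (norm_nonneg _))
    linarith
  · filter_upwards [hd] with w hw
    have h1 := h.avgIterate_le hs hK hw (Y := 0) (fun i => le_rfl) (R := 0) (by simp)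
    have h2 := mul_nonneg (mul_nonneg (c.γ_pos (k + 1)).le (c.η_pos (k + 1)).le)
      (d.W_nonneg (h.mem_X (t := k + 1) le_rfl w) hs.mem_X)
    rw [inner_zero_left, inner_zero_left, add_zero, sub_zero] at h1
    rw [inv_mul_eq_div, le_div_iff₀ hΓ]
    linarith

theorem integralLE_infeasibility {k : ℕ}
    (h : StochasticRun μ P p d c o f₀' f' τ (k + 1) x₀ ξ ξbar x y)
    {xs : E} {ys : Vec m} (hs : p.IsSaddlePoint xs ys) {K : ℝ}
    (hK : c.IsDualScale d.diam (k + 1) K)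
    (hd : ∀ᵐ w ∂μ, DualSteps p c o K (k + 1) (fun t => ξbar t w) (x w) (y w)) :
    IntegralLE μ (fun w => ‖posVec (p.ψ (avgIterate c.γ (k + 1) (x w)))‖)
      ((∑ t ∈ Finset.range (k + 1), c.γ t)⁻¹ *
        (c.meanMajorant d.diam K (c.ζ d.diam ‖ys‖ ^ 2) k (‖ys‖ + 1) + (‖ys‖ + 1) *
          ((∑ t ∈ Finset.range (k + 1), c.γ t)
            * (3 * c.σX d.diam / Real.sqrt (k + 1 : ℕ))))) := by
  have hΓ := c.sum_γ_pos k
  have hN : 0 ≤ ‖ys‖ + 1 := by positivity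
  have hM := (h.integralLE_pathMajorant hK.pos hs.mem_X k.lt_succ_self
    (h.integral_lagrNoise_sq_le_ζ hs hK hd) (‖ys‖ + 1)).add
      (h.integralLE_norm_weightedNoise.const_mul hN)
  refine (hM.const_mul (inv_nonneg.2 hΓ.le)).of_le_of_le (l := fun _ => 0)
    (integrable_const _) (measurable_posVec h.measurable_ψ_avgIterate).norm
    (ae_of_all _ fun w => norm_nonneg _) ?_
  filter_upwards [hd] with w hw
  set u := posVec (p.ψ (avgIterate c.γ (k + 1) (x w))) with hu
  -- the dual reference point in the direction of the violated constraints
  set Y : Vec m := ((‖ys‖ + 1) / ‖u‖) • u with hYdef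
  have hY : ∀ i, 0 ≤ Y i := fun i =>
    mul_nonneg (by positivity) (posVec_nonneg (p.ψ (avgIterate c.γ (k + 1) (x w))) i)
  have hR : ‖Y‖ ≤ ‖ys‖ + 1 := by
    rw [hYdef, norm_smul, Real.norm_of_nonneg (by positivity)]
    rcases eq_or_ne ‖u‖ 0 with h0 | h0
    · simpa [h0] using hN
    · rw [div_mul_cancel₀ _ h0]
  have hin : inner ℝ Y (p.ψ (avgIterate c.γ (k + 1) (x w))) = (‖ys‖ + 1) * ‖u‖ := by
    rw [hYdef, real_inner_smul_left, inner_posVec_self, ← hu]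
    rcases eq_or_ne ‖u‖ 0 with h0 | h0
    · simp [h0]
    · field_simp
  have h1 := h.avgIterate_le hs hK hw hY hR
  have h2 := mul_nonneg (mul_nonneg (c.γ_pos (k + 1)).le (c.η_pos (k + 1)).le)
    (d.W_nonneg (h.mem_X (t := k + 1) le_rfl w) hs.mem_X)
  have h3 := hs.obj_add_inner_nonneg (h.avgIterate_mem w)
  have h4 := (inner_le_inner_posVec hs.nonneg (p.ψ (avgIterate c.γ (k + 1) (x w)))).trans
    (real_inner_le_norm _ _)
  rw [← hu] at h4
  have h5 := neg_le_of_abs_le (abs_real_inner_le_norm Y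
    (weightedNoise p c o f' (fun t => ξbar t w) (x w) (k + 1)))
  have h6 := mul_le_mul_of_nonneg_right hR
    (norm_nonneg (weightedNoise p c o f' (fun t => ξbar t w) (x w) (k + 1)))
  rw [hin] at h1
  -- the saddle point inequality gives `ψ₀(x̄) - ψ₀(x^*) ≥ -‖y^*‖ ‖u‖`
  have h7 : ‖u‖ ≤ p.ψ₀ (avgIterate c.γ (k + 1) (x w)) - p.ψ₀ xs + (‖ys‖ + 1) * ‖u‖ := by
    linarith
  have h8 := mul_le_mul_of_nonneg_left h7 hΓ.le
  rw [inv_mul_eq_div, le_div_iff₀ hΓ]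
  linarith

theorem integralLE_W {k : ℕ} (h : StochasticRun μ P p d c o f₀' f' τ (k + 1) x₀ ξ ξbar x y)
    {xs : E} {ys : Vec m} (hs : p.IsSaddlePoint xs ys) {K : ℝ}
    (hK : c.IsDualScale d.diam (k + 1) K)
    (hd : ∀ᵐ w ∂μ, DualSteps p c o K (k + 1) (fun t => ξbar t w) (x w) (y w)) :
    IntegralLE μ (fun w => d.W xs (x w (k + 1)))
      ((c.α₀ * ∑ t ∈ Finset.range (k + 1), c.γ t)⁻¹ *
        c.meanMajorant d.diam K (c.ζ d.diam ‖ys‖ ^ 2) k ‖ys‖) := by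
  have hΓ := c.sum_γ_pos k
  have hα := c.α₀_pos
  have hM := h.integralLE_pathMajorant hK.pos hs.mem_X k.lt_succ_self
    (h.integral_lagrNoise_sq_le_ζ hs hK hd) ‖ys‖
  have hN := h.integral_inner_weightedNoise (n := k + 1) le_rfl ys
  have hg := (hM.add (IntegralLE.of_eq_zero hN (-1))).const_mul
    (inv_nonneg.2 (mul_pos hα hΓ).le)
  rw [add_zero] at hg
  have hm : Measurable fun w => d.W xs (x w (k + 1)) :=
    measurable_comp_of_continuousOn (f := fun z => d.W xs z) (X := p.X)
      (d.continuousOn_W.comp (continuousOn_const.prodMk continuousOn_id)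
        fun z hz => ⟨hs.mem_X, hz⟩) (h.measurable le_rfl).1 (h.mem_X le_rfl)
  have hW := fun w => d.W_nonneg (h.mem_X (t := k + 1) le_rfl w) hs.mem_X
  refine hg.of_le_of_le (l := fun _ => 0) (integrable_const _) hm (ae_of_all _ hW) ?_
  filter_upwards [hd] with w hw
  have h1 := h.avgIterate_le hs hK hw hs.nonneg le_rfl
  have h2 := mul_nonneg hΓ.le (hs.obj_add_inner_nonneg (h.avgIterate_mem w))
  have h3 : c.α₀ * (∑ t ∈ Finset.range (k + 1), c.γ t) ≤ c.γ (k + 1) * c.η (k + 1) := by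
    rw [c.sum_γ]
    unfold Constants.γ Constants.η
    have := c.two_le_t₀
    rw [← sub_nonneg]
    push_cast
    have e : ((k : ℝ) + 1 + c.t₀ + 2) * (c.α₀ * ((k : ℝ) + 1 + c.t₀ + 1) / 2)
      - c.α₀ * (((k : ℝ) + 1) * ((k : ℝ) + 1 + 2 * c.t₀ + 3) / 2)
      = c.α₀ / 2 * ((c.t₀ + 1) * (c.t₀ + 2)) := by ring
    rw [e]
    positivity
  have h4 := mul_le_mul_of_nonneg_right h3 (hW w)
  rw [inv_mul_eq_div, le_div_iff₀ (mul_pos hα hΓ)]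
  linarith

end StochasticRun

end Final

end ConEx

/-! ### The convergence rates -/

namespace ConEx

/-- Passage to the limit in an arbitrarily small error, which will be the excess of the scale of the
dual steps. -/
theorem IntegralLE.of_forall_pos {Ω : Type*} [MeasurableSpace Ω] {μ : Measure Ω} {f : Ω → ℝ}
    {a C : ℝ} (hC : 0 ≤ C) (h : ∀ ε > 0, IntegralLE μ f (a + C * ε)) : IntegralLE μ f a := by
  refine ⟨(h 1 one_pos).1, le_of_forall_pos_le_add fun ε hε =>
    (h (ε / (C + 1)) (by positivity)).2.trans ?_⟩
  have : C * (ε / (C + 1)) ≤ ε := by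
    rw [mul_div_assoc', div_le_iff₀ (by positivity)]
    nlinarith
  linarith

theorem Constants.nonsmooth_zero {m : ℕ} (c : Constants m) (D : ℝ) : c.nonsmooth D 0 = c.H₀ := by
  unfold Constants.nonsmooth
  rw [max_eq_right (by linarith [c.one_le_B])]
  simp

end ConEx

open ConEx in
theorem theorem2p1
    {E : Type*} [NormedAddCommGroup E] [NormedSpace ℝ E] [FiniteDimensional ℝ E]
    [MeasurableSpace E] [BorelSpace E]
    {S : Type*} [MeasurableSpace S]
    {Ω : Type*} [MeasurableSpace Ω] (μ : Measure Ω) [IsProbabilityMeasure μ]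
    {m : ℕ} (p : Problem E m) (hp : p.IsConvex)
    (d : DistGen p.X) (c : Constants m) (hreg : p.Regular d c)
    (P : Measure S) [IsProbabilityMeasure P] (o : Oracle E m S)
    (f₀' : E → StrongDual ℝ E) (f' : Fin m → E → StrongDual ℝ E)
    (ho : o.IsStochasticOracle p c P f₀' f')
    (ξ ξbar : ℕ → Ω → S) (hξ : AreSamples μ P ξ ξbar)
    (xs : E) (ys : Vec m) (hs : p.IsSaddlePoint xs ys)
    (x₀ : E) (hx₀ : x₀ ∈ p.X) (T : ℕ) (hT : 1 ≤ T)
    (x : Ω → ℕ → E) (y : Ω → ℕ → Vec m)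
    (hrun : ∀ w, IsConExRun p d o c.θ c.η (c.τ d.diam T) T x₀ 0
      (fun t => ξ t w) (fun t => ξbar t w) (x w) (y w)) :
    (Integrable (fun w => p.ψ₀ (avgIterate c.γ T (x w)) - p.ψ₀ xs) μ ∧
      ∫ w, (p.ψ₀ (avgIterate c.γ T (x w)) - p.ψ₀ xs) ∂μ
        ≤ c.α₀ * (c.t₀ + 1) * (c.t₀ + 2) * d.diam ^ 2 / (T : ℝ) ^ 2
          + 12 * c.B * c.σX d.diam * (c.t₀ + 1) * Real.sqrt (c.t₀ + 2) / (T : ℝ) ^ (3 / 2 : ℝ)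
          + 16 * (c.ζ d.diam ‖ys‖ ^ 2 + c.H₀ ^ 2) / (c.α₀ * T)
          + 8 * c.B * Real.sqrt (c.t₀ + 2) * c.σX d.diam / (T : ℝ) ^ (1 / 2 : ℝ)) ∧
    (Integrable (fun w => ‖posVec (p.ψ (avgIterate c.γ T (x w)))‖) μ ∧
      ∫ w, ‖posVec (p.ψ (avgIterate c.γ T (x w)))‖ ∂μ
        ≤ 192 * (c.t₀ + 2) * (‖ys‖ + 1) ^ 2 * c.calM ^ 2 / (c.α₀ * (T : ℝ) ^ 2)
          + c.α₀ * (c.t₀ + 1) * (c.t₀ + 2) * d.diam ^ 2 / (T : ℝ) ^ 2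
          + 13 * c.B * c.σX d.diam * (c.t₀ + 1) * Real.sqrt (c.t₀ + 2) / (T : ℝ) ^ (3 / 2 : ℝ)
          + 16 * (c.ζ d.diam ‖ys‖ ^ 2 + c.calH d.diam ‖ys‖ ^ 2
              + 144 * (c.t₀ + 2) * (‖ys‖ + 1) ^ 2 * c.σNorm ^ 2) / (c.α₀ * T)
          + (6 * Real.sqrt (c.t₀ + 2) * (‖ys‖ + 1) ^ 2 * c.σX d.diam / c.B
              + 26 * c.B * Real.sqrt (c.t₀ + 2) * c.σX d.diam / 3) / (T : ℝ) ^ (1 / 2 : ℝ)) ∧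
    (Integrable (fun w => d.W xs (x w T)) μ ∧
      ∫ w, d.W xs (x w T) ∂μ
        ≤ 192 * (c.t₀ + 2) * (‖ys‖ + 1) ^ 2 * c.calM ^ 2 / (c.α₀ ^ 2 * (T : ℝ) ^ 2)
          + (c.t₀ + 1) * (c.t₀ + 2) * d.diam ^ 2 / (T : ℝ) ^ 2
          + 12 * c.B * c.σX d.diam * (c.t₀ + 1) * Real.sqrt (c.t₀ + 2)
              / (c.α₀ * (T : ℝ) ^ (3 / 2 : ℝ))
          + 16 * (c.ζ d.diam ‖ys‖ ^ 2 + c.calH d.diam ‖ys‖ ^ 2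
              + 144 * (c.t₀ + 2) * (‖ys‖ + 1) ^ 2 * c.σNorm ^ 2) / (c.α₀ ^ 2 * T)
          + Real.sqrt (c.t₀ + 2) * ‖ys‖ ^ 2 * c.σX d.diam / (c.B * c.α₀)
              * (1 / (T : ℝ) ^ (1 / 2 : ℝ))
          + 8 * c.B * Real.sqrt (c.t₀ + 2) * c.σX d.diam / (c.α₀ * (T : ℝ) ^ (1 / 2 : ℝ))) := by
  obtain ⟨k, rfl⟩ : ∃ k, T = k + 1 := ⟨T - 1, by omega⟩
  have h : StochasticRun μ P p d c o f₀' f' (c.τ d.diam (k + 1)) (k + 1) x₀ ξ ξbar x y :=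
    ⟨hp, hreg, ho, hξ, hx₀, hrun⟩
  have hα := c.α₀_pos
  have hB := c.one_le_B
  have ht := c.two_le_t₀
  have hX := c.σX_nonneg d.diam
  have hΓ := c.sum_γ_pos k
  have hN := norm_nonneg ys
  have hr : 2 ≤ Real.sqrt (c.t₀ + 2) := Real.le_sqrt_of_sq_le (by linarith)
  have hr2 : Real.sqrt (c.t₀ + 2) ^ 2 = c.t₀ + 2 := Real.sq_sqrt (by linarith)
  have hn0 : (0 : ℝ) < (k + 1 : ℕ) := by positivity
  have hQ : 0 < Real.sqrt (k + 1 : ℕ) := Real.sqrt_pos.2 hn0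
  have hHle : c.nonsmooth d.diam ‖ys‖ ≤ c.calH d.diam ‖ys‖ :=
    c.nonsmooth_mono d.diam_nonneg (by linarith)
  have hH2 := pow_le_pow_left₀ (c.nonsmooth_nonneg d.diam_nonneg hN) hHle 2
  have hζ := sq_nonneg (c.ζ d.diam ‖ys‖)
  have hmaj := fun (R ε K : ℝ) (hε : 0 < ε) (hK : c.IsDualScale d.diam (k + 1) K)
    (hKle : K ≤ c.dualScaleSum d.diam (k + 1) + ε) => hK.meanMajorant_le (R := R) hKle hε.le hζ
  rw [Constants.rpow_three_halves hn0.le, ← Real.sqrt_eq_rpow]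
  refine ⟨?_, ?_, ?_⟩
  · -- the excess of the scale does not matter here, as it is multiplied by `‖Y‖² = 0`
    obtain ⟨K, hK, hKle, hd⟩ := h.exists_dualScale hT hs one_pos
    refine (h.integralLE_ψ₀ hs hK hd).mono ?_
    rw [inv_mul_le_iff₀ hΓ]
    refine (hmaj 0 1 K one_pos hK hKle).trans (mul_le_mul_of_nonneg_left (le_of_eq ?_) hΓ.le)
    rw [c.nonsmooth_zero]
    ring
  · refine IntegralLE.of_forall_pos (C := (c.t₀ + 2) * (‖ys‖ + 1) ^ 2) (by positivity)
      fun ε hε => ?_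
    obtain ⟨K, hK, hKle, hd⟩ := h.exists_dualScale hT hs hε
    refine (h.integralLE_infeasibility hs hK hd).mono ?_
    rw [inv_mul_le_iff₀ hΓ]
    refine (add_le_add_left (hmaj (‖ys‖ + 1) ε K hε hK hKle) _).trans ?_
    rw [mul_left_comm, ← mul_add]
    refine mul_le_mul_of_nonneg_left ?_ hΓ.le
    rw [show c.nonsmooth d.diam (‖ys‖ + 1) = c.calH d.diam ‖ys‖ from rfl]
    -- Young's inequality for the noise that is paired with the random dual reference point
    have e1 : (‖ys‖ + 1) * (3 * c.σX d.diam / Real.sqrt (k + 1 : ℕ))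
        ≤ (5 * Real.sqrt (c.t₀ + 2) * (‖ys‖ + 1) ^ 2 * c.σX d.diam / c.B
          + 2 / 3 * c.B * Real.sqrt (c.t₀ + 2) * c.σX d.diam) / Real.sqrt (k + 1 : ℕ) := by
      have e2 : 3 * (‖ys‖ + 1) ≤ 5 * Real.sqrt (c.t₀ + 2) * (‖ys‖ + 1) ^ 2 / c.B
          + 2 / 3 * c.B * Real.sqrt (c.t₀ + 2) := by
        have e3 : 3 * (‖ys‖ + 1) ≤ 2 * (5 * (‖ys‖ + 1) ^ 2 / c.B + 2 / 3 * c.B) := by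
          have e4 : 5 * (‖ys‖ + 1) ^ 2 / c.B + 2 / 3 * c.B
              = (5 * (‖ys‖ + 1) ^ 2 + 2 / 3 * c.B ^ 2) / c.B := by field_simp
          rw [e4, mul_div_assoc', le_div_iff₀ (by positivity)]
          nlinarith [sq_nonneg (‖ys‖ + 1 - c.B / 3), sq_nonneg (‖ys‖ + 1), sq_nonneg c.B]
        have e5 := mul_le_mul_of_nonneg_right hr
          (show 0 ≤ 5 * (‖ys‖ + 1) ^ 2 / c.B + 2 / 3 * c.B by positivity)
        refine e3.trans (e5.trans (le_of_eq ?_))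
        ring
      rw [mul_div_assoc']
      refine div_le_div_of_nonneg_right ?_ hQ.le
      have e6 := mul_le_mul_of_nonneg_right e2 hX
      refine le_trans (le_of_eq ?_) (e6.trans (le_of_eq ?_)) <;> ring
    have e7 : 0 ≤ c.B * c.σX d.diam * (c.t₀ + 1) * Real.sqrt (c.t₀ + 2)
      / Real.sqrt (k + 1 : ℕ) ^ 3 := by positivity
    have e8 : 0 ≤ 160 * (c.t₀ + 2) * (‖ys‖ + 1) ^ 2 * c.calM ^ 2
      / (c.α₀ * ((k + 1 : ℕ) : ℝ) ^ 2) := by positivity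
    have e9 : 0 ≤ 1918 * (c.t₀ + 2) * (‖ys‖ + 1) ^ 2 * c.σNorm ^ 2
      / (c.α₀ * ((k + 1 : ℕ) : ℝ)) := by positivity
    refine (add_le_add_right e1 _).trans
      ((le_add_of_nonneg_right (add_nonneg (add_nonneg e7 e8) e9)).trans (le_of_eq ?_))
    ring
  · refine IntegralLE.of_forall_pos (C := (c.t₀ + 2) * ‖ys‖ ^ 2 / c.α₀) (by positivity)
      fun ε hε => ?_
    obtain ⟨K, hK, hKle, hd⟩ := h.exists_dualScale hT hs hε
    refine (h.integralLE_W hs hK hd).mono ?_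
    rw [inv_mul_le_iff₀ (mul_pos hα hΓ)]
    refine (hmaj ‖ys‖ ε K hε hK hKle).trans ?_
    rw [mul_comm c.α₀ (∑ t ∈ Finset.range (k + 1), c.γ t),
      mul_assoc (∑ t ∈ Finset.range (k + 1), c.γ t)]
    refine mul_le_mul_of_nonneg_left ?_ hΓ.le
    have hN2 : ‖ys‖ ^ 2 ≤ (‖ys‖ + 1) ^ 2 := by nlinarith
    have e1 : (c.t₀ + 2) * ‖ys‖ ^ 2 * (32 * c.calM ^ 2 / (c.α₀ * ((k + 1 : ℕ) : ℝ) ^ 2)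
          + 386 * c.σNorm ^ 2 / (c.α₀ * (k + 1 : ℕ)) + ε)
        ≤ (c.t₀ + 2) * (‖ys‖ + 1) ^ 2 * (192 * c.calM ^ 2 / (c.α₀ * ((k + 1 : ℕ) : ℝ) ^ 2)
          + 2304 * c.σNorm ^ 2 / (c.α₀ * (k + 1 : ℕ))) + (c.t₀ + 2) * ‖ys‖ ^ 2 * ε := by
      rw [mul_add _ _ ε]
      gcongr <;> norm_num
    have e2 : 16 * (c.ζ d.diam ‖ys‖ ^ 2 + c.nonsmooth d.diam ‖ys‖ ^ 2) / (c.α₀ * (k + 1 : ℕ))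
        ≤ 16 * (c.ζ d.diam ‖ys‖ ^ 2 + c.calH d.diam ‖ys‖ ^ 2) / (c.α₀ * (k + 1 : ℕ)) := by
      gcongr
    refine (add_le_add_left (add_le_add_left (add_le_add (add_le_add_left (add_le_add_right e1 _) _)
      e2) _) _).trans (le_of_eq ?_)
    field_simp
    ring
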